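/- **Plant.** Consider $x(t+1)=Ax(t)+v_x(t)+w_x(t)+Bu(t)$, $e(t)=Cx(t)+v_e(t)+w_e(t)$ with $x\in\mathbb R^n$, $u\in\mathbb R^m$, $e\in\mathbb R^p$, $(A,B)$ controllable, $(A,C)$ observable, and constraints $x(t)\in\mathbb X$, $u(t)\in\mathbb U$ with $\mathbb X,\mathbb U$ compact and convex. Put $v(t)=(v_x(t),v_e(t+1))$ and $w(t)=(w_x(t),w_e(t+1))$. For $p(z)=\sum_{i=0}^{n_p}p_iz^{-i}$ with $n_p\ge 1$, $p_0=1$, $p_{n_p}\ne0$, write $p(z)\{s\}(t)=\sum_{i=0}^{n_p}p_is(t-i)$; $p(z)\{s\}=0$ means that this vanishes for all $t\in\mathbb N_0$. The generator $p$ is stable: all solutions of $p(z)\{s\}=0$ are bounded for $t\ge0$. The disturbance $v$ satisfies $p(z)\{v\}=0$, and $w(t)\in\mathbb W=\mathbb W_x\times\mathbb W_e$, where $\mathbb W_x,\mathbb W_e$ are compact with $0$ in their interior; all this holds from time $-n_p$ on (initialization phase). Regulation is well-posed: for all $v_x,v_e$ generated by $p$ there is exactly one pair $(x,u)$ generated by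 $p$ with $x(t+1)=Ax(t)+v_x(t)+Bu(t)$ and $0=Cx(t)+v_e(t)$. **Prediction model.** Write $s([t,t'])=(s(t),s(t-1),\dots,s(t'))$ and $\xi(t)=(\Delta x(t),\,e([t,t-n_p+1]),\,x([t,t-n_p+1]),\,u([t-1,t-n_p]))$ with $\Delta x=p(z)\{x\}$, and $\Delta u=p(z)\{u\}$. The nominal model $\xi^+=A_\xi\xi+B_\xi\Delta u$ is $\Delta x^+=A\Delta x+B\Delta u$, $e^+=C\Delta x^+-\sum_{i=0}^{n_p-1}p_{i+1}e(t-i)$, $x^+=\Delta x^+-\sum_{i=0}^{n_p-1}p_{i+1}x(t-i)$, $u(t)=\Delta u-\sum_{i=1}^{n_p}p_iu(t-i)$. $C_{\Delta x},C_x,C_e$ read off $\Delta x(t),x(t),e(t)$ from $\xi(t)$, $C_u$ reads off $u(t-1)$, and $M_e$ reads off the output window. $T_v\xi$ stacks, for $i=1,\dots,n_p$, the vectors $(x(t+1-i)-Ax(t-i)-Bu(t-i),\ e(t+1-i)-Cx(t+1-i))$, where $x(t-n_p)$ is recovered from $\Delta x(t)$. Put $\mathbf v(t)=v([t-1,t-n_p])$,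 and let $S$ be the matrix with $\mathbf v(t+1)=S\mathbf v(t)$ for $p(z)\{v\}=0$. **Controller.** $\Delta u=K_x\Delta x+K_ee([t,t+1-n_p])$ asymptotically stabilizes the $(\Delta x,e)$-subsystem, and $u(t)=\Delta u(t)-\sum_{i\ge1}p_iu(t-i)=:K\xi(t)$. It is realized as $x_c(t+1)=A_cx_c(t)+B_ce(t)$, $u(t)=C_cx_c(t)+D_ce(t)+K_xx(t)$ with $x_c=T_c\xi\in\mathbb R^{pn_p}$. With $T_0\xi=(C_x\xi,T_c\xi)$, the map $\xi\mapsto(T_0\xi,T_v\xi)$ is bijective. **Sets.** $\mathbb V\subseteq\mathbb R^{n_p(n+p)}$ is convex, $S\mathbb V\subseteq\mathbb V$, and $S^t\mathbb W^{n_p}\subseteq\mathbb V$ for all $t\ge0$. $\mathbb V_1$ is the set of all $(\hat v_x(t),\hat v_e(t))$ for $p$-generated $\hat v$ with window $\hat v([t-1,t-n_p])\in-\mathbb V$. $\mathbb S$ is compact, convex and robustly positively invariant for $$(\hat x,\hat x_c)\mapsto\begin{bmatrix}A+B(K_x+D_cC)&BC_c\\B_cC&A_c\end{bmatrix}\begin{bmatrix}\hat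 x\\\hat x_c\end{bmatrix}+\begin{bmatrix}I&BD_c\\0&B_c\end{bmatrix}\delta,\qquad \delta\in\mathbb V_1\oplus\mathbb W .$$ $\mathbb S_x=[I,0]\mathbb S$ and $\mathbb S_u=[K_x+D_cC,\,C_c]\mathbb S\oplus D_c\mathbb W_e\oplus D_c[0,I]\mathbb V_1$. For a fixed $\sigma>1$, $\mathcal Z_a$ is the set of all $\xi$ such that for all $t\ge0$: $C_uA_\xi^t\xi\in\mathbb U\ominus\sigma\mathbb S_u$, $C_xA_\xi^t\xi\in\mathbb X\ominus\sigma\mathbb S_x$, $C_{\Delta x}A_\xi^t\xi=0$. **Costs.** $V(e)=\|e\|_P^2$ with $P\succ0$ such that $V$ does not increase along output windows of solutions of $p(z)\{e\}=0$; $l(\xi,\Delta u)=\|C_{\Delta x}\xi\|^2_{Q_{\Delta x}}+\|C_e\xi\|^2_{Q_e}+\|\Delta u\|_R^2$ with $Q_{\Delta x}\succeq0$, $Q_e\in\mathbb R^{p\times p}$, $Q_e\succ0$, $R\succ0$; $\lambda\ge0$. For an extended state $\xi$, the optimal reachable reference $\xi^d(\xi)$ minimizes $V(M_e\zeta)$ over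 all $\zeta\in\mathcal Z_a$ for which some input sequence $\Delta u(\cdot)$ steers the nominal trajectory $\xi(\cdot)$ from $\xi$ such that $\xi(t)-A_\xi^t\zeta\to0$. **MPC.** $J^*(\xi,\bar{\mathbf v})$ is the minimum of $\sum_{k=0}^{N-1}l(\xi_k-\xi_{a,k},\Delta u_k)+\lambda\tau^2+V(M_e\xi_{a,0})$ over $\Delta u_0,\dots,\Delta u_{N-1},\xi_0,\xi_{a,0},\tau$ subject to $\xi_{k+1}=A_\xi\xi_k+B_\xi\Delta u_k$, $\xi_{a,k+1}=A_\xi\xi_{a,k}$, $C_x\xi_k\in\mathbb X\ominus\mathbb S_x$ and $u_k=\Delta u_k-\sum_{i\ge1}p_iu_{k-i}\in\mathbb U\ominus\mathbb S_u$ for $k=0,\dots,N$ (with $\Delta u_N=0$), $T_v\xi_0=\tau\bar{\mathbf v}+(1-\tau)T_v\xi$, $\tau\in[0,1]$, $T_0(\xi-\xi_0)\in\mathbb S$, $\xi_N=\xi_{a,N}$, $\xi_{a,0}\in\mathcal Z_a$. With any choice of optimizers (marked $^*$) at each time, the control law is $u(t)=u_0^*(t)+K(\xi(t)-\xi_0^*(t))$,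 $\bar{\mathbf v}(t+1)=T_v\xi_1^*(t)$. **Theorem.** Let $N>n_p(n+p+m)+n$, $\bar{\mathbf v}(0)\in\mathbf v(0)\oplus\mathbb V$, and let the problem $J^*(\xi(0),\bar{\mathbf v}(0))$ be feasible. Under the control law the following holds. (i) The problem $J^*(\xi(t),\bar{\mathbf v}(t))$ is feasible and has an optimizer for all $t\in\mathbb N_0$. (ii) $x(t)\in\mathbb X$ and $u(t)\in\mathbb U$ for all $t\in\mathbb N_0$. For (iii) and (iv) suppose in addition that $p$ has no decaying modes (the only solution of $p(z)\{s\}=0$ tending to $0$ is $s=0$) and that $\ker A\cap\ker Q_{\Delta x}=\{0\}$ (e.g. $A$ invertible or $Q_{\Delta x}\succ0$). (iii) If $\lambda=0$, then for every $t$ the reference $\xi^d(\xi_0^*(t))$ exists and is unique, and $\lim_{t\to\infty}\xi_0^*(t)-\xi^d(\xi_0^*(t))=0$. (iv) If $\lambda>0$ and $p(z)\{w\}=0$, then the same holds, and $\lim_{t\to\infty}e(t)-C_e\xi^d(\xi_0^*(t))=0$. (v) For all $\sigma_1,\sigma_2\in[0,1)$ there is an $\epsilon>0$ such that, for every $t_0\in\mathbb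 N_0$ and every $\Delta v\in\mathbb R^{n+p}$ with $\|\Delta v\|<\epsilon$: if the generated disturbance jumps at $t_0$, i.e. $v(t_0)=\Delta v-\sum_{i=1}^{n_p}p_iv(t_0-i)$ while $p(z)\{v\}(t)=0$ for all $t\in\mathbb N_0\setminus\{t_0\}$, and if $w(t)\in\sigma_1\mathbb W$ for all $t\in\mathbb N_0$ and $\bar{\mathbf v}(t_0)\in\mathbf v(t_0)\oplus\sigma_2\mathbb V$, then (i)–(iv) still hold. -/

import Mathlib

open Filter Topology Matrix
open scoped Pointwise

noncomputable section

namespace TubeMPC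

/-! ### Delay polynomials `p(z) = ∑_{i=0}^{d} c i • z^{-i}` -/

/-- The signal `p(z){s}` at time `t`, for `p(z) = ∑_{i=0}^{d} c i z^{-i}`. -/
def delayFilter (c : ℕ → ℝ) (d : ℕ) {E : Type*} [AddCommMonoid E] [Module ℝ E]
    (s : ℤ → E) (t : ℤ) : E :=
  ∑ i ∈ Finset.range (d + 1), c i • s (t - i)

/-- The signal generator is (Lyapunov) stable: every solution of `p(z){s} = 0` is bounded
in forward time. -/
def StableGenerator (c : ℕ → ℝ) (d : ℕ) : Prop :=
  ∀ s : ℤ → ℝ, (∀ t : ℤ, delayFilter c d s t = 0) → ∃ b : ℝ, ∀ t : ℕ, |s t| ≤ b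

/-- The signal generator has no decaying modes: the only solution of `p(z){s} = 0` that tends
to zero is the zero solution. -/
def PersistentGenerator (c : ℕ → ℝ) (d : ℕ) : Prop :=
  ∀ s : ℤ → ℝ, (∀ t : ℤ, delayFilter c d s t = 0) →
    Tendsto (fun t : ℕ => s t) atTop (𝓝 0) → ∀ t : ℤ, s t = 0

/-- Put a new value at the head of a window of length `d`, dropping the oldest entry. -/
def push {d : ℕ} {E : Type*} (new : E) (w : Fin d → E) : Fin d → E :=
  fun i => if (i : ℕ) = 0 then new else w ⟨(i : ℕ) - 1, by omega⟩

/-- `-∑_{i=1}^{d} c i • s(t+1-i)`, where the window `w` holds `s(t), s(t-1), …, s(t-d+1)`. -/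
def genNext (c : ℕ → ℝ) {d : ℕ} {E : Type*} [AddCommGroup E] [Module ℝ E]
    (w : Fin d → E) : E :=
  -∑ i : Fin d, c ((i : ℕ) + 1) • w i

/-- The state-space realization `S` of `p(z)`, acting on windows of past values. -/
def genStep (c : ℕ → ℝ) {d : ℕ} {E : Type*} [AddCommGroup E] [Module ℝ E]
    (w : Fin d → E) : Fin d → E :=
  push (genNext c w) w

/-! ### Generic notions -/

/-- Controllability of `(A, B)` (Kalman rank condition). -/
def Controllable {n m : ℕ} (A : Matrix (Fin n) (Fin n) ℝ) (B : Matrix (Fin n) (Fin m) ℝ) : Prop :=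
  (⨆ k : Fin n, LinearMap.range (A ^ (k : ℕ) * B).mulVecLin) = ⊤

/-- Observability of `(A, C)` (Kalman rank condition). -/
def Observable {n p : ℕ} (A : Matrix (Fin n) (Fin n) ℝ) (C : Matrix (Fin p) (Fin n) ℝ) : Prop :=
  ∀ x : Fin n → ℝ, (∀ k : Fin n, (C * A ^ (k : ℕ)) *ᵥ x = 0) → x = 0

/-- Pontryagin difference `X ⊖ Y`. -/
def pdiff {E : Type*} [Add E] (X Y : Set E) : Set E := {x | ∀ y ∈ Y, x + y ∈ X}

/-- The quadratic form `‖x‖²_Q = xᵀ Q x`. -/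
def quad {ι : Type*} [Fintype ι] (Q : Matrix ι ι ℝ) (x : ι → ℝ) : ℝ := x ⬝ᵥ (Q *ᵥ x)

/-! ### The extended state -/

/-- The extended state
`ξ(t) = (Δx(t), e([t, t-d+1]), x([t, t-d+1]), u([t-1, t-d]))`, where `d` is the order of `p(z)`. -/
abbrev ExtState (n m p d : ℕ) : Type :=
  (Fin n → ℝ) × (Fin d → Fin p → ℝ) × (Fin d → Fin n → ℝ) × (Fin d → Fin m → ℝ)

/-- A value `v(t) = (v_x(t), v_e(t+1))` of the disturbance. -/
abbrev Dist (n p : ℕ) : Type := (Fin n → ℝ) × (Fin p → ℝ)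

/-- A window `(v(t-1), …, v(t-d))` of past disturbances. -/
abbrev DistWindow (n p d : ℕ) : Type := Fin d → Dist n p

/-- A state `(x, x_c)` of the closed loop, `x_c` being the state of the controller. -/
abbrev LoopState (n p d : ℕ) : Type := (Fin n → ℝ) × (Fin d × Fin p → ℝ)

namespace ExtState

variable {n m p d : ℕ}

def dx (ξ : ExtState n m p d) : Fin n → ℝ := ξ.1

/-- The window `M_e ξ = e([t, t-d+1])`. -/
def eWin (ξ : ExtState n m p d) : Fin d → Fin p → ℝ := ξ.2.1

def xWin (ξ : ExtState n m p d) : Fin d → Fin n → ℝ := ξ.2.2.1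

def uWin (ξ : ExtState n m p d) : Fin d → Fin m → ℝ := ξ.2.2.2

/-- The current output `C_e ξ = e(t)`. -/
def e [NeZero d] (ξ : ExtState n m p d) : Fin p → ℝ := ξ.2.1 0

/-- The current state `C_x ξ = x(t)`. -/
def x [NeZero d] (ξ : ExtState n m p d) : Fin n → ℝ := ξ.2.2.1 0

/-- The last input `C_u ξ = u(t-1)`. -/
def uPrev [NeZero d] (ξ : ExtState n m p d) : Fin m → ℝ := ξ.2.2.2 0

end ExtState

/-! ### Plant and design data -/

/-- The plant, the signal generator, the constraint and disturbance sets, and the design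
parameters of the controller (data only). -/
structure Data (n m p d N : ℕ) where
  /-- plant matrices -/
  A : Matrix (Fin n) (Fin n) ℝ
  B : Matrix (Fin n) (Fin m) ℝ
  C : Matrix (Fin p) (Fin n) ℝ
  /-- coefficients of `p(z) = ∑_{i=0}^{d} c i z^{-i}` -/
  c : ℕ → ℝ
  /-- state and input constraints -/
  X : Set (Fin n → ℝ)
  U : Set (Fin m → ℝ)
  /-- bounds on the unstructured disturbances -/
  Wx : Set (Fin n → ℝ)
  We : Set (Fin p → ℝ)
  /-- stabilizing gains: `Δu = K_x Δx + ∑_i K_e i e(t-i)` -/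
  Kx : Matrix (Fin m) (Fin n) ℝ
  Ke : Fin d → Matrix (Fin m) (Fin p) ℝ
  /-- state-space form of the controller, with controller state `x_c = T_c ξ` -/
  Ac : Matrix (Fin d × Fin p) (Fin d × Fin p) ℝ
  Bc : Matrix (Fin d × Fin p) (Fin p) ℝ
  Cc : Matrix (Fin m) (Fin d × Fin p) ℝ
  Dc : Matrix (Fin m) (Fin p) ℝ
  Tc : ExtState n m p d →ₗ[ℝ] (Fin d × Fin p → ℝ)
  /-- invariant set for the disturbance state, and RPI set for `(x, x_c)` -/
  V : Set (DistWindow n p d)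
  S : Set (LoopState n p d)
  /-- tightening factor of the artificial references -/
  σ : ℝ
  /-- weights -/
  Qdx : Matrix (Fin n) (Fin n) ℝ
  Qe : Matrix (Fin p) (Fin p) ℝ
  R : Matrix (Fin m) (Fin m) ℝ
  P : Matrix (Fin d × Fin p) (Fin d × Fin p) ℝ
  lam : ℝ

/-- The decision variables of the MPC problem: `Δu_0, …, Δu_{N-1}`, `ξ_0`, `ξ_{a,0}` and `τ`. -/
structure Decision (n m p d N : ℕ) where
  du : Fin N → Fin m → ℝ
  ξ0 : ExtState n m p d
  ξa0 : ExtState n m p d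
  τ : ℝ

namespace Data

variable {n m p d N : ℕ} [NeZero d] (D : Data n m p d N)

/-- The prediction model in incremental form, with increments `ωx = Δw_x(t)` and
`ωe = Δw_e(t+1)` of the unstructured disturbance. -/
def predStep (ξ : ExtState n m p d) (Δu : Fin m → ℝ) (ωx : Fin n → ℝ) (ωe : Fin p → ℝ) :
    ExtState n m p d :=
  let dx' : Fin n → ℝ := D.A *ᵥ ξ.dx + D.B *ᵥ Δu + ωx
  (dx',
   push (D.C *ᵥ dx' + genNext D.c ξ.eWin + ωe) ξ.eWin,
   push (dx' + genNext D.c ξ.xWin) ξ.xWin,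
   push (genNext D.c ξ.uWin + Δu) ξ.uWin)

/-- The nominal model `A_ξ ξ + B_ξ Δu`. -/
def step (ξ : ExtState n m p d) (Δu : Fin m → ℝ) : ExtState n m p d :=
  D.predStep ξ Δu 0 0

/-- The autonomous nominal evolution `A_ξ^t ξ`. -/
def free (t : ℕ) (ξ : ExtState n m p d) : ExtState n m p d :=
  (fun ζ => D.step ζ 0)^[t] ξ

/-- The nominal trajectory from `ξ` under the input increments `Δu`. -/
def traj (ξ : ExtState n m p d) (Δu : ℕ → Fin m → ℝ) : ℕ → ExtState n m p d
  | 0 => ξ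
  | t + 1 => D.step (traj ξ Δu t) (Δu t)

/-- The state `x(t-1-i)` encoded in `ξ(t)`; the oldest one is recovered from
`p_d x(t-d) = Δx(t) - ∑_{j<d} p_j x(t-j)`. -/
def xOld (ξ : ExtState n m p d) (i : Fin d) : Fin n → ℝ :=
  if h : (i : ℕ) + 1 < d then ξ.xWin ⟨(i : ℕ) + 1, h⟩
  else (D.c d)⁻¹ • (ξ.dx - ∑ j : Fin d, D.c j • ξ.xWin j)

/-- The disturbance state `T_v ξ(t)` embedded in the extended state; its entry `i` is
`(x(t-i) - A x(t-1-i) - B u(t-1-i), e(t-i) - C x(t-i))`. -/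
def Tv (ξ : ExtState n m p d) : DistWindow n p d :=
  fun i => (ξ.xWin i - D.A *ᵥ D.xOld ξ i - D.B *ᵥ ξ.uWin i, ξ.eWin i - D.C *ᵥ ξ.xWin i)

/-- `T_0 ξ = (C_x ξ, T_c ξ)`. -/
def T0 (ξ : ExtState n m p d) : LoopState n p d := (ξ.x, D.Tc ξ)

/-- The stabilizing feedback in incremental form. -/
def dK (ξ : ExtState n m p d) : Fin m → ℝ :=
  D.Kx *ᵥ ξ.dx + ∑ i : Fin d, D.Ke i *ᵥ ξ.eWin i

/-- The stabilizing feedback `K ξ`, giving `u(t)` from `ξ(t)`. -/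
def K (ξ : ExtState n m p d) : Fin m → ℝ := D.dK ξ + genNext D.c ξ.uWin

/-! #### Disturbance and tube sets -/

/-- `W = W_x × W_e`. -/
def W : Set (Dist n p) := D.Wx ×ˢ D.We

/-- All possible values of `(v̂_x(t), v̂_e(t))`, where the error `v̂ = v - v_n` between the true and
the nominal disturbance has a disturbance state `v̂([t-1, t-d])` in `-V`. -/
def V1 : Set (Dist n p) :=
  (fun v : DistWindow n p d => (-(genStep D.c v 0).1, -(v 0).2)) '' D.V

/-- The closed-loop error dynamics
`[A + B(K_x + D_c C), B C_c; B_c C, A_c] s + [I, B D_c; 0, B_c] δ`. -/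
def errStep (s : LoopState n p d) (δ : Dist n p) : LoopState n p d :=
  ((D.A + D.B * (D.Kx + D.Dc * D.C)) *ᵥ s.1 + (D.B * D.Cc) *ᵥ s.2 + δ.1 + (D.B * D.Dc) *ᵥ δ.2,
   (D.Bc * D.C) *ᵥ s.1 + D.Ac *ᵥ s.2 + D.Bc *ᵥ δ.2)

/-- `S_x = [I, 0] S`. -/
def Sx : Set (Fin n → ℝ) := Prod.fst '' D.S

/-- `S_u = [K_x + D_c C, C_c] S ⊕ D_c W_e ⊕ D_c [0, I] V_1`. -/
def Su : Set (Fin m → ℝ) :=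
  (fun s : LoopState n p d => (D.Kx + D.Dc * D.C) *ᵥ s.1 + D.Cc *ᵥ s.2) '' D.S
    + (fun w : Fin p → ℝ => D.Dc *ᵥ w) '' D.We
    + (fun v : Dist n p => D.Dc *ᵥ v.2) '' D.V1

/-! #### Artificial references and costs -/

/-- The set `Z_a` of artificial references. -/
def Za : Set (ExtState n m p d) :=
  {ξ | ∀ t : ℕ, (D.free t ξ).uPrev ∈ pdiff D.U (D.σ • D.Su) ∧
    (D.free t ξ).x ∈ pdiff D.X (D.σ • D.Sx) ∧ (D.free t ξ).dx = 0}

/-- The output cost `V(e) = ‖e‖²_P` on output windows. -/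
def Vcost (e : Fin d → Fin p → ℝ) : ℝ := quad D.P (fun i => e i.1 i.2)

/-- The stage cost `l(ξ, Δu)`. -/
def stageCost (ξ : ExtState n m p d) (Δu : Fin m → ℝ) : ℝ :=
  quad D.Qdx ξ.dx + quad D.Qe ξ.e + quad D.R Δu

/-- `ζ` is an admissible reference that can be reached asymptotically from `ξ`. -/
def IsReachableRef (ξ ζ : ExtState n m p d) : Prop :=
  ζ ∈ D.Za ∧ ∃ Δu : ℕ → Fin m → ℝ,
    Tendsto (fun t => D.traj ξ Δu t - D.free t ζ) atTop (𝓝 0)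

/-- `ζ` is an optimal reachable reference `ξ^d(ξ)` for `ξ`. -/
def IsOptRef (ξ ζ : ExtState n m p d) : Prop :=
  D.IsReachableRef ξ ζ ∧ ∀ ζ', D.IsReachableRef ξ ζ' → D.Vcost ζ.eWin ≤ D.Vcost ζ'.eWin

/-! #### The MPC problem -/

/-- The increment `Δu_k`, equal to zero from the terminal stage `N` on, where the prediction
continues along the artificial reference. -/
def inc (z : Decision n m p d N) (k : ℕ) : Fin m → ℝ :=
  if h : k < N then z.du ⟨k, h⟩ else 0

/-- The predicted nominal state `ξ_k`. -/
def pred (z : Decision n m p d N) (k : ℕ) : ExtState n m p d := D.traj z.ξ0 (inc z) k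

/-- The artificial reference `ξ_{a,k}`. -/
def art (z : Decision n m p d N) (k : ℕ) : ExtState n m p d := D.free k z.ξa0

/-- The predicted input `u_k = Δu_k - ∑_{i=1}^{d} p_i u_{k-i}`. -/
def predInput (z : Decision n m p d N) (k : ℕ) : Fin m → ℝ :=
  inc z k + genNext D.c (D.pred z k).uWin

/-- The constraints of the MPC problem for the extended state `ξ` and the fallback `vbar`. -/
structure IsFeasible (ξ : ExtState n m p d) (vbar : DistWindow n p d)
    (z : Decision n m p d N) : Prop where
  state_mem : ∀ k ≤ N, (D.pred z k).x ∈ pdiff D.X D.Sx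
  input_mem : ∀ k ≤ N, D.predInput z k ∈ pdiff D.U D.Su
  tau_mem : z.τ ∈ Set.Icc (0 : ℝ) 1
  init_dist : D.Tv z.ξ0 = z.τ • vbar + (1 - z.τ) • D.Tv ξ
  init_loop : D.T0 (ξ - z.ξ0) ∈ D.S
  terminal : D.pred z N = D.art z N
  art_mem : z.ξa0 ∈ D.Za

/-- The cost of the MPC problem. -/
def cost (z : Decision n m p d N) : ℝ :=
  (∑ k : Fin N, D.stageCost (D.pred z k - D.art z k) (z.du k)) + D.lam * z.τ ^ 2
    + D.Vcost z.ξa0.eWin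

/-- `z` is an optimizer of the MPC problem `J^*(ξ, vbar)`. -/
def IsOptimal (ξ : ExtState n m p d) (vbar : DistWindow n p d) (z : Decision n m p d N) : Prop :=
  D.IsFeasible ξ vbar z ∧ ∀ z', D.IsFeasible ξ vbar z' → D.cost z ≤ D.cost z'

/-! #### Standing assumptions -/

/-- The unconstrained output regulation problem is well-posed. -/
def WellPosed : Prop :=
  ∀ (vx : ℤ → Fin n → ℝ) (ve : ℤ → Fin p → ℝ),
    (∀ t, delayFilter D.c d vx t = 0) → (∀ t, delayFilter D.c d ve t = 0) →
    ∃! xu : (ℤ → Fin n → ℝ) × (ℤ → Fin m → ℝ),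
      (∀ t, delayFilter D.c d xu.1 t = 0) ∧ (∀ t, delayFilter D.c d xu.2 t = 0) ∧
      ∀ t : ℤ, xu.1 (t + 1) = D.A *ᵥ xu.1 t + vx t + D.B *ᵥ xu.2 t ∧
        0 = D.C *ᵥ xu.1 t + ve t

/-- The standing assumptions on the plant and on the design data. -/
structure Standing : Prop where
  controllable : Controllable D.A D.B
  observable : Observable D.A D.C
  c_zero : D.c 0 = 1
  c_last : D.c d ≠ 0
  stable : StableGenerator D.c d
  wellPosed : D.WellPosed
  X_compact : IsCompact D.X
  X_convex : Convex ℝ D.X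
  U_compact : IsCompact D.U
  U_convex : Convex ℝ D.U
  Wx_compact : IsCompact D.Wx
  Wx_zero : (0 : Fin n → ℝ) ∈ interior D.Wx
  We_compact : IsCompact D.We
  We_zero : (0 : Fin p → ℝ) ∈ interior D.We
  /-- the feedback asymptotically stabilizes the `(Δx, e)`-subsystem -/
  stabilizing : ∀ ξ : ExtState n m p d,
    Tendsto (fun t : ℕ => ((fun ζ => D.step ζ (D.dK ζ))^[t] ξ).dx) atTop (𝓝 0) ∧
    Tendsto (fun t : ℕ => ((fun ζ => D.step ζ (D.dK ζ))^[t] ξ).eWin) atTop (𝓝 0)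
  /-- `x_c = T_c ξ` obeys `x_c(t+1) = A_c x_c(t) + B_c e(t)` when the feedback is applied -/
  ctrl_state : ∀ (ξ : ExtState n m p d) (ωx : Fin n → ℝ) (ωe : Fin p → ℝ),
    D.Tc (D.predStep ξ (D.dK ξ) ωx ωe) = D.Ac *ᵥ D.Tc ξ + D.Bc *ᵥ ξ.e
  /-- `u(t) = C_c x_c(t) + D_c e(t) + K_x x(t)` when the feedback is applied -/
  ctrl_output : ∀ ξ : ExtState n m p d,
    D.K ξ = D.Cc *ᵥ D.Tc ξ + D.Dc *ᵥ ξ.e + D.Kx *ᵥ ξ.x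
  /-- `T = (T_0, T_v)` is a state-space transformation -/
  transformation : Function.Bijective (fun ξ : ExtState n m p d => (D.T0 ξ, D.Tv ξ))
  V_convex : Convex ℝ D.V
  V_invariant : ∀ v ∈ D.V, genStep D.c v ∈ D.V
  V_contains : ∀ v : DistWindow n p d, (∀ i, v i ∈ D.W) → ∀ t : ℕ, (genStep D.c)^[t] v ∈ D.V
  S_compact : IsCompact D.S
  S_convex : Convex ℝ D.S
  S_rpi : ∀ s ∈ D.S, ∀ δ ∈ D.V1 + D.W, D.errStep s δ ∈ D.S
  sigma_gt : 1 < D.σ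
  Qdx_psd : D.Qdx.PosSemidef
  Qe_pd : D.Qe.PosDef
  R_pd : D.R.PosDef
  P_pd : D.P.PosDef
  P_decrease : ∀ e : Fin d → Fin p → ℝ, D.Vcost (genStep D.c e) ≤ D.Vcost e
  lam_nonneg : 0 ≤ D.lam
  horizon : d * (n + p + m) + n < N

/-- No nonzero increment `Δx` is both unweighted and forgotten by the plant in one step, that is,
`ker A ∩ ker Q_Δx = 0`; otherwise `Δx`-components of `ξ_0` without any effect on the cost or on the
prediction are left undetermined by the optimization. -/
def IncrementWeighted : Prop :=
  ∀ y : Fin n → ℝ, D.A *ᵥ y = 0 → D.Qdx *ᵥ y = 0 → y = 0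

end Data

/-! ### Closed-loop runs -/

/-- The signals of a run of the controlled system. Time starts at `-d` (initialization phase);
the values of the signals before that play no role. `sol t` are the decision variables used by
the controller at time `t`. -/
structure Run (n m p d N : ℕ) where
  x : ℤ → Fin n → ℝ
  u : ℤ → Fin m → ℝ
  e : ℤ → Fin p → ℝ
  vx : ℤ → Fin n → ℝ
  ve : ℤ → Fin p → ℝ
  wx : ℤ → Fin n → ℝ
  we : ℤ → Fin p → ℝ
  vbar : ℕ → DistWindow n p d
  sol : ℕ → Decision n m p d N

namespace Run

variable {n m p d N : ℕ} [NeZero d] (r : Run n m p d N)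

/-- `v(t) = (v_x(t), v_e(t+1))`. -/
def v (t : ℤ) : Dist n p := (r.vx t, r.ve (t + 1))

/-- `w(t) = (w_x(t), w_e(t+1))`. -/
def w (t : ℤ) : Dist n p := (r.wx t, r.we (t + 1))

/-- The disturbance state `v([t-1, t-d])`. -/
def vWin (t : ℤ) : DistWindow n p d := fun i => r.v (t - 1 - (i : ℕ))

/-- The measured extended state `ξ(t)`. -/
def ext (D : Data n m p d N) (t : ℤ) : ExtState n m p d :=
  (delayFilter D.c d r.x t, fun i => r.e (t - (i : ℕ)), fun i => r.x (t - (i : ℕ)),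
    fun i => r.u (t - 1 - (i : ℕ)))

/-- `r` is a run of the plant under the MPC law, started with a feasible problem and an admissible
fallback. The disturbance `v` follows the signal generator, except for a jump `Δv` at time `t₀`
(there is no jump if `Δv = 0`). The control law is only imposed at times where the optimization
problem has a solution. -/
structure IsClosedLoop (D : Data n m p d N) (t₀ : ℕ) (Δv : Dist n p) : Prop where
  dynamics : ∀ t : ℤ, -(d : ℤ) ≤ t →
    r.x (t + 1) = D.A *ᵥ r.x t + r.vx t + r.wx t + D.B *ᵥ r.u t
  output : ∀ t : ℤ, 1 - (d : ℤ) ≤ t → r.e t = D.C *ᵥ r.x t + r.ve t + r.we t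
  generator : ∀ t : ℕ, delayFilter D.c d r.v t = if t = t₀ then Δv else 0
  w_mem : ∀ t : ℤ, -(d : ℤ) ≤ t → r.w t ∈ D.W
  init_vbar : r.vbar 0 - r.vWin 0 ∈ D.V
  init_feasible : ∃ z, D.IsFeasible (r.ext D 0) (r.vbar 0) z
  control : ∀ t : ℕ, (∃ z, D.IsOptimal (r.ext D t) (r.vbar t) z) →
    D.IsOptimal (r.ext D t) (r.vbar t) (r.sol t) ∧
    r.u t = D.predInput (r.sol t) 0 + D.K (r.ext D t - (r.sol t).ξ0) ∧
    r.vbar (t + 1) = D.Tv (D.pred (r.sol t) 1)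

/-- The MPC problem is feasible at all times (and the controller applies an optimizer). -/
def RecursivelyFeasible (D : Data n m p d N) : Prop :=
  ∀ t : ℕ, (∃ z, D.IsFeasible (r.ext D t) (r.vbar t) z) ∧
    D.IsOptimal (r.ext D t) (r.vbar t) (r.sol t)

/-- State and input constraints hold at all times. -/
def SatisfiesConstraints (D : Data n m p d N) : Prop :=
  ∀ t : ℕ, r.x t ∈ D.X ∧ r.u t ∈ D.U

/-- `ζ t` is, at each time, the unique optimal reachable reference `ξ^d(ξ_0^*(t))`. -/
def IsOptRefSeq (D : Data n m p d N) (ζ : ℕ → ExtState n m p d) : Prop :=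
  ∀ t : ℕ, D.IsOptRef (r.sol t).ξ0 (ζ t) ∧ ∀ η, D.IsOptRef (r.sol t).ξ0 η → η = ζ t

/-- The four guarantees for a run. -/
structure Guarantees (D : Data n m p d N) : Prop where
  feasible : r.RecursivelyFeasible D
  constraints : r.SatisfiesConstraints D
  convergence_zero : PersistentGenerator D.c d → D.IncrementWeighted → D.lam = 0 →
    ∃ ζ : ℕ → ExtState n m p d, r.IsOptRefSeq D ζ ∧
      Tendsto (fun t => (r.sol t).ξ0 - ζ t) atTop (𝓝 0)
  convergence_pos : PersistentGenerator D.c d → D.IncrementWeighted → 0 < D.lam →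
    (∀ t : ℕ, delayFilter D.c d r.w t = 0) →
    ∃ ζ : ℕ → ExtState n m p d, r.IsOptRefSeq D ζ ∧
      Tendsto (fun t => (r.sol t).ξ0 - ζ t) atTop (𝓝 0) ∧
      Tendsto (fun t : ℕ => r.e t - (ζ t).e) atTop (𝓝 0)

end Run

end TubeMPC

end

/-!
The decision variables of the MPC problem form a finite-dimensional vector space, `DecVec`, on which
the problem is a convex quadratic program. Every statement about the closed loop is obtained by
exhibiting a suitable feasible decision and comparing its cost with that of the optimizer.

*Feasibility and constraints.* All disturbances are described through the disturbance state `T_v ξ`.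
It is split into a nominal part, which follows the generator `p` forever, and a part whose entries lie
in the convex hull of `W` (`Run.exists_split`). Since `p` is stable, the response to a small jump of
`v` stays small, and the room that `w ∈ σ₁ W` leaves in the convex hull of `W` absorbs it; so a run
with a jump needs no separate treatment. As `𝕊` and `𝕍` are convex, their properties extend from `W`
to its convex hull. The shifted prediction, with the old prediction as fallback (`τ = 1`), is then
feasible at the next time (`Data.tube_step`). An optimizer exists since the set of feasible decisions is
compact: the bijection `T = (T_0, T_v)` and the compactness of `𝕊` bound `ξ_0`, the input constraints
bound the increments, and well-posedness bounds the reference (`Data.exists_norm_feasible_le`).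

*References.* On `Z_a` the increments `Δx` vanish, so `e`, `x` and `u` follow the generator, and
well-posedness says that `T_v` and the output window determine the reference. Under a persistent
generator, `ζ ∈ Z_a` is reachable from `ξ` if and only if `T_v ζ = T_v ξ` (`Data.isReachableRef_iff`):
controllability steers `ker T_v` to zero, and disturbance states which approach each other are equal.
With `P ≻ 0` this gives existence and uniqueness of `ξ^d`.

*Convergence.* The cost being a positive semidefinite quadratic form, the optimal cost grows
quadratically around the optimizer (`Data.IsOptimal.growth`). So the decrease of the optimal cost
controls the first stage cost and the distance between the shifted optimizer and its successor.
If both vanish, then all stage costs vanish one after the other, and with them the deviation from the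
artificial reference (`Data.dev_tendsto_zero`). Near its artificial reference an optimizer could move
towards `ξ^d` at a cost of second order and with a gain of first order; here `σ > 1` provides slack in the
constraints, because `𝕊_x` and `𝕊_u` are neighbourhoods of zero (`Data.Sx_mem_nhds`,
`Data.Su_mem_nhds`). Hence the artificial reference approaches `ξ^d` (`Data.exists_forall_Vcost_le`,
`Data.sub_optRef_tendsto_zero`).

For `λ = 0` the optimal cost decreases. For `λ > 0` and `p(z){w} = 0`, the distance of the fallback from
the true disturbance state is contracted by the weights `τ`. If their product has a positive limit, the
penalties `λ (1 - τ²)` are summable, and the argument for `λ = 0` applies up to a summable error. If the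
product tends to zero, the prediction becomes exact, and `Data.exists_perturbed_candidate` provides
candidates with `τ = 0` whose cost is asymptotically that of the shifted optimizer; here the optimal
cost, less its penalty, is compared with the optimal cost of the admissible references for the true
disturbance (`Data.dev_tendsto_zero_of_prod_tendsto_zero`). In either case the tube error obeys the
stabilized `(Δx, e)`-loop with a vanishing input, so the output approaches its prediction.
-/

set_option linter.unusedSectionVars false

noncomputable section

namespace TubeMPC

/-! ### Finite-dimensional estimates -/

section FiniteDim

variable {E F : Type*} [NormedAddCommGroup E] [NormedSpace ℝ E] [FiniteDimensional ℝ E]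
  [NormedAddCommGroup F] [NormedSpace ℝ F]

theorem exists_norm_map_le (f : E →ₗ[ℝ] F) : ∃ K > 0, ∀ x, ‖f x‖ ≤ K * ‖x‖ := by
  refine ⟨‖LinearMap.toContinuousLinearMap f‖ + 1, by positivity, fun x => ?_⟩
  have h := (LinearMap.toContinuousLinearMap f).le_opNorm x
  rw [LinearMap.coe_toContinuousLinearMap'] at h
  nlinarith [norm_nonneg x]

theorem exists_norm_le_of_injective (f : E →ₗ[ℝ] F) (hf : ∀ x, f x = 0 → x = 0) :
    ∃ K > 0, ∀ x, ‖x‖ ≤ K * ‖f x‖ := by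
  obtain ⟨K, hK, h⟩ := LinearMap.exists_antilipschitzWith f (LinearMap.ker_eq_bot'.2 hf)
  refine ⟨K, by exact_mod_cast hK, fun x => ?_⟩
  have := h.le_mul_dist x 0
  simpa [dist_eq_norm] using this

theorem tendsto_zero_of_injective {ι : Type*} {l : Filter ι} (f : E →ₗ[ℝ] F)
    (hf : ∀ x, f x = 0 → x = 0) {x : ι → E} (h : Tendsto (fun i => f (x i)) l (𝓝 0)) :
    Tendsto x l (𝓝 0) := by
  obtain ⟨K, -, hK⟩ := exists_norm_le_of_injective f hf
  refine squeeze_zero_norm (fun i => hK (x i)) ?_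
  simpa using (h.norm.const_mul K)

theorem continuous_linear (f : E →ₗ[ℝ] F) : Continuous f :=
  f.continuous_of_finiteDimensional

theorem tendsto_linear_zero {ι : Type*} {l : Filter ι} (f : E →ₗ[ℝ] F) {x : ι → E}
    (h : Tendsto x l (𝓝 0)) : Tendsto (fun i => f (x i)) l (𝓝 0) := by
  simpa [Function.comp_def] using ((continuous_linear f).tendsto 0).comp h

end FiniteDim

/-! ### Positive semidefinite quadratic forms -/

/-- A positive semidefinite quadratic form on a normed space: the diagonal of a bilinear form,
nonnegative and continuous. -/
structure IsPSDQuad {E : Type*} [NormedAddCommGroup E] [NormedSpace ℝ E] (q : E → ℝ) : Prop where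
  exists_bilin : ∃ b : E →ₗ[ℝ] E →ₗ[ℝ] ℝ, ∀ x, q x = b x x
  nonneg : ∀ x, 0 ≤ q x
  continuous : Continuous q

namespace IsPSDQuad

variable {E F : Type*} [NormedAddCommGroup E] [NormedSpace ℝ E]
  [NormedAddCommGroup F] [NormedSpace ℝ F] {q q' : E → ℝ}

theorem add (h : IsPSDQuad q) (h' : IsPSDQuad q') : IsPSDQuad (fun x => q x + q' x) := by
  obtain ⟨b, hb⟩ := h.exists_bilin
  obtain ⟨b', hb'⟩ := h'.exists_bilin
  exact ⟨⟨b + b', fun x => by simp [hb, hb']⟩, fun x => add_nonneg (h.nonneg x) (h'.nonneg x),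
    h.continuous.add h'.continuous⟩

theorem const_mul (h : IsPSDQuad q) {a : ℝ} (ha : 0 ≤ a) : IsPSDQuad (fun x => a * q x) := by
  obtain ⟨b, hb⟩ := h.exists_bilin
  exact ⟨⟨a • b, fun x => by simp [hb]⟩, fun x => mul_nonneg ha (h.nonneg x),
    h.continuous.const_mul a⟩

theorem zero : IsPSDQuad (fun _ : E => (0 : ℝ)) :=
  ⟨⟨0, fun x => by simp⟩, fun _ => le_rfl, continuous_const⟩

theorem sum {ι : Type*} (s : Finset ι) {q : ι → E → ℝ} (h : ∀ i, IsPSDQuad (q i)) :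
    IsPSDQuad (fun x => ∑ i ∈ s, q i x) := by
  classical
  induction s using Finset.induction_on with
  | empty => simpa using zero
  | insert i s hi ih => simpa [Finset.sum_insert hi] using (h i).add ih

theorem comp [FiniteDimensional ℝ F] (h : IsPSDQuad q) (f : F →ₗ[ℝ] E) :
    IsPSDQuad (fun x => q (f x)) := by
  obtain ⟨b, hb⟩ := h.exists_bilin
  exact ⟨⟨b.compl₁₂ f f, fun x => by simp [hb]⟩, fun x => h.nonneg _,
    h.continuous.comp (continuous_linear f)⟩

theorem map_smul (h : IsPSDQuad q) (a : ℝ) (x : E) : q (a • x) = a ^ 2 * q x := by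
  obtain ⟨b, hb⟩ := h.exists_bilin
  simp [hb]; ring

theorem map_zero (h : IsPSDQuad q) : q 0 = 0 := by
  simpa using h.map_smul 0 0

theorem map_neg (h : IsPSDQuad q) (x : E) : q (-x) = q x := by
  simpa using h.map_smul (-1) x

theorem map_sub_comm (h : IsPSDQuad q) (x y : E) : q (x - y) = q (y - x) := by
  rw [← h.map_neg, neg_sub]

theorem map_convex_comb (h : IsPSDQuad q) (s : ℝ) (x y : E) :
    q ((1 - s) • x + s • y) = (1 - s) * q x + s * q y - s * (1 - s) * q (x - y) := by
  obtain ⟨b, hb⟩ := h.exists_bilin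
  simp [hb]; ring

theorem map_convex_comb_le (h : IsPSDQuad q) {s : ℝ} (h0 : 0 ≤ s) (h1 : s ≤ 1) (x y : E) :
    q ((1 - s) • x + s • y) ≤ (1 - s) * q x + s * q y := by
  rw [h.map_convex_comb]
  nlinarith [mul_nonneg (mul_nonneg h0 (sub_nonneg.2 h1)) (h.nonneg (x - y))]

theorem map_add_le (h : IsPSDQuad q) (x y : E) : q (x + y) ≤ 2 * q x + 2 * q y := by
  have h2 := h.nonneg (x - y)
  obtain ⟨b, hb⟩ := h.exists_bilin
  simp [hb] at h2 ⊢
  linarith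

/-- A minimizer over a midpoint-convex set satisfies a quadratic growth estimate. -/
theorem growth (h : IsPSDQuad q) {x y : E} (hm : q x ≤ q ((1 - (1 / 2 : ℝ)) • x + (1 / 2 : ℝ) • y)) :
    q (y - x) ≤ 2 * (q y - q x) := by
  rw [h.map_convex_comb, h.map_sub_comm] at hm
  linarith

theorem abs_map_add_sub_le (h : IsPSDQuad q) (x y : E) :
    |q (x + y) - q x| ≤ q y + 2 * √(q x * q y) := by
  have hn := h.nonneg
  obtain ⟨b, hb⟩ := h.exists_bilin
  have hd : discrim (q y) (b x y + b y x) (q x) ≤ 0 := by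
    apply discrim_le_zero
    intro r
    have := hn (x + r • y)
    rw [hb] at this
    simp at this
    rw [hb x, hb y]
    linarith
  have h2 : |b x y + b y x| ≤ 2 * √(q x * q y) := by
    have : (b x y + b y x) ^ 2 ≤ 2 ^ 2 * (q x * q y) := by
      unfold discrim at hd; linarith
    have h3 := Real.abs_le_sqrt this
    rwa [Real.sqrt_mul (by norm_num), Real.sqrt_sq (by norm_num)] at h3
  have h4 : q (x + y) - q x = q y + (b x y + b y x) := by
    simp [hb]; ring
  rw [h4]
  calc _ ≤ |q y| + |b x y + b y x| := abs_add_le _ _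
    _ ≤ _ := by rw [abs_of_nonneg (hn y)]; linarith

theorem exists_le_norm_sq [FiniteDimensional ℝ E] (h : IsPSDQuad q) :
    ∃ K > 0, ∀ x, q x ≤ K * ‖x‖ ^ 2 := by
  obtain ⟨K, hK⟩ := (isCompact_sphere (0 : E) 1).exists_bound_of_continuousOn h.continuous.continuousOn
  refine ⟨max K 1, by positivity, fun x => ?_⟩
  rcases eq_or_ne x 0 with rfl | hx
  · simp [h.map_zero]
  have hx' : 0 < ‖x‖ := norm_pos_iff.2 hx
  have h1 := hK (‖x‖⁻¹ • x) (by simp [norm_smul, hx'.ne'])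
  rw [h.map_smul, Real.norm_eq_abs, abs_of_nonneg (by have := h.nonneg x; positivity)] at h1
  have : q x = ‖x‖ ^ 2 * (‖x‖⁻¹ ^ 2 * q x) := by field_simp
  rw [this, mul_comm (max K 1)]
  gcongr
  exact h1.trans (le_max_left _ _)

theorem exists_norm_sq_le [FiniteDimensional ℝ E] (h : IsPSDQuad q) (h0 : ∀ x, q x = 0 → x = 0) :
    ∃ K > 0, ∀ x, ‖x‖ ^ 2 ≤ K * q x := by
  rcases subsingleton_or_nontrivial E with hs | hs
  · exact ⟨1, one_pos, fun x => by rw [Subsingleton.elim x 0]; simp [h.map_zero]⟩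
  obtain ⟨x₀, hx₀, hmin⟩ := (isCompact_sphere (0 : E) 1).exists_isMinOn
    (NormedSpace.sphere_nonempty.2 zero_le_one) h.continuous.continuousOn
  have hpos : 0 < q x₀ := by
    refine lt_of_le_of_ne (h.nonneg _) fun h' => ?_
    have := h0 _ h'.symm
    simp [this] at hx₀
  refine ⟨(q x₀)⁻¹, by positivity, fun x => ?_⟩
  rcases eq_or_ne x 0 with rfl | hx
  · simp [h.map_zero]
  have hx' : 0 < ‖x‖ := norm_pos_iff.2 hx
  have h1 : q x₀ ≤ q (‖x‖⁻¹ • x) := hmin (by simp [norm_smul, hx'.ne'])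
  rw [h.map_smul] at h1
  rw [inv_mul_eq_div, le_div_iff₀ hpos]
  have : q x = ‖x‖ ^ 2 * (‖x‖⁻¹ ^ 2 * q x) := by field_simp
  rw [this]
  gcongr

theorem tendsto_zero [FiniteDimensional ℝ E] (h : IsPSDQuad q) {ι : Type*} {l : Filter ι} {x : ι → E}
    (hx : Tendsto x l (𝓝 0)) : Tendsto (fun i => q (x i)) l (𝓝 0) := by
  simpa [h.map_zero, Function.comp_def] using (h.continuous.tendsto 0).comp hx

theorem tendsto_of_tendsto_zero [FiniteDimensional ℝ E] (h : IsPSDQuad q) (h0 : ∀ x, q x = 0 → x = 0)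
    {ι : Type*} {l : Filter ι} {x : ι → E}
    (hx : Tendsto (fun i => q (x i)) l (𝓝 0)) : Tendsto x l (𝓝 0) := by
  obtain ⟨K, -, hK⟩ := h.exists_norm_sq_le h0
  rw [tendsto_zero_iff_norm_tendsto_zero]
  have h1 : Tendsto (fun i => √(K * q (x i))) l (𝓝 0) := by
    simpa using ((hx.const_mul K).sqrt)
  exact squeeze_zero (fun i => norm_nonneg _) (fun i => Real.le_sqrt_of_sq_le (hK _)) h1

/-- Uniform continuity of a semidefinite form on sublevel sets. -/
theorem tendsto_map_sub [FiniteDimensional ℝ E] (h : IsPSDQuad q) {ι : Type*} {l : Filter ι}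
    {x y : ι → E} {M : ℝ} (hM : ∀ᶠ i in l, q (x i) ≤ M)
    (hy : Tendsto (fun i => q (y i - x i)) l (𝓝 0)) :
    Tendsto (fun i => q (y i) - q (x i)) l (𝓝 0) := by
  have hb : Tendsto (fun i => q (y i - x i) + 2 * √(M * q (y i - x i))) l (𝓝 0) := by
    have := hy.add (((hy.const_mul M).sqrt).const_mul 2)
    simpa using this
  refine squeeze_zero_norm' ?_ hb
  filter_upwards [hM] with i hi
  have h1 := h.abs_map_add_sub_le (x i) (y i - x i)
  rw [add_sub_cancel] at h1
  refine h1.trans ?_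
  gcongr
  exact h.nonneg _

end IsPSDQuad

theorem isPSDQuad_quad {ι : Type*} [Fintype ι] {Q : Matrix ι ι ℝ} (hQ : Q.PosSemidef) :
    IsPSDQuad (quad Q) where
  exists_bilin := by
    classical
    refine ⟨Matrix.toLinearMap₂' ℝ Q, fun x => ?_⟩
    rw [Matrix.toLinearMap₂'_apply']; rfl
  nonneg x := by simpa [quad] using hQ.dotProduct_mulVec_nonneg x
  continuous := by unfold quad; fun_prop

theorem mulVec_eq_zero_of_quad {ι : Type*} [Fintype ι] {Q : Matrix ι ι ℝ} (hQ : Q.PosSemidef)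
    {x : ι → ℝ} (h : quad Q x = 0) : Q *ᵥ x = 0 :=
  (hQ.dotProduct_mulVec_zero_iff x).1 (by simpa [quad] using h)

theorem eq_zero_of_quad {ι : Type*} [Fintype ι] {Q : Matrix ι ι ℝ} (hQ : Q.PosDef)
    {x : ι → ℝ} (h : quad Q x = 0) : x = 0 := by
  by_contra hx
  have := hQ.dotProduct_mulVec_pos hx
  simp [quad] at h
  simp [h] at this

/-! ### Real sequences -/

/-- A sequence that decreases up to summable errors has convergent, hence vanishing, decrements. -/
theorem tendsto_zero_of_decrease {φ a κ : ℕ → ℝ} (hφ : ∀ t, 0 ≤ φ t) (ha : ∀ t, 0 ≤ a t)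
    {K : ℝ} (hK : ∀ t, ∑ i ∈ Finset.range t, κ i ≤ K)
    (h : ∀ t, φ (t + 1) + a t ≤ φ t + κ t) : Tendsto a atTop (𝓝 0) := by
  have h1 : ∀ t, ∑ i ∈ Finset.range t, a i ≤ φ 0 - φ t + ∑ i ∈ Finset.range t, κ i := by
    intro t
    induction t with
    | zero => simp
    | succ t ih => rw [Finset.sum_range_succ, Finset.sum_range_succ]; linarith [h t]
  refine (summable_of_sum_range_le ha (c := φ 0 + K) fun t => ?_).tendsto_atTop_zero
  linarith [h1 t, hφ t, hK t]

/-- A sequence `x`, asymptotically nonnegative, that decreases by `a` up to vanishing errors tends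
to zero if smallness of `k` successive decrements forces smallness of `x`. -/
theorem tendsto_zero_of_block_decrease {x a κ : ℕ → ℝ} {k : ℕ} (ha : ∀ t, 0 ≤ a t)
    (hκ : Tendsto κ atTop (𝓝 0)) (hstep : ∀ t, x (t + 1) + a t ≤ x t + κ t)
    (hlow : ∀ ε > 0, ∀ᶠ t in atTop, -ε ≤ x t)
    (hup : ∀ ε > 0, ∃ δ > 0, ∀ᶠ t in atTop, (∀ i < k, a (t + i) ≤ δ) → x t ≤ ε) :
    Tendsto x atTop (𝓝 0) := by
  have key : ∀ ε > 0, ∀ᶠ t in atTop, x t ≤ 3 * ε := by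
    intro ε hε
    obtain ⟨δ, hδ, hup⟩ := hup ε hε
    set μ : ℝ := min (δ / 2) ε / (k + 1) with hμ
    have hμ0 : 0 < μ := by positivity
    have hk1 : (k : ℝ) * μ ≤ δ / 2 ∧ (k : ℝ) * μ ≤ ε := by
      have : (k : ℝ) * μ ≤ (k + 1) * μ := by nlinarith
      have h2 : ((k : ℝ) + 1) * μ = min (δ / 2) ε := by rw [hμ]; field_simp
      rw [h2] at this
      exact ⟨this.trans (min_le_left _ _), this.trans (min_le_right _ _)⟩
    have hκ' : ∀ᶠ t in atTop, κ t ≤ μ := by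
      filter_upwards [hκ.eventually (gt_mem_nhds hμ0)] with t ht using ht.le
    obtain ⟨T, hT⟩ := eventually_atTop.1 (hup.and (hκ'.and (hlow 1 one_pos)))
    have hsum : ∀ t ≥ T, ∀ j, x (t + j) + ∑ i ∈ Finset.range j, a (t + i) ≤ x t + j * μ := by
      intro t ht j
      induction j with
      | zero => simp
      | succ j ih =>
        rw [Finset.sum_range_succ]
        have h1 := hstep (t + j)
        have h2 := (hT (t + j) (by omega)).2.1
        rw [← add_assoc t j 1]
        push_cast
        linarith
    have hsum0 : ∀ t j, 0 ≤ ∑ i ∈ Finset.range j, a (t + i) :=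
      fun t j => Finset.sum_nonneg fun i _ => ha _
    have hdesc : ∀ t ≥ T, ε < x t → x (t + k) ≤ x t - δ / 2 := by
      intro t ht hx
      have h1 : ∃ i < k, δ < a (t + i) := by
        by_contra! hcon
        exact absurd ((hT t ht).1 hcon) (not_le.2 hx)
      obtain ⟨i, hi, hai⟩ := h1
      have h2 : δ ≤ ∑ i ∈ Finset.range k, a (t + i) :=
        hai.le.trans (Finset.single_le_sum (f := fun i => a (t + i)) (fun i _ => ha _)
          (Finset.mem_range.2 hi))
      linarith [hsum t ht k, hk1.1]
    have hex : ∃ t ≥ T, x t ≤ ε := by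
      by_contra! hcon
      have h1 : ∀ j : ℕ, x (T + j * k) ≤ x T - j * (δ / 2) := by
        intro j
        induction j with
        | zero => simp
        | succ j ih =>
          have := hdesc (T + j * k) (by omega) (hcon _ (by omega))
          rw [add_one_mul, ← add_assoc]
          push_cast
          linarith
      obtain ⟨j, hj⟩ := exists_nat_gt ((x T - ε) / (δ / 2))
      rw [div_lt_iff₀ (by positivity)] at hj
      linarith [h1 j, hcon (T + j * k) (by omega)]
    obtain ⟨t', ht', hxt'⟩ := hex
    have hinv : ∀ j : ℕ, ∃ s, t' ≤ s ∧ s ≤ t' + j ∧ t' + j ≤ s + k ∧ x s ≤ 2 * ε := by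
      intro j
      induction j with
      | zero => exact ⟨t', le_rfl, by omega, by omega, by linarith⟩
      | succ j ih =>
        obtain ⟨s, h1, h2, h3, h4⟩ := ih
        rcases Nat.lt_or_ge (t' + j) (s + k) with h5 | h5
        · exact ⟨s, h1, by omega, by omega, h4⟩
        · have hs : x (s + k) ≤ 2 * ε := by
            rcases le_or_gt (x s) ε with h6 | h6
            · linarith [hsum s (by omega) k, hsum0 s k, hk1.2]
            · linarith [hdesc s (by omega) h6]
          rcases Nat.eq_zero_or_pos k with hk | hk
          · subst hk
            have := hsum s (by omega) 0
            have h6 : (t' + (j + 1)) = s + 1 := by omega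
            refine ⟨s + 1, by omega, by omega, by omega, ?_⟩
            have h7 := hT s (by omega)
            have h8 := hT (s + 1) (by omega)
            have := h8.1 (by simp)
            linarith
          · exact ⟨s + k, by omega, by omega, by omega, hs⟩
    filter_upwards [eventually_ge_atTop t'] with t ht
    obtain ⟨s, h1, h2, h3, h4⟩ := hinv (t - t')
    obtain ⟨j, rfl⟩ : ∃ j, t = s + j := ⟨t - s, by omega⟩
    have h5 := hsum s (by omega) j
    have h6 := hsum0 s j
    have h7 : (j : ℝ) * μ ≤ k * μ := by
      have : (j : ℝ) ≤ k := by exact_mod_cast (by omega)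
      gcongr
    linarith [hk1.2]
  rw [Metric.tendsto_atTop]
  intro ε hε
  obtain ⟨T, hT⟩ := eventually_atTop.1 ((key (ε / 4) (by positivity)).and (hlow (ε / 2) (by positivity)))
  refine ⟨T, fun t ht => ?_⟩
  obtain ⟨h1, h2⟩ := hT t ht
  rw [Real.dist_eq, sub_zero, abs_lt]
  constructor <;> linarith

/-- A power-stable linear recursion with vanishing input has vanishing state. -/
theorem tendsto_zero_of_stable_input {E : Type*} [NormedAddCommGroup E] [NormedSpace ℝ E]
    [FiniteDimensional ℝ E] (f : E →ₗ[ℝ] E) (hf : ∀ x, Tendsto (fun t : ℕ => (f ^ t) x) atTop (𝓝 0))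
    {y r : ℕ → E} (hy : ∀ t, y (t + 1) = f (y t) + r t) (hr : Tendsto r atTop (𝓝 0)) :
    Tendsto y atTop (𝓝 0) := by
  -- a power of `f` is a contraction
  obtain ⟨k, hk⟩ : ∃ k : ℕ, ∀ x, ‖(f ^ k) x‖ ≤ 1 / 2 * ‖x‖ := by
    let b := Module.finBasis ℝ E
    obtain ⟨K, hK, hb⟩ := exists_norm_map_le b.equivFun.toLinearMap
    have h1 : Tendsto (fun t : ℕ => ∑ i, ‖(f ^ t) (b i)‖) atTop (𝓝 0) := by
      simpa using tendsto_finsetSum Finset.univ fun i _ => (hf (b i)).norm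
    obtain ⟨k, hk⟩ := (h1.eventually (gt_mem_nhds (show (0 : ℝ) < 1 / (2 * K) by positivity))).exists
    refine ⟨k, fun x => ?_⟩
    calc ‖(f ^ k) x‖ = ‖∑ i, b.equivFun x i • (f ^ k) (b i)‖ := by
          conv_lhs => rw [← b.sum_equivFun x]
          simp only [map_sum, map_smul]
      _ ≤ ∑ i, ‖b.equivFun x i • (f ^ k) (b i)‖ := norm_sum_le _ _
      _ ≤ ∑ i, (K * ‖x‖) * ‖(f ^ k) (b i)‖ := by
          refine Finset.sum_le_sum fun i _ => ?_
          rw [norm_smul]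
          gcongr
          exact (norm_le_pi_norm _ i).trans (hb x)
      _ = (K * ‖x‖) * ∑ i, ‖(f ^ k) (b i)‖ := by rw [Finset.mul_sum]
      _ ≤ (K * ‖x‖) * (1 / (2 * K)) := by gcongr
      _ = _ := by field_simp
  have hyk : ∀ j t, y (t + j) = (f ^ j) (y t) + ∑ i ∈ Finset.range j, (f ^ (j - 1 - i)) (r (t + i)) := by
    intro j
    induction j with
    | zero => simp
    | succ j ih =>
      intro t
      rw [← add_assoc, hy, ih, map_add, Finset.sum_range_succ, map_sum, add_assoc]
      congr 1
      · rw [pow_succ', Module.End.mul_apply]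
      · congr 1
        · refine Finset.sum_congr rfl fun i hi => ?_
          rw [Finset.mem_range] at hi
          rw [← Module.End.mul_apply, ← pow_succ']
          congr 2; omega
        · simp
  set ρ : ℕ → ℝ := fun t => ‖∑ i ∈ Finset.range k, (f ^ (k - 1 - i)) (r (t + i))‖ with hρ
  have hρ0 : Tendsto ρ atTop (𝓝 0) := by
    have : Tendsto (fun t => ∑ i ∈ Finset.range k, (f ^ (k - 1 - i)) (r (t + i))) atTop (𝓝 0) := by
      simpa using tendsto_finsetSum (Finset.range k) fun i _ =>
        tendsto_linear_zero (f ^ (k - 1 - i)) ((tendsto_add_atTop_iff_nat i).2 hr)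
    simpa using this.norm
  have hstep : ∀ t, ‖y (t + k)‖ ≤ 1 / 2 * ‖y t‖ + ρ t := fun t => by
    rw [hyk k t]
    exact (norm_add_le _ _).trans (add_le_add (hk _) le_rfl)
  rcases Nat.eq_zero_or_pos k with h0 | hkpos
  · -- `f ^ 0 = 1` is a contraction only on the trivial space
    subst h0
    have : ∀ x : E, x = 0 := fun x => by
      have := hk x
      simp at this
      exact norm_le_zero_iff.1 (by linarith)
    exact tendsto_const_nhds.congr fun t => (this (y t)).symm
  rw [tendsto_zero_iff_norm_tendsto_zero, Metric.tendsto_atTop]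
  intro ε hε
  obtain ⟨T, hT⟩ := eventually_atTop.1 (hρ0.eventually (gt_mem_nhds (show (0 : ℝ) < ε / 4 by positivity)))
  -- a common bound on the first block, halved from block to block
  set B : ℝ := ∑ i ∈ Finset.range k, ‖y (T + i)‖ with hB
  have hblock : ∀ j : ℕ, ∀ i < k, ‖y (T + i + j * k)‖ ≤ (1 / 2) ^ j * B + ε / 2 := by
    intro j
    induction j with
    | zero =>
      intro i hi
      have := Finset.single_le_sum (f := fun i => ‖y (T + i)‖) (fun i _ => norm_nonneg _)
        (Finset.mem_range.2 hi)
      simp only [zero_mul, add_zero, pow_zero, one_mul]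
      linarith
    | succ j ih =>
      intro i hi
      have h1 := hstep (T + i + j * k)
      have h2 := hT (T + i + j * k) (by omega)
      rw [add_one_mul, ← add_assoc, pow_succ]
      linarith [ih i hi]
  have hB0 : Tendsto (fun j : ℕ => (1 / 2 : ℝ) ^ j * B) atTop (𝓝 0) := by
    simpa using (tendsto_pow_atTop_nhds_zero_of_lt_one (by norm_num : (0 : ℝ) ≤ 1 / 2)
      (by norm_num)).mul_const B
  obtain ⟨J, hJ⟩ := eventually_atTop.1 (hB0.eventually (gt_mem_nhds (show (0 : ℝ) < ε / 2 by positivity)))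
  refine ⟨T + J * k, fun t ht => ?_⟩
  have hdm := Nat.div_add_mod (t - T) k
  have hJle : J ≤ (t - T) / k := (Nat.le_div_iff_mul_le hkpos).2 (by omega)
  have h1 := hblock ((t - T) / k) ((t - T) % k) (Nat.mod_lt _ hkpos)
  have h2 : T + (t - T) % k + (t - T) / k * k = t := by rw [mul_comm] at hdm; omega
  rw [h2] at h1
  have h3 := hJ _ hJle
  rw [dist_zero_right, norm_norm]
  linarith

/-! ### Signals generated by a delay polynomial -/

section Generator

variable {c : ℕ → ℝ} {d : ℕ}

section Push

variable {E F : Type*}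

theorem push_zero [NeZero d] (a : E) (w : Fin d → E) : push a w 0 = a := by simp [push]

theorem push_succ (a : E) (w : Fin d → E) (i : ℕ) (h : i + 1 < d) :
    push a w ⟨i + 1, h⟩ = w ⟨i, by omega⟩ := by simp [push]

theorem push_add [Add E] (a a' : E) (w w' : Fin d → E) :
    push (a + a') (w + w') = push a w + push a' w' := by
  funext i; simp only [push, Pi.add_apply]; split <;> rfl

theorem push_smul [SMul ℝ E] (r : ℝ) (a : E) (w : Fin d → E) :
    push (r • a) (r • w) = r • push a w := by
  funext i; simp only [push, Pi.smul_apply]; split <;> rfl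

theorem push_map (f : E → F) (a : E) (w : Fin d → E) :
    push (f a) (fun i => f (w i)) = fun i => f (push a w i) := by
  funext i; simp only [push]; split <;> rfl

theorem window_succ (s : ℤ → E) (t : ℤ) :
    (fun i : Fin d => s (t - (i : ℕ))) = push (s t) (fun i : Fin d => s (t - 1 - (i : ℕ))) := by
  funext ⟨i, hi⟩
  cases i with
  | zero => simp [push]
  | succ i => rw [push_succ]; congr 1; push_cast; ring

end Push

section Algebra

variable {E F : Type*} [AddCommGroup E] [Module ℝ E] [AddCommGroup F] [Module ℝ F]

variable (c) in
/-- `genNext` as a linear map. -/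
def genNextL : (Fin d → E) →ₗ[ℝ] E where
  toFun := genNext c
  map_add' w w' := by simp [genNext, Finset.sum_add_distrib]; abel
  map_smul' r w := by simp [genNext, Finset.smul_sum, smul_comm r]

variable (c) in
/-- The companion map `genStep` as a linear map. -/
def genStepL : (Fin d → E) →ₗ[ℝ] (Fin d → E) where
  toFun := genStep c
  map_add' w w' := by
    simp only [genStep]; rw [← push_add]; congr 1; exact (genNextL c).map_add w w'
  map_smul' r w := by
    simp only [genStep, RingHom.id_apply]; rw [← push_smul]; congr 1
    exact (genNextL c).map_smul r w

@[simp] theorem genNextL_apply (w : Fin d → E) : genNextL c w = genNext c w := rfl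

@[simp] theorem genStepL_apply (w : Fin d → E) : genStepL c w = genStep c w := rfl

theorem genStep_iterate (t : ℕ) (w : Fin d → E) : (genStep c)^[t] w = (genStepL c ^ t) w := by
  rw [Module.End.pow_apply]; rfl

theorem genNext_map (f : E →ₗ[ℝ] F) (w : Fin d → E) :
    genNext c (fun i => f (w i)) = f (genNext c w) := by simp [genNext]

theorem genStep_map (f : E →ₗ[ℝ] F) (w : Fin d → E) :
    genStep c (fun i => f (w i)) = fun i => f (genStep c w i) := by
  simp only [genStep]; rw [genNext_map, push_map]

theorem genStep_iterate_map (f : E →ₗ[ℝ] F) (t : ℕ) (w : Fin d → E) :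
    (genStep c)^[t] (fun i => f (w i)) = fun i => f ((genStep c)^[t] w i) := by
  induction t generalizing w with
  | zero => rfl
  | succ t ih => rw [Function.iterate_succ_apply, genStep_map, ih, Function.iterate_succ_apply]

theorem genStep_injective [NeZero d] (hc : c d ≠ 0) {w : Fin d → E} (h : genStep c w = 0) : w = 0 := by
  have hlt : ∀ (i : ℕ) (hi : i + 1 < d), w ⟨i, by omega⟩ = 0 := fun i hi => by
    have := congrFun h ⟨i + 1, hi⟩
    rwa [genStep, push_succ] at this
  have hd : 0 < d := Nat.pos_of_neZero d
  have h0 : genNext c w = 0 := by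
    have := congrFun h 0
    rwa [genStep, push_zero] at this
  have hlast : w ⟨d - 1, by omega⟩ = 0 := by
    rw [genNext, neg_eq_zero, Finset.sum_eq_single ⟨d - 1, by omega⟩] at h0
    · simp only at h0
      rw [Nat.sub_add_cancel hd] at h0
      exact (smul_eq_zero.1 h0).resolve_left hc
    · intro i _ hi
      have : (i : ℕ) + 1 < d := by
        have := i.2
        rcases Nat.lt_or_ge ((i : ℕ) + 1) d with h | h
        · exact h
        · exact absurd (Fin.ext (by simp; omega)) hi
      rw [show w i = 0 from hlt i this, smul_zero]
    · simp
  funext i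
  rcases Nat.lt_or_ge ((i : ℕ) + 1) d with hi | hi
  · exact hlt i hi
  · have : i = ⟨d - 1, by omega⟩ := Fin.ext (by simp; omega)
    rw [this, hlast]; rfl

theorem genStep_iterate_injective [NeZero d] (hc : c d ≠ 0) {t : ℕ} {w : Fin d → E}
    (h : (genStep c)^[t] w = 0) : w = 0 := by
  induction t with
  | zero => simpa using h
  | succ t ih => rw [Function.iterate_succ_apply'] at h; exact ih (genStep_injective hc h)

theorem delayFilter_eq (hc : c 0 = 1) (s : ℤ → E) (t : ℤ) :
    delayFilter c d s t = s t - genNext c (fun i : Fin d => s (t - 1 - (i : ℕ))) := by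
  rw [delayFilter, Finset.sum_range_succ', genNext, sub_neg_eq_add, add_comm, hc]
  congr 1
  · simp
  · rw [Finset.sum_range]
    refine Finset.sum_congr rfl fun i _ => ?_
    congr 2; push_cast; ring

theorem delayFilter_map (f : E →ₗ[ℝ] F) (s : ℤ → E) (t : ℤ) :
    delayFilter c d (fun t => f (s t)) t = f (delayFilter c d s t) := by
  simp [delayFilter]

theorem delayFilter_add (s s' : ℤ → E) (t : ℤ) :
    delayFilter c d (fun t => s t + s' t) t = delayFilter c d s t + delayFilter c d s' t := by
  simp [delayFilter, Finset.sum_add_distrib]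

theorem delayFilter_shift (s : ℤ → E) (k t : ℤ) :
    delayFilter c d (fun t => s (t - k)) t = delayFilter c d s (t - k) := by
  simp only [delayFilter]
  refine Finset.sum_congr rfl fun i _ => ?_
  congr 2; ring

/-- A solution of the generator equation whose window vanishes is zero. -/
theorem solution_eq_zero [NeZero d] (hc : c 0 = 1) (hcd : c d ≠ 0) {s : ℤ → E}
    (hs : ∀ t, delayFilter c d s t = 0) (h0 : ∀ i : Fin d, s (-(i : ℕ)) = 0) (t : ℤ) : s t = 0 := by
  have hstep : ∀ t, (fun i : Fin d => s (t - (i : ℕ))) = genStep c (fun i : Fin d => s (t - 1 - (i : ℕ))) := by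
    intro t
    rw [window_succ, genStep]
    congr 1
    exact sub_eq_zero.1 ((delayFilter_eq hc s t).symm.trans (hs t))
  have hall : ∀ t : ℤ, (fun i : Fin d => s (t - (i : ℕ))) = 0 := by
    intro t
    induction t using Int.induction_on with
    | zero => funext i; simpa using h0 i
    | succ t ih =>
      rw [hstep, add_sub_cancel_right, ih]; exact (genStepL c).map_zero
    | pred t ih => rw [hstep] at ih; exact genStep_injective hcd ih
  have := congrFun (hall t) 0
  simpa using this

theorem genStep_iterate_apply_eq_sum (t : ℕ) (w : Fin d → E) (i : Fin d) :
    (genStep c)^[t] w i = ∑ j, ((genStep c)^[t] (Pi.single j (1 : ℝ)) i) • w j := by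
  have h1 : w = ∑ j, (fun i : Fin d => (LinearMap.toSpanSingleton ℝ E (w j)) ((Pi.single j (1 : ℝ) : Fin d → ℝ) i)) := by
    funext i
    simp [Finset.sum_apply, Pi.single_apply]
  conv_lhs => rw [h1]
  rw [genStep_iterate, map_sum, Finset.sum_apply]
  refine Finset.sum_congr rfl fun j _ => ?_
  rw [← genStep_iterate, genStep_iterate_map]
  simp

variable [FiniteDimensional ℝ E]

/-- Every window extends to a two-sided solution of the generator equation. -/
theorem exists_solution [NeZero d] (hc : c 0 = 1) (hcd : c d ≠ 0) (w : Fin d → E) :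
    ∃ s : ℤ → E, (∀ t, delayFilter c d s t = 0) ∧
      ∀ (t : ℕ) (i : Fin d), s ((t : ℤ) - (i : ℕ)) = (genStep c)^[t] w i := by
  let G : (Fin d → E) ≃ₗ[ℝ] (Fin d → E) := LinearEquiv.ofInjectiveEndo (genStepL c)
    ((injective_iff_map_eq_zero _).2 fun w hw => genStep_injective hcd hw)
  have hG : ∀ w, G w = genStep c w := fun w => rfl
  have hsucc : ∀ (t : ℤ) (w : Fin d → E), (G ^ (t + 1)) w = genStep c ((G ^ t) w) := fun t w => by
    rw [add_comm, _root_.zpow_add, zpow_one, LinearEquiv.mul_apply, hG]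
  have hwin : ∀ (i : ℕ) (hi : i < d) (t : ℤ), (G ^ (t - i)) w 0 = (G ^ t) w ⟨i, hi⟩ := by
    intro i
    induction i with
    | zero => intro hi t; simp
    | succ i ih =>
      intro hi t
      have := hsucc (t - 1) w
      rw [sub_add_cancel] at this
      rw [this, genStep, push_succ, ← ih (by omega), Nat.cast_succ, sub_add_eq_sub_sub_swap]
  refine ⟨fun t => (G ^ t) w 0, fun t => ?_, fun t i => ?_⟩
  · rw [delayFilter_eq hc, sub_eq_zero]
    have := hsucc (t - 1) w
    rw [sub_add_cancel] at this
    rw [this, genStep, push_zero]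
    congr 1
    funext i
    exact (hwin i i.2 (t - 1)).symm
  · change (G ^ ((t : ℤ) - (i : ℕ))) w 0 = _
    rw [hwin i i.2]
    have : ∀ t : ℕ, (G ^ (t : ℤ)) w = (genStep c)^[t] w := by
      intro t
      induction t with
      | zero => simp
      | succ t ih => rw [Nat.cast_succ, hsucc, ih, Function.iterate_succ_apply']
    rw [this]

end Algebra

section Normed

variable {E : Type*} [NormedAddCommGroup E] [NormedSpace ℝ E] [NeZero d]

/-- Stability of the generator bounds all powers of the companion map. -/
theorem genStep_iterate_bounded (hc : c 0 = 1) (hcd : c d ≠ 0) (hs : StableGenerator c d) :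
    ∃ K > 0, ∀ (t : ℕ) (w : Fin d → E), ‖(genStep c)^[t] w‖ ≤ K * ‖w‖ := by
  have h1 : ∀ i j : Fin d, ∃ b : ℝ, ∀ t : ℕ, |(genStep c)^[t] (Pi.single j (1 : ℝ)) i| ≤ b := by
    intro i j
    obtain ⟨s, hs1, hs2⟩ := exists_solution hc hcd (Pi.single j (1 : ℝ) : Fin d → ℝ)
    obtain ⟨b, hb⟩ := hs (fun t => s (t - (i : ℕ))) fun t => by
      rw [delayFilter_shift]; exact hs1 _
    exact ⟨b, fun t => by rw [← hs2]; exact hb t⟩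
  choose b hb using h1
  have hb0 : ∀ i j, 0 ≤ b i j := fun i j => (abs_nonneg _).trans (hb i j 0)
  refine ⟨∑ i, ∑ j, b i j + 1, by
    have : 0 ≤ ∑ i, ∑ j, b i j := Finset.sum_nonneg fun i _ => Finset.sum_nonneg fun j _ => hb0 i j
    linarith, fun t w => ?_⟩
  refine (pi_norm_le_iff_of_nonneg (by
    have : 0 ≤ ∑ i, ∑ j, b i j := Finset.sum_nonneg fun i _ => Finset.sum_nonneg fun j _ => hb0 i j
    positivity)).2 fun i => ?_
  rw [genStep_iterate_apply_eq_sum]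
  calc _ ≤ ∑ j, ‖((genStep c)^[t] (Pi.single j (1 : ℝ)) i) • w j‖ := norm_sum_le _ _
    _ ≤ ∑ j, b i j * ‖w‖ := by
        refine Finset.sum_le_sum fun j _ => ?_
        rw [norm_smul, Real.norm_eq_abs]
        exact mul_le_mul (hb i j t) (norm_le_pi_norm w j) (norm_nonneg _) (hb0 i j)
    _ = (∑ j, b i j) * ‖w‖ := by rw [Finset.sum_mul]
    _ ≤ _ := by
        gcongr
        have := Finset.single_le_sum (f := fun i => ∑ j, b i j)
          (fun i _ => Finset.sum_nonneg fun j _ => hb0 i j) (Finset.mem_univ i)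
        linarith

variable [FiniteDimensional ℝ E]

/-- Without decaying modes, only the zero window tends to zero under the generator. -/
theorem eq_zero_of_genStep_tendsto (hc : c 0 = 1) (hcd : c d ≠ 0) (hp : PersistentGenerator c d)
    {w : Fin d → E} (h : Tendsto (fun t : ℕ => (genStep c)^[t] w) atTop (𝓝 0)) : w = 0 := by
  have key : ∀ f : E →ₗ[ℝ] ℝ, ∀ i, f (w i) = 0 := by
    intro f i
    obtain ⟨s, hs1, hs2⟩ := exists_solution hc hcd (fun i => f (w i))
    have h0 : Tendsto (fun t : ℕ => s t) atTop (𝓝 0) := by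
      have h2 : ∀ t : ℕ, s t = f ((genStep c)^[t] w 0) := fun t => by
        have := hs2 t 0
        rw [genStep_iterate_map] at this
        simpa using this
      simp only [h2]
      exact tendsto_linear_zero (f.comp (LinearMap.proj 0)) h
    have := hp s hs1 h0 (-(i : ℕ))
    simpa using (hs2 0 i).symm.trans (by simpa using this)
  funext i
  let b := Module.finBasis ℝ E
  exact b.ext_elem fun j => by simpa using key (b.coord j) i

/-- Without decaying modes, the companion map is uniformly bounded from below. -/
theorem genStep_iterate_bounded_below (hc : c 0 = 1) (hcd : c d ≠ 0) (hs : StableGenerator c d)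
    (hp : PersistentGenerator c d) :
    ∃ K > 0, ∀ (t : ℕ) (w : Fin d → E), ‖w‖ ≤ K * ‖(genStep c)^[t] w‖ := by
  by_contra! hcon
  obtain ⟨K, hK, hb⟩ := genStep_iterate_bounded (E := E) hc hcd hs
  have h1 : ∀ k : ℕ, ∃ (t : ℕ) (w : Fin d → E), ‖w‖ = 1 ∧ ‖(genStep c)^[t] w‖ ≤ 1 / (k + 1) := by
    intro k
    obtain ⟨t, w, hw⟩ := hcon (k + 1) (by positivity)
    have hw0 : 0 < ‖w‖ := lt_of_le_of_lt (by positivity) hw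
    refine ⟨t, ‖w‖⁻¹ • w, by simp [norm_smul, hw0.ne'], ?_⟩
    rw [genStep_iterate, map_smul, norm_smul, ← genStep_iterate, norm_inv, norm_norm,
      inv_mul_eq_div, div_le_div_iff₀ hw0 (by positivity)]
    linarith
  choose T w hw1 hw2 using h1
  obtain ⟨a, -, φ, hφ, hlim⟩ := tendsto_subseq_of_bounded (Metric.isBounded_closedBall (x := (0 : Fin d → E)) (r := 1))
    (x := w) (fun k => by simp [hw1])
  have ha : ‖a‖ = 1 := tendsto_nhds_unique hlim.norm (by simp [hw1])
  have h0 : a = 0 := by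
    refine eq_zero_of_genStep_tendsto hc hcd hp ?_
    rw [Metric.tendsto_atTop]
    intro ε hε
    have e1 : Tendsto (fun j => K * (1 / ((φ j : ℝ) + 1)) + K * ‖a - w (φ j)‖) atTop (𝓝 0) := by
      have e2 := ((tendsto_one_div_add_atTop_nhds_zero_nat (𝕜 := ℝ)).comp hφ.tendsto_atTop).const_mul K
      have e3 := ((tendsto_const_nhds (x := a)).sub hlim).norm.const_mul K
      simpa using e2.add e3
    obtain ⟨j, hj⟩ := (e1.eventually (gt_mem_nhds hε)).exists
    refine ⟨T (φ j), fun t ht => ?_⟩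
    obtain ⟨r, rfl⟩ : ∃ r, t = r + T (φ j) := ⟨t - T (φ j), by omega⟩
    rw [dist_zero_right]
    refine lt_of_le_of_lt ?_ hj
    have e4 : (genStep c)^[r + T (φ j)] a = (genStep c)^[r] ((genStep c)^[T (φ j)] (w (φ j)))
        + (genStep c)^[r + T (φ j)] (a - w (φ j)) := by
      rw [← Function.iterate_add_apply]
      simp only [genStep_iterate, map_sub]; abel
    rw [e4]
    refine (norm_add_le _ _).trans (add_le_add ((hb _ _).trans ?_) (hb _ _))
    gcongr
    exact hw2 _
  simp [h0] at ha

/-- Without decaying modes, a stable companion map is recurrent. -/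
theorem genStep_recurrent (hc : c 0 = 1) (hcd : c d ≠ 0) (hs : StableGenerator c d)
    (hp : PersistentGenerator c d) (w : Fin d → E) {ε : ℝ} (hε : 0 < ε) :
    ∃ t : ℕ, ‖(genStep c)^[t + 1] w - w‖ < ε := by
  obtain ⟨K, hK, hb⟩ := genStep_iterate_bounded (E := E) hc hcd hs
  obtain ⟨K', hK', hb'⟩ := genStep_iterate_bounded_below (E := E) hc hcd hs hp
  obtain ⟨a, -, φ, hφ, hlim⟩ := tendsto_subseq_of_bounded
    (Metric.isBounded_closedBall (x := (0 : Fin d → E)) (r := K * ‖w‖))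
    (x := fun t => (genStep c)^[t] w) (fun k => by simpa using hb k w)
  obtain ⟨J, hJ⟩ := Metric.cauchySeq_iff.1 hlim.cauchySeq (ε / K') (by positivity)
  have h1 := hJ (J + 1) (by omega) J le_rfl
  have h2 : φ J < φ (J + 1) := hφ (by omega)
  obtain ⟨t, ht⟩ : ∃ t, φ (J + 1) = φ J + (t + 1) := ⟨φ (J + 1) - φ J - 1, by omega⟩
  refine ⟨t, ?_⟩
  have h3 := hb' (φ J) ((genStep c)^[t + 1] w - w)
  have h4 : (genStep c)^[φ J] ((genStep c)^[t + 1] w - w)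
      = (genStep c)^[φ (J + 1)] w - (genStep c)^[φ J] w := by
    rw [ht, Function.iterate_add_apply _ (φ J) (t + 1)]
    simp only [genStep_iterate (φ J), map_sub]
  rw [h4] at h3
  simp only [Function.comp_apply, dist_eq_norm] at h1
  calc _ ≤ _ := h3
    _ < K' * (ε / K') := by gcongr
    _ = ε := by field_simp

end Normed

end Generator

/-! ### Linear structure of the prediction model -/

theorem sum_smul_push {c : ℕ → ℝ} {d : ℕ} [NeZero d] {E : Type*} [AddCommGroup E] [Module ℝ E]
    (a : E) (w : Fin d → E) (hd : d - 1 < d) :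
    ∑ j : Fin d, c j • push a w j = c 0 • a - genNext c w - c d • w ⟨d - 1, hd⟩ := by
  obtain ⟨k, rfl⟩ : ∃ k, d = k + 1 := ⟨d - 1, by omega⟩
  rw [Fin.sum_univ_succ, genNext, Fin.sum_univ_castSucc]
  have : ∀ i : Fin k, push a w i.succ = w i.castSucc := fun i => push_succ a w i (by omega)
  simp only [this, Fin.val_succ, Fin.val_castSucc, Fin.val_last]
  have h0 : push a w 0 = a := by simp [push]
  rw [h0]
  have : (⟨k + 1 - 1, hd⟩ : Fin (k + 1)) = Fin.last k := rfl
  rw [this]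
  simp only [Fin.val_zero]
  abel

namespace ExtState

variable {n m p d : ℕ}

theorem ext' {ξ ζ : ExtState n m p d} (h1 : ξ.dx = ζ.dx) (h2 : ξ.eWin = ζ.eWin)
    (h3 : ξ.xWin = ζ.xWin) (h4 : ξ.uWin = ζ.uWin) : ξ = ζ :=
  Prod.ext h1 (Prod.ext h2 (Prod.ext h3 h4))

/-- `ExtState.dx` as a linear map. -/
def dxL : ExtState n m p d →ₗ[ℝ] (Fin n → ℝ) := LinearMap.fst ℝ _ _

/-- `ExtState.eWin` as a linear map. -/
def eWinL : ExtState n m p d →ₗ[ℝ] (Fin d → Fin p → ℝ) :=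
  LinearMap.fst ℝ _ _ ∘ₗ LinearMap.snd ℝ _ _

/-- `ExtState.xWin` as a linear map. -/
def xWinL : ExtState n m p d →ₗ[ℝ] (Fin d → Fin n → ℝ) :=
  LinearMap.fst ℝ _ _ ∘ₗ LinearMap.snd ℝ _ _ ∘ₗ LinearMap.snd ℝ _ _

/-- `ExtState.uWin` as a linear map. -/
def uWinL : ExtState n m p d →ₗ[ℝ] (Fin d → Fin m → ℝ) :=
  LinearMap.snd ℝ _ _ ∘ₗ LinearMap.snd ℝ _ _ ∘ₗ LinearMap.snd ℝ _ _

/-- `ExtState.x` as a linear map. -/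
def xL [NeZero d] : ExtState n m p d →ₗ[ℝ] (Fin n → ℝ) := LinearMap.proj 0 ∘ₗ xWinL

/-- `ExtState.e` as a linear map. -/
def eL [NeZero d] : ExtState n m p d →ₗ[ℝ] (Fin p → ℝ) := LinearMap.proj 0 ∘ₗ eWinL

/-- `ExtState.uPrev` as a linear map. -/
def uPrevL [NeZero d] : ExtState n m p d →ₗ[ℝ] (Fin m → ℝ) := LinearMap.proj 0 ∘ₗ uWinL

theorem dxL_apply (ξ : ExtState n m p d) : dxL ξ = ξ.dx := rfl
theorem eWinL_apply (ξ : ExtState n m p d) : eWinL ξ = ξ.eWin := rfl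
theorem xWinL_apply (ξ : ExtState n m p d) : xWinL ξ = ξ.xWin := rfl
theorem uWinL_apply (ξ : ExtState n m p d) : uWinL ξ = ξ.uWin := rfl

end ExtState

namespace Data

variable {n m p d N : ℕ} [NeZero d] (D : Data n m p d N)

theorem predStep_add (ξ ξ' : ExtState n m p d) (u u' : Fin m → ℝ) (a a' : Fin n → ℝ) (b b' : Fin p → ℝ) :
    D.predStep (ξ + ξ') (u + u') (a + a') (b + b') = D.predStep ξ u a b + D.predStep ξ' u' a' b' := by
  refine ExtState.ext' ?_ ?_ ?_ ?_
  · simp only [predStep, ExtState.dx, Prod.fst_add, mulVec_add]; abel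
  · simp only [predStep, ExtState.eWin, ExtState.dx, Prod.fst_add, Prod.snd_add]
    rw [← push_add]; congr 1
    simp only [mulVec_add, ← genNextL_apply, map_add]; abel
  · simp only [predStep, ExtState.xWin, ExtState.dx, Prod.fst_add, Prod.snd_add]
    rw [← push_add]; congr 1
    simp only [mulVec_add, ← genNextL_apply, map_add]; abel
  · simp only [predStep, ExtState.uWin, Prod.snd_add]
    rw [← push_add]; congr 1
    simp only [← genNextL_apply, map_add]; abel

theorem predStep_smul (r : ℝ) (ξ : ExtState n m p d) (u : Fin m → ℝ) (a : Fin n → ℝ) (b : Fin p → ℝ) :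
    D.predStep (r • ξ) (r • u) (r • a) (r • b) = r • D.predStep ξ u a b := by
  refine ExtState.ext' ?_ ?_ ?_ ?_
  · simp only [predStep, ExtState.dx, Prod.smul_fst, mulVec_smul, smul_add]
  · simp only [predStep, ExtState.eWin, ExtState.dx, Prod.smul_fst, Prod.smul_snd]
    rw [← push_smul]; congr 1
    simp only [mulVec_smul, ← genNextL_apply, map_smul, mulVec_add, smul_add]
  · simp only [predStep, ExtState.xWin, ExtState.dx, Prod.smul_fst, Prod.smul_snd]
    rw [← push_smul]; congr 1
    simp only [mulVec_smul, ← genNextL_apply, map_smul, smul_add]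
  · simp only [predStep, ExtState.uWin, Prod.smul_snd]
    rw [← push_smul]; congr 1
    simp only [← genNextL_apply, map_smul, smul_add]

theorem predStep_xWin_succ (ξ : ExtState n m p d) (u : Fin m → ℝ) (a : Fin n → ℝ) (b : Fin p → ℝ)
    (i : ℕ) (h : i + 1 < d) : (D.predStep ξ u a b).xWin ⟨i + 1, h⟩ = ξ.xWin ⟨i, by omega⟩ := by
  simp [predStep, ExtState.xWin, push]

theorem predStep_eWin_succ (ξ : ExtState n m p d) (u : Fin m → ℝ) (a : Fin n → ℝ) (b : Fin p → ℝ)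
    (i : ℕ) (h : i + 1 < d) : (D.predStep ξ u a b).eWin ⟨i + 1, h⟩ = ξ.eWin ⟨i, by omega⟩ := by
  simp [predStep, ExtState.eWin, push]

theorem predStep_uWin_succ (ξ : ExtState n m p d) (u : Fin m → ℝ) (a : Fin n → ℝ) (b : Fin p → ℝ)
    (i : ℕ) (h : i + 1 < d) : (D.predStep ξ u a b).uWin ⟨i + 1, h⟩ = ξ.uWin ⟨i, by omega⟩ := by
  simp [predStep, ExtState.uWin, push]

theorem predStep_sub (ξ ξ' : ExtState n m p d) (u u' : Fin m → ℝ) (a a' : Fin n → ℝ) (b b' : Fin p → ℝ) :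
    D.predStep (ξ - ξ') (u - u') (a - a') (b - b') = D.predStep ξ u a b - D.predStep ξ' u' a' b' := by
  rw [eq_sub_iff_add_eq, ← predStep_add]; simp

theorem predStep_zero : D.predStep 0 0 0 0 = 0 := by
  simpa using D.predStep_smul 0 0 0 0 0

theorem step_add (ξ ξ' : ExtState n m p d) (u u' : Fin m → ℝ) :
    D.step (ξ + ξ') (u + u') = D.step ξ u + D.step ξ' u' := by
  simpa [step] using D.predStep_add ξ ξ' u u' 0 0 0 0

theorem step_smul (r : ℝ) (ξ : ExtState n m p d) (u : Fin m → ℝ) :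
    D.step (r • ξ) (r • u) = r • D.step ξ u := by
  simpa [step] using D.predStep_smul r ξ u 0 0

theorem step_zero : D.step 0 0 = 0 := D.predStep_zero

/-- The system matrix `A_ξ`. -/
def stepL : ExtState n m p d →ₗ[ℝ] ExtState n m p d where
  toFun ξ := D.step ξ 0
  map_add' ξ ζ := by simpa using D.step_add ξ ζ 0 0
  map_smul' r ξ := by simpa using D.step_smul r ξ 0

theorem free_eq (t : ℕ) (ξ : ExtState n m p d) : D.free t ξ = (D.stepL ^ t) ξ := by
  rw [Module.End.pow_apply]; rfl

theorem free_zero (ξ : ExtState n m p d) : D.free 0 ξ = ξ := rfl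

theorem free_succ (t : ℕ) (ξ : ExtState n m p d) : D.free (t + 1) ξ = D.step (D.free t ξ) 0 := by
  rw [free, Function.iterate_succ_apply']; rfl

theorem free_add (s t : ℕ) (ξ : ExtState n m p d) : D.free (s + t) ξ = D.free s (D.free t ξ) :=
  Function.iterate_add_apply _ _ _ _

theorem traj_add (ξ ξ' : ExtState n m p d) (u u' : ℕ → Fin m → ℝ) (k : ℕ) :
    D.traj (ξ + ξ') (u + u') k = D.traj ξ u k + D.traj ξ' u' k := by
  induction k with
  | zero => rfl
  | succ k ih => simp only [traj, ih, Pi.add_apply, step_add]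

theorem traj_smul (r : ℝ) (ξ : ExtState n m p d) (u : ℕ → Fin m → ℝ) (k : ℕ) :
    D.traj (r • ξ) (r • u) k = r • D.traj ξ u k := by
  induction k with
  | zero => rfl
  | succ k ih => simp only [traj, ih, Pi.smul_apply, step_smul]

theorem traj_zero (ξ : ExtState n m p d) (k : ℕ) : D.traj ξ 0 k = D.free k ξ := by
  induction k with
  | zero => rfl
  | succ k ih => rw [free_succ, ← ih]; rfl

theorem traj_congr {u u' : ℕ → Fin m → ℝ} {k : ℕ} (h : ∀ j < k, u j = u' j) (ξ : ExtState n m p d) :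
    D.traj ξ u k = D.traj ξ u' k := by
  induction k with
  | zero => rfl
  | succ k ih => simp only [traj]; rw [ih fun j hj => h j (by omega), h k (by omega)]

theorem traj_shift (ξ : ExtState n m p d) (u : ℕ → Fin m → ℝ) (s t : ℕ) :
    D.traj ξ u (s + t) = D.traj (D.traj ξ u s) (fun k => u (s + k)) t := by
  induction t with
  | zero => rfl
  | succ t ih => rw [← add_assoc]; simp only [traj, ih]

/-- `D.xOld` as a linear map. -/
def xOldL : ExtState n m p d →ₗ[ℝ] (Fin d → Fin n → ℝ) where
  toFun ξ := D.xOld ξ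
  map_add' ξ ζ := by
    funext i; simp only [xOld, Pi.add_apply]; split
    · rfl
    · rw [← smul_add]; congr 1
      simp only [← ExtState.xWinL_apply, ← ExtState.dxL_apply, map_add, Pi.add_apply, smul_add,
        Finset.sum_add_distrib]; abel
  map_smul' r ξ := by
    funext i; simp only [xOld, Pi.smul_apply, RingHom.id_apply]; split
    · rfl
    · rw [smul_comm]; congr 1
      simp only [← ExtState.xWinL_apply, ← ExtState.dxL_apply, map_smul, Pi.smul_apply, smul_sub,
        Finset.smul_sum, smul_comm r]

theorem xOldL_apply (ξ : ExtState n m p d) : D.xOldL ξ = D.xOld ξ := rfl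

/-- `D.Tv` as a linear map. -/
def TvL : ExtState n m p d →ₗ[ℝ] DistWindow n p d where
  toFun ξ := D.Tv ξ
  map_add' ξ ζ := by
    funext i
    simp only [Tv, ← xOldL_apply, ← ExtState.xWinL_apply, ← ExtState.uWinL_apply,
      ← ExtState.eWinL_apply, map_add, Pi.add_apply, mulVec_add, Prod.mk_add_mk]
    congr 1 <;> abel
  map_smul' r ξ := by
    funext i
    simp only [Tv, ← xOldL_apply, ← ExtState.xWinL_apply, ← ExtState.uWinL_apply,
      ← ExtState.eWinL_apply, map_smul, Pi.smul_apply, mulVec_smul, Prod.smul_mk, smul_sub,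
      RingHom.id_apply]

theorem TvL_apply (ξ : ExtState n m p d) : D.TvL ξ = D.Tv ξ := rfl

theorem Tv_add (ξ ζ : ExtState n m p d) : D.Tv (ξ + ζ) = D.Tv ξ + D.Tv ζ := D.TvL.map_add ξ ζ
theorem Tv_sub (ξ ζ : ExtState n m p d) : D.Tv (ξ - ζ) = D.Tv ξ - D.Tv ζ := D.TvL.map_sub ξ ζ
theorem Tv_smul (r : ℝ) (ξ : ExtState n m p d) : D.Tv (r • ξ) = r • D.Tv ξ := D.TvL.map_smul r ξ

/-- `D.T0` as a linear map. -/
def T0L : ExtState n m p d →ₗ[ℝ] LoopState n p d := ExtState.xL.prod D.Tc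

theorem T0L_apply (ξ : ExtState n m p d) : D.T0L ξ = D.T0 ξ := rfl

theorem T0_add (ξ ζ : ExtState n m p d) : D.T0 (ξ + ζ) = D.T0 ξ + D.T0 ζ := D.T0L.map_add ξ ζ
theorem T0_sub (ξ ζ : ExtState n m p d) : D.T0 (ξ - ζ) = D.T0 ξ - D.T0 ζ := D.T0L.map_sub ξ ζ
theorem T0_smul (r : ℝ) (ξ : ExtState n m p d) : D.T0 (r • ξ) = r • D.T0 ξ := D.T0L.map_smul r ξ

/-- `D.dK` as a linear map. -/
def dKL : ExtState n m p d →ₗ[ℝ] (Fin m → ℝ) where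
  toFun ξ := D.dK ξ
  map_add' ξ ζ := by
    simp only [dK, ← ExtState.dxL_apply, ← ExtState.eWinL_apply, map_add, Pi.add_apply, mulVec_add,
      Finset.sum_add_distrib]; abel
  map_smul' r ξ := by
    simp only [dK, ← ExtState.dxL_apply, ← ExtState.eWinL_apply, map_smul, Pi.smul_apply, mulVec_smul,
      smul_add, Finset.smul_sum, RingHom.id_apply]

theorem dKL_apply (ξ : ExtState n m p d) : D.dKL ξ = D.dK ξ := rfl

/-- `D.K` as a linear map. -/
def KL : ExtState n m p d →ₗ[ℝ] (Fin m → ℝ) := D.dKL + genNextL D.c ∘ₗ ExtState.uWinL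

theorem KL_apply (ξ : ExtState n m p d) : D.KL ξ = D.K ξ := rfl

/-- The nominal closed loop `ξ ↦ A_ξ ξ + B_ξ Δu` with `Δu` from the stabilizing feedback. -/
def loopL : ExtState n m p d →ₗ[ℝ] ExtState n m p d where
  toFun ξ := D.step ξ (D.dK ξ)
  map_add' ξ ζ := by rw [← dKL_apply, map_add]; exact D.step_add _ _ _ _
  map_smul' r ξ := by rw [← dKL_apply, map_smul]; exact D.step_smul _ _ _

theorem loopL_apply (ξ : ExtState n m p d) : D.loopL ξ = D.step ξ (D.dK ξ) := rfl

theorem loopL_iterate (t : ℕ) (ξ : ExtState n m p d) :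
    (fun ζ => D.step ζ (D.dK ζ))^[t] ξ = (D.loopL ^ t) ξ := by
  rw [Module.End.pow_apply]; rfl

/-! ### The disturbance coordinates -/

section Coordinates

variable {D}

theorem xWin_zero_eq (hc : D.c 0 = 1) (hcd : D.c d ≠ 0) (ξ : ExtState n m p d) :
    ξ.xWin 0 = ξ.dx + genNext D.c (D.xOld ξ) := by
  have hd : d - 1 < d := by have := Nat.pos_of_neZero d; omega
  have h1 := sum_smul_push (c := D.c) (ξ.xWin 0) (D.xOld ξ) hd
  have h2 : push (ξ.xWin 0) (D.xOld ξ) = ξ.xWin := by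
    funext ⟨i, hi⟩
    cases i with
    | zero => exact push_zero _ _
    | succ i => rw [push_succ, xOld, dif_pos hi]
  have h3 : D.c d • D.xOld ξ ⟨d - 1, hd⟩ = ξ.dx - ∑ j : Fin d, D.c j • ξ.xWin j := by
    rw [xOld, dif_neg (by simp only; omega), smul_inv_smul₀ hcd]
  rw [h2, hc, one_smul, h3] at h1
  have : ξ.xWin 0 - genNext D.c (D.xOld ξ) - ξ.dx = 0 := by
    have h4 := sub_eq_zero.2 h1.symm
    rw [← h4]; abel
  rw [sub_sub, sub_eq_zero] at this
  rw [this, add_comm]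

theorem xOld_predStep (hc : D.c 0 = 1) (hcd : D.c d ≠ 0) (ξ : ExtState n m p d) (u : Fin m → ℝ)
    (a : Fin n → ℝ) (b : Fin p → ℝ) : D.xOld (D.predStep ξ u a b) = ξ.xWin := by
  have hd : d - 1 < d := by have := Nat.pos_of_neZero d; omega
  funext ⟨i, hi⟩
  rw [xOld]
  split
  next h => exact push_succ (D.A *ᵥ ξ.dx + D.B *ᵥ u + a + genNext D.c ξ.xWin) ξ.xWin i h
  next h =>
    simp only at h
    have h1 := sum_smul_push (c := D.c) (D.A *ᵥ ξ.dx + D.B *ᵥ u + a + genNext D.c ξ.xWin) ξ.xWin hd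
    have h2 : ∑ j : Fin d, D.c j • (D.predStep ξ u a b).xWin j
        = D.A *ᵥ ξ.dx + D.B *ᵥ u + a - D.c d • ξ.xWin ⟨d - 1, hd⟩ := by
      refine h1.trans ?_
      rw [hc, one_smul]; abel
    rw [h2, show (D.predStep ξ u a b).dx = D.A *ᵥ ξ.dx + D.B *ᵥ u + a from rfl, sub_sub_cancel,
      inv_smul_smul₀ hcd]
    congr 1
    exact Fin.ext (by simp only; omega)

theorem Tv_predStep_zero (hc : D.c 0 = 1) (hcd : D.c d ≠ 0) (ξ : ExtState n m p d) (u : Fin m → ℝ)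
    (a : Fin n → ℝ) (b : Fin p → ℝ) :
    (D.Tv (D.predStep ξ u a b) 0).1 = (D.predStep ξ u a b).x - D.A *ᵥ ξ.x
      - D.B *ᵥ (u + genNext D.c ξ.uWin) := by
  simp only [Tv, xOld_predStep hc hcd]
  rw [add_comm u]
  rfl

theorem Tv_step (hc : D.c 0 = 1) (hcd : D.c d ≠ 0) (ξ : ExtState n m p d) (u : Fin m → ℝ) :
    D.Tv (D.step ξ u) = genStep D.c (D.Tv ξ) := by
  funext ⟨i, hi⟩
  cases i with
  | zero =>
    have h0 : (⟨0, hi⟩ : Fin d) = 0 := rfl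
    rw [h0, genStep, push_zero]
    have hA : D.A *ᵥ genNext D.c (D.xOld ξ) = genNext D.c (fun i => D.A *ᵥ D.xOld ξ i) :=
      (genNext_map D.A.mulVecLin (D.xOld ξ)).symm
    have hB : D.B *ᵥ genNext D.c ξ.uWin = genNext D.c (fun i => D.B *ᵥ ξ.uWin i) :=
      (genNext_map D.B.mulVecLin ξ.uWin).symm
    have hC : D.C *ᵥ genNext D.c ξ.xWin = genNext D.c (fun i => D.C *ᵥ ξ.xWin i) :=
      (genNext_map D.C.mulVecLin ξ.xWin).symm
    have h1 : genNext D.c (D.Tv ξ) = (genNext D.c ξ.xWin - D.A *ᵥ genNext D.c (D.xOld ξ)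
        - D.B *ᵥ genNext D.c ξ.uWin, genNext D.c ξ.eWin - D.C *ᵥ genNext D.c ξ.xWin) := by
      refine Prod.ext ?_ ?_
      · refine (genNext_map (LinearMap.fst ℝ _ _) (D.Tv ξ)).symm.trans ?_
        rw [hA, hB]
        simp only [← genNextL_apply, ← map_sub]; rfl
      · refine (genNext_map (LinearMap.snd ℝ _ _) (D.Tv ξ)).symm.trans ?_
        rw [hC]
        simp only [← genNextL_apply, ← map_sub]; rfl
    rw [h1]
    refine Prod.ext ?_ ?_
    · rw [step, Tv_predStep_zero hc hcd]
      have h2 : (D.predStep ξ u 0 0).x = D.A *ᵥ ξ.dx + D.B *ᵥ u + 0 + genNext D.c ξ.xWin := by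
        exact push_zero _ ξ.xWin
      have h3 := xWin_zero_eq hc hcd ξ
      rw [h2, show ξ.x = ξ.xWin 0 from rfl, h3]
      simp only [mulVec_add]; abel
    · have h2 : (D.step ξ u).xWin 0 = D.A *ᵥ ξ.dx + D.B *ᵥ u + 0 + genNext D.c ξ.xWin :=
        push_zero (d := d) _ ξ.xWin
      have h3 : (D.step ξ u).eWin 0 = D.C *ᵥ (D.A *ᵥ ξ.dx + D.B *ᵥ u + 0) + genNext D.c ξ.eWin + 0 :=
        push_zero (d := d) (D.C *ᵥ (D.A *ᵥ ξ.dx + D.B *ᵥ u + 0) + genNext D.c ξ.eWin + 0) ξ.eWin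
      simp only [Tv]
      rw [h2, h3, mulVec_add D.C _ (genNext _ _)]; abel
  | succ i =>
    rw [genStep, push_succ]
    simp only [Tv, step, xOld_predStep hc hcd]
    have h1 : (D.predStep ξ u 0 0).xWin ⟨i + 1, hi⟩ = ξ.xWin ⟨i, by omega⟩ :=
      D.predStep_xWin_succ ξ u 0 0 i hi
    have h2 : (D.predStep ξ u 0 0).eWin ⟨i + 1, hi⟩ = ξ.eWin ⟨i, by omega⟩ :=
      D.predStep_eWin_succ ξ u 0 0 i hi
    have h3 : (D.predStep ξ u 0 0).uWin ⟨i + 1, hi⟩ = ξ.uWin ⟨i, by omega⟩ :=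
      D.predStep_uWin_succ ξ u 0 0 i hi
    have h4 : D.xOld ξ ⟨i, by omega⟩ = ξ.xWin ⟨i + 1, hi⟩ := by rw [xOld, dif_pos hi]
    rw [h1, h2, h3, h4]

theorem Tv_traj (hc : D.c 0 = 1) (hcd : D.c d ≠ 0) (ξ : ExtState n m p d) (u : ℕ → Fin m → ℝ) (k : ℕ) :
    D.Tv (D.traj ξ u k) = (genStep D.c)^[k] (D.Tv ξ) := by
  induction k with
  | zero => rfl
  | succ k ih => rw [traj, Tv_step hc hcd, ih, Function.iterate_succ_apply']

theorem Tv_free (hc : D.c 0 = 1) (hcd : D.c d ≠ 0) (ξ : ExtState n m p d) (k : ℕ) :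
    D.Tv (D.free k ξ) = (genStep D.c)^[k] (D.Tv ξ) := by
  rw [← traj_zero, Tv_traj hc hcd]

theorem free_of_dx {ξ : ExtState n m p d} (h : ξ.dx = 0) (t : ℕ) :
    D.free t ξ = ((0 : Fin n → ℝ), (genStep D.c)^[t] ξ.eWin, (genStep D.c)^[t] ξ.xWin,
      (genStep D.c)^[t] ξ.uWin) := by
  induction t with
  | zero => exact ExtState.ext' h rfl rfl rfl
  | succ t ih =>
    rw [free_succ, ih]
    simp only [Function.iterate_succ_apply']
    refine ExtState.ext' ?_ ?_ ?_ ?_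
    · simp [step, predStep, ExtState.dx]
    · simp [step, predStep, ExtState.dx, ExtState.eWin, genStep]
    · simp [step, predStep, ExtState.dx, ExtState.xWin, genStep]
    · simp [step, predStep, ExtState.uWin, genStep]

variable (hD : D.Standing)
include hD

/-- The loop coordinates of the closed loop obey the error dynamics, the disturbance being read off
from the disturbance coordinates. -/
theorem T0_predStep (ξ : ExtState n m p d) (a : Fin n → ℝ) (b : Fin p → ℝ) :
    D.T0 (D.predStep ξ (D.dK ξ) a b) =
      D.errStep (D.T0 ξ) ((D.Tv (D.predStep ξ (D.dK ξ) a b) 0).1, (D.Tv ξ 0).2) := by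
  have hK := hD.ctrl_output ξ
  have he : ξ.e = D.C *ᵥ ξ.x + (D.Tv ξ 0).2 := by simp [Tv, ExtState.e, ExtState.eWin, ExtState.x, ExtState.xWin]
  refine Prod.ext ?_ ?_
  · rw [Tv_predStep_zero hD.c_zero hD.c_last]
    have h1 : D.dK ξ + genNext D.c ξ.uWin = D.K ξ := rfl
    rw [h1]
    simp only [errStep, T0]
    have h2 : (D.A + D.B * (D.Kx + D.Dc * D.C)) *ᵥ ξ.x + (D.B * D.Cc) *ᵥ D.Tc ξ
        + (D.B * D.Dc) *ᵥ (D.Tv ξ 0).2 = D.A *ᵥ ξ.x + D.B *ᵥ D.K ξ := by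
      rw [hK, he]
      simp only [mulVec_add, add_mulVec, ← mulVec_mulVec]
      abel
    have h3 : D.A *ᵥ ξ.x + D.B *ᵥ D.K ξ + ((D.predStep ξ (D.dK ξ) a b).x - D.A *ᵥ ξ.x - D.B *ᵥ D.K ξ)
        = (D.predStep ξ (D.dK ξ) a b).x := by abel
    refine h3.symm.trans ?_
    rw [← h2]
    abel
  · simp only [errStep, T0]
    rw [hD.ctrl_state, he]
    simp only [mulVec_add, ← mulVec_mulVec]
    abel

/-- The transformation `T = (T_0, T_v)` as a linear equivalence. -/
def T : ExtState n m p d ≃ₗ[ℝ] LoopState n p d × DistWindow n p d :=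
  LinearEquiv.ofBijective (D.T0L.prod D.TvL) hD.transformation

theorem T_apply (ξ : ExtState n m p d) : T hD ξ = (D.T0 ξ, D.Tv ξ) := rfl

theorem T0_symm (s : LoopState n p d) (v : DistWindow n p d) : D.T0 ((T hD).symm (s, v)) = s :=
  congrArg Prod.fst ((T_apply hD _).symm.trans ((T hD).apply_symm_apply (s, v)))

theorem Tv_symm (s : LoopState n p d) (v : DistWindow n p d) : D.Tv ((T hD).symm (s, v)) = v :=
  congrArg Prod.snd ((T_apply hD _).symm.trans ((T hD).apply_symm_apply (s, v)))

/-- Well-posed regulation: on `ker T_v`, the increment `Δx` and the output window determine the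
extended state. -/
theorem eq_zero_of_dx_eWin {ξ : ExtState n m p d} (hv : D.Tv ξ = 0) (hx : ξ.dx = 0)
    (he : ξ.eWin = 0) : ξ = 0 := by
  have hc := hD.c_zero
  have hcd := hD.c_last
  obtain ⟨x, hx1, hx2⟩ := exists_solution hc hcd ξ.xWin
  obtain ⟨u, hu1, hu2⟩ := exists_solution hc hcd ξ.uWin
  have hx0 : ∀ i : Fin d, x (-(i : ℕ)) = ξ.xWin i := fun i => by simpa using hx2 0 i
  have hu0 : ∀ i : Fin d, u (-(i : ℕ)) = ξ.uWin i := fun i => by simpa using hu2 0 i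
  have hxo : ∀ i : Fin d, x (-1 - (i : ℕ)) = D.xOld ξ i := by
    -- both windows are mapped to `ξ.xWin` by the companion map
    have h1 : (fun i : Fin d => x (-1 - (i : ℕ))) - D.xOld ξ = 0 := by
      refine genStep_injective hcd ?_
      rw [← genStepL_apply, map_sub, sub_eq_zero]
      have e1 : genStep D.c (fun i : Fin d => x (-1 - (i : ℕ))) = ξ.xWin := by
        have h2 := window_succ (d := d) x 0
        have h3 := (delayFilter_eq hc x 0).symm.trans (hx1 0)
        rw [sub_eq_zero] at h3
        rw [h3] at h2
        simp only [zero_sub] at h2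
        rw [genStep, ← h2]
        funext i; exact hx0 i
      have e2 : genStep D.c (D.xOld ξ) = ξ.xWin := by
        have h3 := xWin_zero_eq hc hcd ξ
        rw [hx, zero_add] at h3
        rw [genStep, ← h3]
        funext ⟨i, hi⟩
        cases i with
        | zero => exact push_zero _ _
        | succ i => rw [push_succ, xOld, dif_pos hi]
      exact e1.trans e2.symm
    intro i
    exact sub_eq_zero.1 (congrFun h1 i)
  have hv1 : ∀ i, ξ.xWin i - D.A *ᵥ D.xOld ξ i - D.B *ᵥ ξ.uWin i = 0 :=
    fun i => congrArg Prod.fst (congrFun hv i)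
  have hv2 : ∀ i, ξ.eWin i - D.C *ᵥ ξ.xWin i = 0 := fun i => congrArg Prod.snd (congrFun hv i)
  have hdyn : ∀ t, x t + (-D.A.mulVecLin) (x (t - 1)) + (-D.B.mulVecLin) (u t) = 0 := by
    refine solution_eq_zero hc hcd (fun t => ?_) fun i => ?_
    · rw [delayFilter_add, delayFilter_add, hx1, delayFilter_map (-D.A.mulVecLin) (fun t => x (t - 1)),
        delayFilter_map (-D.B.mulVecLin) u, hu1, delayFilter_shift, hx1]
      simp
    · have h1 := hv1 i
      have h2 := hxo i
      rw [show (-1 - (i : ℕ) : ℤ) = -(i : ℕ) - 1 by ring] at h2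
      rw [h2, hx0, hu0, ← h1]
      simp only [LinearMap.neg_apply, mulVecLin_apply]; abel
  have hout : ∀ t, D.C.mulVecLin (x t) = 0 := by
    refine solution_eq_zero hc hcd (fun t => ?_) fun i => ?_
    · rw [delayFilter_map, hx1, map_zero]
    · have h1 := hv2 i
      rw [he] at h1
      rw [hx0, mulVecLin_apply]
      simpa using h1
  obtain ⟨xu, -, huniq⟩ := hD.wellPosed 0 0 (fun t => by simp [delayFilter]) (fun t => by simp [delayFilter])
  have h1 := huniq (x, fun t => u (t + 1)) ⟨hx1, fun t => by
    have := delayFilter_shift (c := D.c) (d := d) u (-1) t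
    simp only [sub_neg_eq_add] at this
    rw [this, hu1], fun t => ⟨by
      have := hdyn (t + 1)
      simp only [LinearMap.neg_apply, mulVecLin_apply, add_sub_cancel_right] at this
      rw [← sub_eq_add_neg, ← sub_eq_add_neg, sub_sub, sub_eq_zero] at this
      simpa using this, by
      have := hout t
      rw [mulVecLin_apply] at this
      simp [this]⟩⟩
  have h2 := huniq (0, 0) ⟨fun t => by simp [delayFilter], fun t => by simp [delayFilter],
    fun t => by simp⟩
  have h3 := h1.trans h2.symm
  have h4 : x = 0 := congrArg Prod.fst h3
  have h5 : ∀ t, u t = 0 := fun t => by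
    have := congrFun (congrArg Prod.snd h3) (t - 1)
    simpa using this
  refine ExtState.ext' hx he ?_ ?_
  · funext i; rw [← hx0, h4]; rfl
  · funext i; rw [← hu0, h5]; rfl

end Coordinates

end Data

namespace Data

variable {n m p d N : ℕ} [NeZero d] {D : Data n m p d N}

/-! ### Steering the nominal model -/

variable (D) in
/-- The nominal evolution under zero absolute input `u = 0`, that is, `Δu = ∑_{i≥1} p_i u(t-i)`. -/
def restL : ExtState n m p d →ₗ[ℝ] ExtState n m p d where
  toFun ξ := D.step ξ (-genNext D.c ξ.uWin)
  map_add' ξ ζ := by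
    rw [← step_add, ← neg_add]
    simp only [← genNextL_apply, ← ExtState.uWinL_apply, map_add]
  map_smul' r ξ := by
    rw [RingHom.id_apply, ← step_smul, smul_neg]
    simp only [← genNextL_apply, ← ExtState.uWinL_apply, map_smul]

theorem restL_apply (ξ : ExtState n m p d) : D.restL ξ = D.step ξ (-genNext D.c ξ.uWin) := rfl

theorem step_uPrev (ξ : ExtState n m p d) (u : Fin m → ℝ) :
    (D.step ξ u).uPrev = u + genNext D.c ξ.uWin :=
  (push_zero (d := d) _ ξ.uWin).trans (add_comm _ _)

theorem step_x_of_Tv (hc : D.c 0 = 1) (hcd : D.c d ≠ 0) {ξ : ExtState n m p d} (hv : D.Tv ξ = 0)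
    (u : Fin m → ℝ) : (D.step ξ u).x = D.A *ᵥ ξ.x + D.B *ᵥ (u + genNext D.c ξ.uWin) := by
  have h1 := Tv_predStep_zero hc hcd ξ u 0 0
  have h2 := Tv_step hc hcd ξ u
  rw [hv, ← genStepL_apply, map_zero] at h2
  rw [show D.predStep ξ u 0 0 = D.step ξ u from rfl, h2] at h1
  rw [sub_sub, eq_comm] at h1
  exact sub_eq_zero.1 h1

/-- On `ker T_v`, a vanishing current state stays zero when the absolute input is kept at zero, and
the whole extended state vanishes once the windows have been flushed. -/
theorem restL_pow_of_x (hc : D.c 0 = 1) (hcd : D.c d ≠ 0) {ξ : ExtState n m p d} (hv : D.Tv ξ = 0)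
    (hx : ξ.x = 0) (k : ℕ) :
    D.Tv ((D.restL ^ k) ξ) = 0 ∧ (∀ i : Fin d, (i : ℕ) < k → ((D.restL ^ k) ξ).uWin i = 0) ∧
      ∀ i : Fin d, (i : ℕ) ≤ k → ((D.restL ^ k) ξ).xWin i = 0 := by
  induction k with
  | zero =>
    refine ⟨hv, fun i hi => absurd hi (by omega), fun i hi => ?_⟩
    have : i = 0 := Fin.ext (by simpa using hi)
    rw [this]; exact hx
  | succ k ih =>
    obtain ⟨h1, h2, h3⟩ := ih
    rw [pow_succ', Module.End.mul_apply]
    set ζ := (D.restL ^ k) ξ with hζ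
    have hζx : ζ.x = 0 := h3 0 (by simp)
    refine ⟨?_, ?_, ?_⟩
    · rw [restL_apply, Tv_step hc hcd, h1]; exact (genStepL D.c).map_zero
    · rintro ⟨i, hi⟩ hik
      cases i with
      | zero =>
        have := D.step_uPrev ζ (-genNext D.c ζ.uWin)
        rw [neg_add_cancel] at this
        exact this
      | succ i =>
        rw [restL_apply]
        exact (D.predStep_uWin_succ ζ _ 0 0 i hi).trans (h2 _ (by simp only at hik ⊢; omega))
    · rintro ⟨i, hi⟩ hik
      cases i with
      | zero =>
        have := step_x_of_Tv hc hcd h1 (-genNext D.c ζ.uWin)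
        rw [neg_add_cancel, hζx, mulVec_zero, mulVec_zero, add_zero] at this
        exact this
      | succ i =>
        rw [restL_apply]
        exact (D.predStep_xWin_succ ζ _ 0 0 i hi).trans (h3 _ (by simp only at hik ⊢; omega))

theorem eq_zero_of_windows (hc : D.c 0 = 1) (hcd : D.c d ≠ 0) {ξ : ExtState n m p d} (hv : D.Tv ξ = 0)
    (hx : ξ.xWin = 0) (hu : ξ.uWin = 0) (ho : D.xOld ξ = 0) : ξ = 0 := by
  refine ExtState.ext' ?_ ?_ hx hu
  · have := xWin_zero_eq hc hcd ξ
    rw [hx, ho, ← genNextL_apply, map_zero, add_zero] at this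
    exact this.symm
  · funext i
    have h1 : ξ.eWin i - D.C *ᵥ ξ.xWin i = 0 := congrArg Prod.snd (congrFun hv i)
    rw [hx, Pi.zero_apply, mulVec_zero, sub_zero] at h1
    exact h1

theorem restL_pow_eq_zero (hc : D.c 0 = 1) (hcd : D.c d ≠ 0) {ξ : ExtState n m p d} (hv : D.Tv ξ = 0)
    (hx : ξ.x = 0) {k : ℕ} (hk : d ≤ k) : (D.restL ^ k) ξ = 0 := by
  have hd := Nat.pos_of_neZero d
  have h0 : (D.restL ^ d) ξ = 0 := by
    obtain ⟨h1, h2, h3⟩ := restL_pow_of_x hc hcd hv hx d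
    refine eq_zero_of_windows hc hcd h1 (funext fun i => h3 i i.2.le) (funext fun i => h2 i i.2) ?_
    obtain ⟨-, -, h6⟩ := restL_pow_of_x hc hcd hv hx (d - 1)
    have : D.restL ^ d = D.restL * D.restL ^ (d - 1) := by
      rw [← pow_succ']; congr 1; omega
    rw [this, Module.End.mul_apply, restL_apply, step, xOld_predStep hc hcd]
    exact funext fun i => h6 i (by omega)
  obtain ⟨j, rfl⟩ : ∃ j, k = j + d := ⟨k - d, by omega⟩
  rw [pow_add, Module.End.mul_apply, h0, map_zero]

/-- Any sequence of absolute inputs is realized by suitable increments. -/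
theorem exists_increments (ξ : ExtState n m p d) (u : ℕ → Fin m → ℝ) :
    ∃ Δu : ℕ → Fin m → ℝ, ∀ k, Δu k = u k - genNext D.c (D.traj ξ Δu k).uWin := by
  let st : ℕ → ExtState n m p d := fun k =>
    Nat.rec ξ (fun k ζ => D.step ζ (u k - genNext D.c ζ.uWin)) k
  have h : ∀ k, D.traj ξ (fun k => u k - genNext D.c (st k).uWin) k = st k := by
    intro k
    induction k with
    | zero => rfl
    | succ k ih => rw [traj, ih]
  exact ⟨fun k => u k - genNext D.c (st k).uWin, fun k => by rw [h]⟩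

/-- The Kalman rank condition as null controllability in `n` steps. -/
theorem exists_null_inputs (hctr : Controllable D.A D.B) (x₀ : Fin n → ℝ) :
    ∃ u : ℕ → Fin m → ℝ, D.A ^ n *ᵥ x₀ + ∑ k ∈ Finset.range n, (D.A ^ (n - 1 - k) * D.B) *ᵥ u k = 0 := by
  have h1 : -(D.A ^ n *ᵥ x₀) ∈ ⨆ k : Fin n, LinearMap.range (D.A ^ (k : ℕ) * D.B).mulVecLin := by
    rw [show _ = ⊤ from hctr]; trivial
  obtain ⟨f, hf, hsum⟩ := (Submodule.mem_iSup_iff_exists_finsupp _ _).1 h1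
  choose w hw using hf
  refine ⟨fun k => if h : n - 1 - k < n then w ⟨n - 1 - k, h⟩ else 0, ?_⟩
  have h2 : ∑ k ∈ Finset.range n, (D.A ^ (n - 1 - k) * D.B) *ᵥ
      (if h : n - 1 - k < n then w ⟨n - 1 - k, h⟩ else 0) = ∑ k : Fin n, f k := by
    rw [← Finset.sum_range_reflect, Finset.sum_range]
    refine Finset.sum_congr rfl fun k _ => ?_
    have hk : n - 1 - (n - 1 - (k : ℕ)) = k := by omega
    simp only [hk, k.2, dif_pos, Fin.eta]
    rw [← hw k, mulVecLin_apply]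
  rw [h2, ← Finsupp.sum_fintype f (fun _ x => x) (fun _ => rfl), hsum, add_neg_cancel]

/-- Null controllability on `ker T_v`: the Kalman condition brings the plant state to zero in `n`
steps, and zero inputs then flush the windows in `d` steps. -/
theorem exists_null_increments (hD : D.Standing) {ξ : ExtState n m p d} (hv : D.Tv ξ = 0) :
    ∃ Δu : ℕ → Fin m → ℝ, ∀ k, n + d ≤ k → D.traj ξ Δu k = 0 ∧ Δu k = 0 := by
  have hc := hD.c_zero
  have hcd := hD.c_last
  obtain ⟨u, hu⟩ := exists_null_inputs hD.controllable ξ.x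
  obtain ⟨Δu, hΔ⟩ := D.exists_increments ξ (fun k => if k < n then u k else 0)
  have hvk : ∀ k, D.Tv (D.traj ξ Δu k) = 0 := fun k => by
    rw [Tv_traj hc hcd, hv, genStep_iterate, map_zero]
  have hx : ∀ k ≤ n, (D.traj ξ Δu k).x = D.A ^ k *ᵥ ξ.x
      + ∑ j ∈ Finset.range k, (D.A ^ (k - 1 - j) * D.B) *ᵥ u j := by
    intro k
    induction k with
    | zero => simp [traj]
    | succ k ih =>
      intro hk
      rw [traj, step_x_of_Tv hc hcd (hvk k), hΔ, sub_add_cancel, if_pos (by omega), ih (by omega),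
        Finset.sum_range_succ, mulVec_add, mulVec_mulVec, ← pow_succ', ← mulVecLin_apply D.A (∑ _ ∈ _, _), map_sum]
      simp only [mulVecLin_apply, mulVec_mulVec, add_tsub_cancel_right, tsub_self, pow_zero,
        Matrix.one_mul]
      rw [add_assoc]
      congr 2
      refine Finset.sum_congr rfl fun j hj => ?_
      rw [Finset.mem_range] at hj
      rw [← Matrix.mul_assoc, ← pow_succ', show k - 1 - j + 1 = k - j by omega]
  have hxn : (D.traj ξ Δu n).x = 0 := by rw [hx n le_rfl, hu]
  have hrest : ∀ j, D.traj ξ Δu (n + j) = (D.restL ^ j) (D.traj ξ Δu n) := by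
    intro j
    induction j with
    | zero => rfl
    | succ j ih =>
      rw [← add_assoc, traj, hΔ, ih, if_neg (by omega), zero_sub, pow_succ', Module.End.mul_apply]
      rfl
  refine ⟨Δu, fun k hk => ?_⟩
  have h0 : D.traj ξ Δu k = 0 := by
    obtain ⟨j, rfl⟩ : ∃ j, k = n + j := ⟨k - n, by omega⟩
    rw [hrest, restL_pow_eq_zero hc hcd (hvk n) hxn (by omega)]
  refine ⟨h0, ?_⟩
  rw [hΔ, h0, if_neg (by omega), zero_sub, neg_eq_zero]
  exact (genNextL D.c).map_zero

/-- Extension of `N` input increments by zero. -/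
def pad (du : Fin N → Fin m → ℝ) (k : ℕ) : Fin m → ℝ := if h : k < N then du ⟨k, h⟩ else 0

theorem pad_add (du du' : Fin N → Fin m → ℝ) : pad (du + du') = pad du + pad du' := by
  funext k; simp only [pad, Pi.add_apply]; split <;> simp

theorem pad_smul (r : ℝ) (du : Fin N → Fin m → ℝ) : pad (r • du) = r • pad du := by
  funext k; simp only [pad, Pi.smul_apply]; split <;> simp

theorem pad_apply (u : ℕ → Fin m → ℝ) {k : ℕ} (hk : k < N) :
    pad (N := N) (fun i => u i) k = u k := by simp [pad, hk]

variable (D) in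
/-- The nominal state at stage `k` as a linear function of the initial state and the increments. -/
def trajL (k : ℕ) : (ExtState n m p d × (Fin N → Fin m → ℝ)) →ₗ[ℝ] ExtState n m p d where
  toFun y := D.traj y.1 (pad y.2) k
  map_add' y z := by rw [Prod.fst_add, Prod.snd_add, pad_add, traj_add]
  map_smul' r y := by rw [Prod.smul_fst, Prod.smul_snd, pad_smul, traj_smul]; rfl

theorem trajL_apply (k : ℕ) (y : ExtState n m p d × (Fin N → Fin m → ℝ)) :
    D.trajL k y = D.traj y.1 (pad y.2) k := rfl

variable (D) in
/-- The absolute input at stage `k` as a linear function of the initial state and the increments. -/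
def inputL (k : ℕ) : (ExtState n m p d × (Fin N → Fin m → ℝ)) →ₗ[ℝ] (Fin m → ℝ) where
  toFun y := pad y.2 k + genNext D.c (D.trajL k y).uWin
  map_add' y z := by
    simp only [← genNextL_apply, ← ExtState.uWinL_apply, map_add, Prod.snd_add, pad_add, Pi.add_apply]
    abel
  map_smul' r y := by
    simp only [← genNextL_apply, ← ExtState.uWinL_apply, map_smul, Prod.smul_snd, pad_smul,
      Pi.smul_apply, smul_add, RingHom.id_apply]

theorem inputL_apply (k : ℕ) (y : ExtState n m p d × (Fin N → Fin m → ℝ)) :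
    D.inputL k y = pad y.2 k + genNext D.c (D.traj y.1 (pad y.2) k).uWin := rfl

theorem horizon_cases (hD : D.Standing) : Subsingleton (ExtState n m p d) ∧ m = 0 ∨ n + d ≤ N := by
  rcases Nat.eq_zero_or_pos (n + p + m) with h | h
  · left
    obtain rfl : n = 0 := by omega
    obtain rfl : m = 0 := by omega
    obtain rfl : p = 0 := by omega
    exact ⟨inferInstance, rfl⟩
  · right
    have h1 : d * 1 ≤ d * (n + p + m) := Nat.mul_le_mul_left d h
    have := hD.horizon
    omega

/-- States in `ker T_v` are steered to zero within the horizon, with increments bounded linearly. -/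
theorem exists_steering (hD : D.Standing) :
    ∃ K > 0, ∀ ξ : ExtState n m p d, D.Tv ξ = 0 →
      ∃ du : Fin N → Fin m → ℝ, D.trajL N (ξ, du) = 0 ∧ ‖du‖ ≤ K * ‖ξ‖ := by
  rcases horizon_cases hD with ⟨hs, -⟩ | hN
  · exact ⟨1, one_pos, fun ξ _ => ⟨0, Subsingleton.elim _ _, by simp⟩⟩
  let f : (Fin N → Fin m → ℝ) →ₗ[ℝ] ExtState n m p d := D.trajL N ∘ₗ LinearMap.inr ℝ _ _
  obtain ⟨g, hg⟩ := f.rangeRestrict.exists_rightInverse_of_surjective f.range_rangeRestrict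
  obtain ⟨K₁, hK₁, h1⟩ := exists_norm_map_le g
  obtain ⟨K₂, hK₂, h2⟩ := exists_norm_map_le (D.stepL ^ N)
  refine ⟨K₁ * K₂, by positivity, fun ξ hξ => ?_⟩
  have hsplit : ∀ du, D.trajL N (ξ, du) = (D.stepL ^ N) ξ + f du := by
    intro du
    have : ((ξ, du) : ExtState n m p d × (Fin N → Fin m → ℝ)) = (ξ, 0) + (0, du) := by simp
    rw [this, map_add]
    congr 1
    rw [trajL_apply, ← free_eq, ← traj_zero]
    congr 1
    funext k; simp [pad]
  have hmem : -(D.stepL ^ N) ξ ∈ LinearMap.range f := by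
    obtain ⟨Δu, hΔ⟩ := exists_null_increments hD hξ
    refine ⟨fun i => Δu i, ?_⟩
    rw [eq_neg_iff_add_eq_zero, add_comm, ← hsplit, trajL_apply,
      D.traj_congr (u' := Δu) (fun j hj => pad_apply Δu hj)]
    exact (hΔ N hN).1
  refine ⟨g ⟨_, hmem⟩, ?_, ?_⟩
  · rw [hsplit]
    have := congrArg Subtype.val (LinearMap.congr_fun hg ⟨_, hmem⟩)
    have h3 : f (g ⟨_, hmem⟩) = -(D.stepL ^ N) ξ := this
    rw [h3, add_neg_cancel]
  · calc _ ≤ K₁ * ‖(⟨_, hmem⟩ : LinearMap.range f)‖ := h1 _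
      _ = K₁ * ‖(D.stepL ^ N) ξ‖ := by rw [Submodule.coe_norm, norm_neg]
      _ ≤ K₁ * (K₂ * ‖ξ‖) := by gcongr; exact h2 _
      _ = _ := by ring

variable (D) in
/-- The increments that keep the absolute input at zero. -/
def restInc : ExtState n m p d →ₗ[ℝ] (Fin N → Fin m → ℝ) :=
  LinearMap.pi fun k : Fin N => -(genNextL D.c ∘ₗ ExtState.uWinL ∘ₗ D.restL ^ (k : ℕ))

/-- States in `ker T_v` with vanishing plant state are brought to zero without any effect on the
predicted plant states and inputs. -/
theorem restInc_spec (hD : D.Standing) {ξ : ExtState n m p d} (hv : D.Tv ξ = 0) (hx : ξ.x = 0) :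
    D.trajL N (ξ, D.restInc ξ) = 0 ∧
      ∀ k ≤ N, (D.trajL k (ξ, D.restInc ξ)).x = 0 ∧ D.inputL k (ξ, D.restInc ξ) = 0 := by
  rcases horizon_cases hD with ⟨hs, rfl⟩ | hN
  · exact ⟨Subsingleton.elim _ _, fun k _ => ⟨by rw [Subsingleton.elim (D.trajL k _) 0]; rfl,
      Subsingleton.elim _ _⟩⟩
  have hc := hD.c_zero
  have hcd := hD.c_last
  have htraj : ∀ k ≤ N, D.trajL k (ξ, D.restInc ξ) = (D.restL ^ k) ξ := by
    intro k
    induction k with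
    | zero => intro _; rfl
    | succ k ih =>
      intro hk
      have h1 := ih (by omega)
      rw [trajL_apply] at h1 ⊢
      rw [traj, h1, pow_succ', Module.End.mul_apply, restL_apply]
      congr 1
      simp only [pad, show k < N by omega, dif_pos]
      rfl
  have h0 : D.trajL N (ξ, D.restInc ξ) = 0 := by
    rw [htraj N le_rfl, restL_pow_eq_zero hc hcd hv hx (by omega)]
  refine ⟨h0, fun k hk => ⟨?_, ?_⟩⟩
  · rw [htraj k hk]
    exact (restL_pow_of_x hc hcd hv hx k).2.2 0 (by simp)
  · rcases hk.lt_or_eq with h | rfl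
    · rw [inputL_apply, ← trajL_apply k (ξ, D.restInc ξ), htraj k hk]
      simp only [pad, h, dif_pos]
      exact neg_add_cancel _
    · rw [inputL_apply, ← trajL_apply k (ξ, D.restInc ξ), h0]
      simp only [pad, lt_irrefl, dif_neg, not_false_eq_true, zero_add]
      exact (genNextL D.c).map_zero

/-- An admissible reference is reachable exactly when its disturbance state is the given one. -/
theorem isReachableRef_iff (hD : D.Standing) (hp : PersistentGenerator D.c d)
    {ξ ζ : ExtState n m p d} : D.IsReachableRef ξ ζ ↔ ζ ∈ D.Za ∧ D.Tv ζ = D.Tv ξ := by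
  have hc := hD.c_zero
  have hcd := hD.c_last
  refine and_congr_right fun _ => ⟨?_, fun h => ?_⟩
  · rintro ⟨Δu, hlim⟩
    have h1 : Tendsto (fun t => (genStep D.c)^[t] (D.Tv ξ - D.Tv ζ)) atTop (𝓝 0) := by
      refine (tendsto_linear_zero D.TvL hlim).congr fun t => ?_
      rw [TvL_apply, Tv_sub, Tv_traj hc hcd, Tv_free hc hcd]
      simp only [genStep_iterate, map_sub]
    exact (sub_eq_zero.1 (eq_zero_of_genStep_tendsto hc hcd hp h1)).symm
  · have hv : D.Tv (ξ - ζ) = 0 := by rw [Tv_sub, h, sub_self]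
    obtain ⟨Δu, hΔ⟩ := exists_null_increments hD hv
    refine ⟨Δu, tendsto_const_nhds.congr' ?_⟩
    filter_upwards [eventually_ge_atTop (n + d)] with t ht
    have h2 := D.traj_add (ξ - ζ) ζ Δu 0 t
    rw [sub_add_cancel, add_zero, (hΔ t ht).1, zero_add, traj_zero] at h2
    rw [h2, sub_self]

end Data

/-! ### Pontryagin differences -/

section Pdiff

variable {E : Type*} [NormedAddCommGroup E] [NormedSpace ℝ E] {X Y : Set E}

theorem convex_pdiff (hX : Convex ℝ X) : Convex ℝ (pdiff X Y) := by
  intro x hx x' hx' a b ha hb hab y hy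
  have := hX (hx y hy) (hx' y hy) ha hb hab
  have h2 : a • x + b • x' + y = a • (x + y) + b • (x' + y) := by
    rw [smul_add, smul_add, add_add_add_comm, ← add_smul, hab, one_smul]
  rwa [h2]

theorem isClosed_pdiff (hX : IsClosed X) : IsClosed (pdiff X Y) := by
  have : pdiff X Y = ⋂ y ∈ Y, (fun x => x + y) ⁻¹' X := by ext x; simp [pdiff]
  rw [this]
  exact isClosed_biInter fun y _ => hX.preimage (by fun_prop)

theorem exists_bound_pdiff (hX : Bornology.IsBounded X) (hY : Y.Nonempty) :
    ∃ M, ∀ x ∈ pdiff X Y, ‖x‖ ≤ M := by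
  obtain ⟨y, hy⟩ := hY
  obtain ⟨M, hM⟩ := hX.exists_norm_le
  refine ⟨M + ‖y‖, fun x hx => ?_⟩
  calc ‖x‖ = ‖(x + y) - y‖ := by rw [add_sub_cancel_right]
    _ ≤ ‖x + y‖ + ‖y‖ := norm_sub_le _ _
    _ ≤ _ := by gcongr; exact hM _ (hx y hy)

theorem add_mem_pdiff (hX : Convex ℝ X) {σ : ℝ} (hσ : 1 < σ) {x δ : E}
    (hx : x ∈ pdiff X (σ • Y)) (hδ : (σ - 1)⁻¹ • δ ∈ Y) : x + δ ∈ pdiff X Y := by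
  intro y hy
  have h1 := hx (σ • y) (Set.smul_mem_smul_set hy)
  have h2 := hx (σ • (σ - 1)⁻¹ • δ) (Set.smul_mem_smul_set hδ)
  have hσ0 : σ ≠ 0 := by positivity
  have hσ1 : σ - 1 ≠ 0 := by linarith
  have h3 := hX h1 h2 (a := σ⁻¹) (b := 1 - σ⁻¹) (by positivity)
    (sub_nonneg.2 (inv_le_one_of_one_le₀ hσ.le)) (by ring)
  convert h3 using 1
  have e1 : (1 - σ⁻¹) * σ * (σ - 1)⁻¹ = 1 := by field_simp
  rw [smul_add, smul_add, smul_smul, inv_mul_cancel₀ hσ0, one_smul, smul_smul, smul_smul, e1, one_smul]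
  module

theorem pdiff_smul_subset (hX : Convex ℝ X) {σ : ℝ} (hσ : 1 < σ) (h0 : (0 : E) ∈ Y) :
    pdiff X (σ • Y) ⊆ pdiff X Y := fun x hx => by
  simpa using add_mem_pdiff hX hσ hx (δ := 0) (by simpa using h0)

/-- Tightening by `σ > 1` leaves uniform slack if the tightening set is a neighbourhood of zero. -/
theorem exists_slack_pdiff (hX : Convex ℝ X) {σ : ℝ} (hσ : 1 < σ) (h0 : Y ∈ 𝓝 (0 : E)) :
    ∃ r > 0, ∀ x ∈ pdiff X (σ • Y), ∀ δ, ‖δ‖ ≤ r → x + δ ∈ pdiff X Y := by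
  obtain ⟨ρ, hρ, hball⟩ := Metric.mem_nhds_iff.1 h0
  have hσ1 : 0 < σ - 1 := by linarith
  refine ⟨(σ - 1) * (ρ / 2), by positivity, fun x hx δ hδ => add_mem_pdiff hX hσ hx (hball ?_)⟩
  rw [mem_ball_zero_iff, norm_smul, norm_inv, Real.norm_eq_abs, abs_of_pos hσ1, inv_mul_lt_iff₀ hσ1]
  exact hδ.trans_lt (by gcongr; linarith)

theorem mix_mem_pdiff (hX : Convex ℝ X) {σ r s : ℝ}
    (hr : ∀ x ∈ pdiff X (σ • Y), ∀ δ, ‖δ‖ ≤ r → x + δ ∈ pdiff X Y) (hs0 : 0 < s) (hs1 : s ≤ 1)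
    {x x' δ : E} (hx : x ∈ pdiff X Y) (hx' : x' ∈ pdiff X (σ • Y)) (hδ : ‖δ‖ ≤ s * r) :
    (1 - s) • x + s • x' + δ ∈ pdiff X Y := by
  have h1 := hr x' hx' (s⁻¹ • δ) (by
    rw [norm_smul, norm_inv, Real.norm_eq_abs, abs_of_pos hs0, inv_mul_le_iff₀ hs0]; exact hδ)
  have h2 := convex_pdiff hX hx h1 (a := 1 - s) (b := s) (by linarith) hs0.le (by ring)
  rwa [smul_add, smul_inv_smul₀ hs0.ne', ← add_assoc] at h2

end Pdiff

section Core

variable {E : Type*} [NormedAddCommGroup E] [NormedSpace ℝ E]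

/-- The subspace of directions along which a convex set `C` containing zero extends to both sides
of zero. -/
def coreSpan (C : Set E) (hC : Convex ℝ C) (h0 : (0 : E) ∈ C) : Submodule ℝ E where
  carrier := {x | ∃ ε > 0, ∀ s : ℝ, |s| ≤ ε → s • x ∈ C}
  zero_mem' := ⟨1, one_pos, fun s _ => by simpa using h0⟩
  add_mem' := by
    rintro x y ⟨ε, hε, hx⟩ ⟨ε', hε', hy⟩
    refine ⟨min ε ε' / 2, by positivity, fun s hs => ?_⟩
    have h2 : |2 * s| ≤ min ε ε' := by rw [abs_mul, abs_two]; linarith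
    have h3 := hC (hx (2 * s) (h2.trans (min_le_left _ _))) (hy (2 * s) (h2.trans (min_le_right _ _)))
      (a := 1 / 2) (b := 1 / 2) (by norm_num) (by norm_num) (by norm_num)
    convert h3 using 1
    module
  smul_mem' := by
    rintro a x ⟨ε, hε, hx⟩
    refine ⟨ε / (|a| + 1), by positivity, fun s hs => ?_⟩
    rw [smul_smul]
    refine hx _ ?_
    rw [abs_mul]
    rw [le_div_iff₀ (by positivity)] at hs
    nlinarith [abs_nonneg s, abs_nonneg a]

/-- A convex set is a neighbourhood of zero once it contains a segment around zero in every
direction. -/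
theorem mem_nhds_of_coreSpan_eq_top [FiniteDimensional ℝ E] {C : Set E} {hC : Convex ℝ C}
    {h0 : (0 : E) ∈ C} (h : coreSpan C hC h0 = ⊤) : C ∈ 𝓝 (0 : E) := by
  let b := Module.finBasis ℝ E
  set k := Module.finrank ℝ E
  have h1 : ∀ i, ∃ ε > 0, ∀ s : ℝ, |s| ≤ ε → s • b i ∈ C := fun i => by
    have : b i ∈ coreSpan C hC h0 := h ▸ Submodule.mem_top
    exact this
  choose ε hε hb using h1
  have hcont : ∀ i, Tendsto (fun x : E => |(k + 1 : ℝ) * b.coord i x|) (𝓝 0) (𝓝 0) := fun i => by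
    have := ((continuous_linear (b.coord i)).const_mul ((k : ℝ) + 1)).abs.tendsto 0
    simpa using this
  have hev : ∀ᶠ x in 𝓝 (0 : E), ∀ i, |(k + 1 : ℝ) * b.coord i x| < ε i :=
    eventually_all.2 fun i => (hcont i).eventually (gt_mem_nhds (hε i))
  filter_upwards [hev] with x hx
  -- `x` is the average of `k` points on the axes and of zero
  have h2 := hC.sum_mem (t := Finset.univ) (w := fun _ : Option (Fin k) => (1 / (k + 1) : ℝ))
    (z := fun o => o.elim 0 fun i => ((k + 1 : ℝ) * b.coord i x) • b i) (fun _ _ => by positivity)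
    (by simp; field_simp) (fun o _ => by
      cases o with
      | none => exact h0
      | some i => exact hb i _ (hx i).le)
  convert h2 using 1
  rw [Fintype.sum_option]
  simp only [Option.elim, smul_zero, zero_add, smul_smul]
  conv_lhs => rw [← b.sum_repr x]
  refine Finset.sum_congr rfl fun i _ => ?_
  congr 1
  simp only [Module.Basis.coord_apply]
  field_simp

end Core

/-- A window is controlled by the next `d` heads of its evolution. -/
theorem exists_norm_le_heads {c : ℕ → ℝ} {d : ℕ} [NeZero d] (hc : c 0 = 1) (hcd : c d ≠ 0)
    (E : Type*) [NormedAddCommGroup E] [NormedSpace ℝ E] [FiniteDimensional ℝ E] :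
    ∃ K > 0, ∀ (w : Fin d → E) (M : ℝ), 0 ≤ M → (∀ t : ℕ, ‖(genStep c)^[t] w 0‖ ≤ M) → ‖w‖ ≤ K * M := by
  let f : (Fin d → E) →ₗ[ℝ] (Fin d → E) := LinearMap.pi fun k : Fin d => LinearMap.proj 0 ∘ₗ genStepL c ^ (k : ℕ)
  have hf : ∀ w k, f w k = (genStep c)^[(k : ℕ)] w 0 := fun w k => by rw [genStep_iterate]; rfl
  obtain ⟨K, hK, h⟩ := exists_norm_le_of_injective f fun w hw => by
    obtain ⟨s, hs1, hs2⟩ := exists_solution hc hcd w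
    have hd := Nat.pos_of_neZero d
    have h0 := solution_eq_zero hc hcd (s := fun t => s (t - (-((d - 1 : ℕ) : ℤ))))
      (fun t => by rw [delayFilter_shift]; exact hs1 _) (fun i => by
        have h1 := congrFun hw ⟨d - 1 - i, by omega⟩
        rw [hf, Pi.zero_apply] at h1
        have h2 := hs2 (d - 1 - i) 0
        rw [h1] at h2
        rw [← h2]
        congr 1
        have := i.2
        simp only [Fin.val_zero]
        omega)
    funext i
    have h1 := hs2 0 i
    have h2 := h0 (0 - (i : ℕ) + (-((d - 1 : ℕ) : ℤ)))
    rw [add_sub_cancel_right] at h2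
    simpa using h1.symm.trans (by simpa using h2)
  refine ⟨K, hK, fun w M hM hw => (h w).trans ?_⟩
  gcongr
  exact (pi_norm_le_iff_of_nonneg hM).2 fun k => by rw [hf]; exact hw _

namespace Data

variable {n m p d N : ℕ} [NeZero d] {D : Data n m p d N}

/-! ### The tube -/

variable (D) in
/-- The convex hull of `W = W_x × W_e`. -/
def Wc : Set (Dist n p) := convexHull ℝ D.Wx ×ˢ convexHull ℝ D.We

theorem Wc_eq : D.Wc = convexHull ℝ D.W := (convexHull_prod _ _).symm

section Tube

variable (hD : D.Standing)
include hD

theorem zero_mem_W : (0 : Dist n p) ∈ D.W := ⟨interior_subset hD.Wx_zero, interior_subset hD.We_zero⟩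

theorem zero_mem_V : (0 : DistWindow n p d) ∈ D.V := hD.V_contains 0 (fun _ => zero_mem_W hD) 0

theorem zero_mem_V1 : (0 : Dist n p) ∈ D.V1 := by
  refine ⟨0, zero_mem_V hD, ?_⟩
  simp only [← genStepL_apply, map_zero]
  simp

theorem mem_V_of_mem_Wc {v : DistWindow n p d} (hv : ∀ i, v i ∈ D.Wc) : v ∈ D.V := by
  have h1 : (Set.univ.pi fun _ : Fin d => D.W) ⊆ D.V := fun w hw => hD.V_contains w (fun i => hw i trivial) 0
  have h2 := convexHull_min h1 hD.V_convex
  rw [convexHull_pi] at h2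
  exact h2 fun i _ => by rw [← Wc_eq]; exact hv i

/-- Robust invariance of `𝕊` for disturbances in the convex hull of `W`. -/
theorem errStep_mem {s : LoopState n p d} (hs : s ∈ D.S) {δ : Dist n p} (hδ : δ ∈ D.V1 + D.Wc) :
    D.errStep s δ ∈ D.S := by
  obtain ⟨ν, hν, w, hw, rfl⟩ := hδ
  have hconv : Convex ℝ {w : Dist n p | D.errStep s (ν + w) ∈ D.S} := by
    intro w hw w' hw' a b ha hb hab
    have h1 := hD.S_convex hw hw' ha hb hab
    have h2 : D.errStep s (ν + (a • w + b • w')) = a • D.errStep s (ν + w) + b • D.errStep s (ν + w') := by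
      obtain rfl : b = 1 - a := by linarith
      refine Prod.ext ?_ ?_
      · simp only [errStep, Prod.fst_add, Prod.snd_add, Prod.smul_fst, Prod.smul_snd, mulVec_add, mulVec_smul]
        module
      · simp only [errStep, Prod.fst_add, Prod.snd_add, Prod.smul_fst, Prod.smul_snd, mulVec_add, mulVec_smul]
        module
    rw [Set.mem_ofPred_eq, h2]; exact h1
  have h1 : D.W ⊆ {w : Dist n p | D.errStep s (ν + w) ∈ D.S} :=
    fun w hw => hD.S_rpi s hs _ (Set.add_mem_add hν hw)
  rw [Wc_eq] at hw
  exact convexHull_min h1 hconv hw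

theorem errStep_mem_of_Wc {s : LoopState n p d} (hs : s ∈ D.S) {δ : Dist n p} (hδ : δ ∈ D.Wc) :
    D.errStep s δ ∈ D.S :=
  errStep_mem hD hs ⟨0, zero_mem_V1 hD, δ, hδ, zero_add _⟩

theorem Wc_mem_nhds : D.Wc ∈ 𝓝 (0 : Dist n p) := by
  refine prod_mem_nhds ?_ ?_
  · exact mem_of_superset (mem_interior_iff_mem_nhds.1 hD.Wx_zero) (subset_convexHull ℝ _)
  · exact mem_of_superset (mem_interior_iff_mem_nhds.1 hD.We_zero) (subset_convexHull ℝ _)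

/-- On `ker T_v`, the state is determined by `(Δx, e([t, t-d+1]))`, so convergence of the latter
implies convergence of the whole. -/
theorem tendsto_zero_of_dx_eWin {ι : Type*} {l : Filter ι} {ξ : ι → ExtState n m p d}
    (hv : Tendsto (fun i => D.Tv (ξ i)) l (𝓝 0)) (hx : Tendsto (fun i => (ξ i).dx) l (𝓝 0))
    (he : Tendsto (fun i => (ξ i).eWin) l (𝓝 0)) : Tendsto ξ l (𝓝 0) := by
  refine tendsto_zero_of_injective (D.TvL.prod (ExtState.dxL.prod ExtState.eWinL)) (fun ζ h => ?_) ?_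
  · exact eq_zero_of_dx_eWin hD (congrArg Prod.fst h) (congrArg (fun y => y.2.1) h)
      (congrArg (fun y => y.2.2) h)
  · exact hv.prodMk_nhds (hx.prodMk_nhds he)

theorem loop_tendsto_zero {ξ : ExtState n m p d} (hv : D.Tv ξ = 0) :
    Tendsto (fun t : ℕ => (D.loopL ^ t) ξ) atTop (𝓝 0) := by
  have hvt : ∀ t : ℕ, D.Tv ((D.loopL ^ t) ξ) = 0 := by
    intro t
    induction t with
    | zero => exact hv
    | succ t ih =>
      rw [pow_succ', Module.End.mul_apply, loopL_apply, Tv_step hD.c_zero hD.c_last, ih]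
      exact (genStepL D.c).map_zero
  have hst := hD.stabilizing ξ
  simp only [loopL_iterate] at hst
  exact tendsto_zero_of_dx_eWin hD (by simp [hvt]) hst.1 hst.2

/-- The tube contains zero: trajectories of the undisturbed error dynamics stay in it and tend
to zero. -/
theorem zero_mem_S (hS : D.S.Nonempty) : (0 : LoopState n p d) ∈ D.S := by
  obtain ⟨s, hs⟩ := hS
  set ξ := (T hD).symm (s, 0) with hξ
  have hv : D.Tv ξ = 0 := Tv_symm hD _ _
  have h2 : ∀ t : ℕ, D.Tv ((D.loopL ^ t) ξ) = 0 ∧ D.T0 ((D.loopL ^ t) ξ) ∈ D.S := by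
    intro t
    induction t with
    | zero => exact ⟨hv, by rw [pow_zero, Module.End.one_apply, hξ, T0_symm]; exact hs⟩
    | succ t ih =>
      have h3 : D.Tv ((D.loopL ^ (t + 1)) ξ) = 0 := by
        rw [pow_succ', Module.End.mul_apply, loopL_apply, Tv_step hD.c_zero hD.c_last, ih.1]
        exact (genStepL D.c).map_zero
      refine ⟨h3, ?_⟩
      have h4 := T0_predStep hD ((D.loopL ^ t) ξ) 0 0
      rw [pow_succ', Module.End.mul_apply, loopL_apply] at h3 ⊢
      rw [show D.predStep ((D.loopL ^ t) ξ) (D.dK ((D.loopL ^ t) ξ)) 0 0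
        = D.step ((D.loopL ^ t) ξ) (D.dK ((D.loopL ^ t) ξ)) from rfl, h3, ih.1] at h4
      rw [h4]
      exact errStep_mem_of_Wc hD ih.2 (mem_of_mem_nhds (Wc_mem_nhds hD))
  have h3 := tendsto_linear_zero D.T0L (loop_tendsto_zero hD hv)
  exact hD.S_compact.isClosed.mem_of_tendsto h3 (Eventually.of_forall fun t => (h2 t).2)

theorem errStep_zero_fst (s : LoopState n p d) (δ : Dist n p) (w : Fin n → ℝ) :
    D.errStep s (δ + (w, 0)) = D.errStep s δ + (w, 0) := by
  refine Prod.ext ?_ ?_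
  · simp only [errStep, Prod.fst_add, Prod.snd_add, add_zero]; abel
  · simp only [errStep, Prod.snd_add, add_zero]

theorem Sx_mem_nhds (hS : D.S.Nonempty) : D.Sx ∈ 𝓝 (0 : Fin n → ℝ) := by
  refine mem_of_superset (mem_interior_iff_mem_nhds.1 hD.Wx_zero) fun w hw => ?_
  refine ⟨D.errStep 0 (w, 0), errStep_mem_of_Wc hD (zero_mem_S hD hS)
    ⟨subset_convexHull ℝ _ hw, subset_convexHull ℝ _ (interior_subset hD.We_zero)⟩, ?_⟩
  simp [errStep]

theorem zero_mem_Su (hS : D.S.Nonempty) : (0 : Fin m → ℝ) ∈ D.Su := by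
  refine ⟨0, ⟨0, ⟨0, zero_mem_S hD hS, by simp⟩, 0, ⟨0, interior_subset hD.We_zero, by simp⟩, by simp⟩,
    0, ⟨0, zero_mem_V1 hD, by simp⟩, by simp⟩

/-- The input tightening also covers the convex hull of the disturbance set. -/
theorem add_mem_of_mem_pdiff_Su {u : Fin m → ℝ} (hu : u ∈ pdiff D.U D.Su) {s : LoopState n p d}
    (hs : s ∈ D.S) {w : Fin p → ℝ} (hw : w ∈ convexHull ℝ D.We) {v : Dist n p} (hv : v ∈ D.V1) :
    u + ((D.Kx + D.Dc * D.C) *ᵥ s.1 + D.Cc *ᵥ s.2 + D.Dc *ᵥ (v.2 + w)) ∈ D.U := by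
  have hconv : Convex ℝ {w : Fin p → ℝ |
      u + ((D.Kx + D.Dc * D.C) *ᵥ s.1 + D.Cc *ᵥ s.2 + D.Dc *ᵥ (v.2 + w)) ∈ D.U} := by
    intro w hw w' hw' a b ha hb hab
    have h1 := hD.U_convex hw hw' ha hb hab
    obtain rfl : b = 1 - a := by linarith
    rw [Set.mem_ofPred_eq]
    convert h1 using 1
    simp only [mulVec_add, mulVec_smul]
    module
  refine convexHull_min (fun w hw => ?_) hconv hw
  have := hu _ (Set.add_mem_add (Set.add_mem_add (Set.mem_image_of_mem _ hs) (Set.mem_image_of_mem _ hw))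
    (Set.mem_image_of_mem (fun v : Dist n p => D.Dc *ᵥ v.2) hv))
  rw [Set.mem_ofPred_eq]
  convert this using 1
  simp only [mulVec_add]
  abel

/-- Feedback gains with persistent modes act in every input direction: otherwise the closed loop
would not react to some persistent input. -/
theorem eq_zero_of_dK (hp : PersistentGenerator D.c d) {h : Fin m → ℝ}
    (hK : ∀ ξ : ExtState n m p d, h ⬝ᵥ D.dK ξ = 0) : h = 0 := by
  have hc := hD.c_zero
  have hcd := hD.c_last
  let f : (Fin m → ℝ) →ₗ[ℝ] ℝ := dotProductBilin ℝ ℝ h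
  set ξ : ExtState n m p d := D.step 0 h with hξ
  have hv : D.Tv ξ = 0 := by
    rw [hξ, Tv_step hc hcd, ← TvL_apply, map_zero]; exact (genStepL D.c).map_zero
  have hu : ∀ t : ℕ, (fun i => f (((D.loopL ^ t) ξ).uWin i)) = (genStep D.c)^[t] (fun i => f (ξ.uWin i)) := by
    intro t
    induction t with
    | zero => rfl
    | succ t ih =>
      rw [Function.iterate_succ_apply', ← ih, pow_succ', Module.End.mul_apply, loopL_apply, genStep,
        genNext_map]
      set ζ := (D.loopL ^ t) ξ
      have h1 : (D.step ζ (D.dK ζ)).uWin = push (genNext D.c ζ.uWin + D.dK ζ) ζ.uWin := rfl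
      have h2 : f (D.dK ζ) = 0 := hK ζ
      have h3 : f (genNext D.c ζ.uWin) = f (genNext D.c ζ.uWin + D.dK ζ) := by rw [map_add, h2, add_zero]
      rw [h1, h3, push_map]
  have h0 : Tendsto (fun t => (genStep D.c)^[t] (fun i => f (ξ.uWin i))) atTop (𝓝 0) := by
    simp only [← hu]
    rw [tendsto_pi_nhds]
    intro i
    have h1 : Tendsto (fun t : ℕ => ((D.loopL ^ t) ξ).uWin) atTop (𝓝 0) :=
      tendsto_linear_zero ExtState.uWinL (loop_tendsto_zero hD hv)
    exact tendsto_linear_zero f (tendsto_pi_nhds.1 h1 i)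
  have h1 := congrFun (eq_zero_of_genStep_tendsto hc hcd hp h0) 0
  have h2 : ξ.uWin 0 = h := by
    have h3 : ξ.uWin 0 = h + genNext D.c (0 : ExtState n m p d).uWin := step_uPrev 0 h
    rw [h3, show genNext D.c (0 : ExtState n m p d).uWin = 0 from (genNextL D.c).map_zero, add_zero]
  simp only [h2] at h1
  exact dotProduct_self_eq_zero.1 h1

/-- With persistent modes, the input tightening is a neighbourhood of zero: the disturbances can
drive the closed loop, hence `(Δx, e)`, in all directions. -/
theorem Su_mem_nhds (hS : D.S.Nonempty) (hp : PersistentGenerator D.c d) : D.Su ∈ 𝓝 (0 : Fin m → ℝ) := by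
  obtain ⟨ρ, hρ, hball⟩ := Metric.mem_nhds_iff.1 (mem_interior_iff_mem_nhds.1 hD.We_zero)
  set C : Set (ExtState n m p d) := {ξ | D.T0 ξ ∈ D.S ∧ (D.Tv ξ 0).2 ∈ Metric.ball 0 ρ} with hCdef
  have hC : Convex ℝ C := by
    intro x hx y hy a b ha hb hab
    refine ⟨?_, ?_⟩
    · rw [T0_add, T0_smul, T0_smul]; exact hD.S_convex hx.1 hy.1 ha hb hab
    · rw [Tv_add, Tv_smul, Tv_smul]; exact convex_ball _ _ hx.2 hy.2 ha hb hab
  have hC0 : (0 : ExtState n m p d) ∈ C := by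
    refine ⟨?_, ?_⟩
    · rw [← T0L_apply, map_zero]; exact zero_mem_S hD hS
    · rw [← TvL_apply, map_zero]; simpa using hρ
  have hKC : D.KL '' C ⊆ D.Su := by
    rintro _ ⟨ξ, hξ, rfl⟩
    refine ⟨_, ⟨_, ⟨D.T0 ξ, hξ.1, rfl⟩, _, ⟨(D.Tv ξ 0).2, hball hξ.2, rfl⟩, rfl⟩, _,
      ⟨0, zero_mem_V1 hD, rfl⟩, ?_⟩
    have he : ξ.e = D.C *ᵥ ξ.x + (D.Tv ξ 0).2 := by
      simp [Tv, ExtState.e, ExtState.eWin, ExtState.x, ExtState.xWin]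
    rw [KL_apply, hD.ctrl_output, he]
    simp only [T0, add_mulVec, mulVec_add, ← mulVec_mulVec, Prod.snd_zero, mulVec_zero]
    abel
  have hK0 : (0 : Fin m → ℝ) ∈ D.KL '' C := ⟨0, hC0, map_zero _⟩
  have hKconv : Convex ℝ (D.KL '' C) := hC.linear_image _
  refine mem_of_superset (mem_nhds_of_coreSpan_eq_top (hC := hKconv) (h0 := hK0) ?_) hKC
  -- the directions covered by `C` are invariant under the disturbed closed loop
  set Z := coreSpan C hC hC0 with hZ
  have hZstep : ∀ ξ ∈ Z, ∀ a b, D.predStep ξ (D.dK ξ) a b ∈ Z := by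
    rintro ξ ⟨ε, hε, hξ⟩ a b
    set ζ := D.predStep ξ (D.dK ξ) a b with hζ
    have h1 : ∀ᶠ s : ℝ in 𝓝 0, s • ((D.Tv ζ 0).1, (D.Tv ξ 0).2) ∈ D.Wc := by
      have : Tendsto (fun s : ℝ => s • ((D.Tv ζ 0).1, (D.Tv ξ 0).2)) (𝓝 0) (𝓝 0) := by
        have h2 : Continuous (fun s : ℝ => s • ((D.Tv ζ 0).1, (D.Tv ξ 0).2)) := by fun_prop
        simpa using h2.tendsto 0
      exact this (Wc_mem_nhds hD)
    have h2 : ∀ᶠ s : ℝ in 𝓝 0, s • (D.Tv ζ 0).2 ∈ Metric.ball 0 ρ := by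
      have : Tendsto (fun s : ℝ => s • (D.Tv ζ 0).2) (𝓝 0) (𝓝 0) := by
        have h2 : Continuous (fun s : ℝ => s • (D.Tv ζ 0).2) := by fun_prop
        simpa using h2.tendsto 0
      exact this (Metric.ball_mem_nhds _ hρ)
    obtain ⟨δ, hδ, h3⟩ := Metric.eventually_nhds_iff.1 (h1.and h2)
    refine ⟨min ε (δ / 2), by positivity, fun s hs => ?_⟩
    have hs1 := hξ s (hs.trans (min_le_left _ _))
    have hs2 := @h3 s (by
      rw [dist_zero_right, Real.norm_eq_abs]
      linarith [hs.trans (min_le_right ε (δ / 2))])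
    refine ⟨?_, by rw [Tv_smul]; exact hs2.2⟩
    have h4 := T0_predStep hD (s • ξ) (s • a) (s • b)
    have h5 : D.predStep (s • ξ) (D.dK (s • ξ)) (s • a) (s • b) = s • ζ := by
      rw [← dKL_apply, map_smul, predStep_smul]; rfl
    rw [h5, Tv_smul, Tv_smul] at h4
    rw [h4]
    exact errStep_mem_of_Wc hD hs1.1 hs2.1
  have hZK : ∀ ξ ∈ Z, D.K ξ ∈ coreSpan (D.KL '' C) hKconv hK0 := by
    rintro ξ ⟨ε, hε, hξ⟩
    exact ⟨ε, hε, fun s hs => ⟨s • ξ, hξ s hs, map_smul _ _ _⟩⟩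
  by_contra hne
  obtain ⟨f, hf, hker⟩ := Submodule.exists_le_ker_of_lt_top _ (lt_top_iff_ne_top.2 hne)
  have hfK : ∀ ξ ∈ Z, f (D.K ξ) = 0 := fun ξ hξ => hker (hZK ξ hξ)
  -- with `f ∘ u = 0` throughout, disturbances still realize every `(Δx, e)`-window
  have hreach : ∀ k : ℕ, ∀ (a : Fin n → ℝ) (b : ℕ → Fin p → ℝ), ∃ ξ ∈ Z, (∀ i, f (ξ.uWin i) = 0) ∧
      (0 < k → ξ.dx = a) ∧ ∀ i : Fin d, (i : ℕ) < k → ξ.eWin i = b i := by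
    intro k
    induction k with
    | zero => exact fun a b => ⟨0, Z.zero_mem, fun i => map_zero f, fun h => absurd h (lt_irrefl _),
        fun i h => absurd h (by omega)⟩
    | succ k ih =>
      intro a b
      obtain ⟨ξ, h1, h2, -, h4⟩ := ih 0 (fun i => b (i + 1))
      set ωx := a - (D.A *ᵥ ξ.dx + D.B *ᵥ D.dK ξ) with hωx
      set ωe := b 0 - (D.C *ᵥ a + genNext D.c ξ.eWin) with hωe
      have hdx : (D.predStep ξ (D.dK ξ) ωx ωe).dx = a := by
        change D.A *ᵥ ξ.dx + D.B *ᵥ D.dK ξ + ωx = a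
        rw [hωx, add_sub_cancel]
      refine ⟨D.predStep ξ (D.dK ξ) ωx ωe, hZstep ξ h1 _ _, ?_, fun _ => hdx, ?_⟩
      · rintro ⟨i, hi⟩
        cases i with
        | zero =>
          have h5 : (D.predStep ξ (D.dK ξ) ωx ωe).uWin ⟨0, hi⟩ = D.K ξ :=
            (push_zero (d := d) _ ξ.uWin).trans (add_comm _ _)
          rw [h5]; exact hfK ξ h1
        | succ i => rw [predStep_uWin_succ]; exact h2 _
      · rintro ⟨i, hi⟩ hik
        cases i with
        | zero =>
          have h5 : (D.predStep ξ (D.dK ξ) ωx ωe).eWin ⟨0, hi⟩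
              = D.C *ᵥ (D.predStep ξ (D.dK ξ) ωx ωe).dx + genNext D.c ξ.eWin + ωe :=
            push_zero (d := d) _ ξ.eWin
          rw [h5, hdx, hωe, add_sub_cancel]
        | succ i => rw [predStep_eWin_succ]; exact h4 _ (by simp only at hik ⊢; omega)
  have hdK : ∀ ξ : ExtState n m p d, f (D.dK ξ) = 0 := by
    intro ξ
    have hd := Nat.pos_of_neZero d
    obtain ⟨ζ, h1, h2, h3, h4⟩ := hreach d ξ.dx (fun i => if h : i < d then ξ.eWin ⟨i, h⟩ else 0)
    have h5 : D.dK ξ = D.dK ζ := by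
      have : ζ.eWin = ξ.eWin := by funext i; rw [h4 i i.2]; simp
      simp only [dK, h3 hd, this]
    have h6 : f (D.dK ζ) + f (genNext D.c ζ.uWin) = 0 := by
      rw [← map_add]; exact hfK ζ h1
    have h7 : f (genNext D.c ζ.uWin) = 0 := by
      rw [← genNext_map, show (fun i => f (ζ.uWin i)) = 0 from funext h2]; exact (genNextL D.c).map_zero
    rw [h5]; linarith
  have hfdot : ∀ u, f u = (fun i => f (Pi.single i 1)) ⬝ᵥ u := by
    intro u
    conv_lhs => rw [← Finset.univ_sum_single u]
    rw [map_sum, dotProduct]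
    refine Finset.sum_congr rfl fun i _ => ?_
    rw [show (Pi.single i (u i) : Fin m → ℝ) = u i • Pi.single i 1 by
      rw [← Pi.single_smul, smul_eq_mul, mul_one], map_smul, smul_eq_mul, mul_comm]
  have h0 := eq_zero_of_dK hD hp (h := fun i => f (Pi.single i 1)) fun ξ => by rw [← hfdot]; exact hdK ξ
  exact hf (LinearMap.ext fun u => by rw [hfdot, h0]; simp)

end Tube

end Data

namespace Data

variable {n m p d N : ℕ} [NeZero d] {D : Data n m p d N}

/-! ### Artificial references -/

/-- The states with `Δx = 0`, parametrized by a joint window of outputs, states and inputs. -/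
def ofWin : (Fin d → (Fin p → ℝ) × (Fin n → ℝ) × (Fin m → ℝ)) →ₗ[ℝ] ExtState n m p d where
  toFun w := (0, fun i => (w i).1, fun i => (w i).2.1, fun i => (w i).2.2)
  map_add' w w' := by refine ExtState.ext' ?_ rfl rfl rfl; simp [ExtState.dx]
  map_smul' r w := by refine ExtState.ext' ?_ rfl rfl rfl; simp [ExtState.dx]

/-- The joint window of outputs, states and inputs. -/
def toWin : ExtState n m p d →ₗ[ℝ] (Fin d → (Fin p → ℝ) × (Fin n → ℝ) × (Fin m → ℝ)) where
  toFun ξ := fun i => (ξ.eWin i, ξ.xWin i, ξ.uWin i)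
  map_add' _ _ := rfl
  map_smul' _ _ := rfl

theorem ofWin_toWin {ξ : ExtState n m p d} (h : ξ.dx = 0) : ofWin (toWin ξ) = ξ :=
  ExtState.ext' h.symm rfl rfl rfl

theorem free_ofWin (w : Fin d → (Fin p → ℝ) × (Fin n → ℝ) × (Fin m → ℝ)) (t : ℕ) :
    D.free t (ofWin w) = ofWin ((genStep D.c)^[t] w) := by
  rw [free_of_dx rfl]
  have h1 := genStep_iterate_map (c := D.c)
    (LinearMap.fst ℝ (Fin p → ℝ) ((Fin n → ℝ) × (Fin m → ℝ))) t w
  have h2 := genStep_iterate_map (c := D.c) (LinearMap.fst ℝ (Fin n → ℝ) (Fin m → ℝ) ∘ₗ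
    LinearMap.snd ℝ (Fin p → ℝ) ((Fin n → ℝ) × (Fin m → ℝ))) t w
  have h3 := genStep_iterate_map (c := D.c) (LinearMap.snd ℝ (Fin n → ℝ) (Fin m → ℝ) ∘ₗ
    LinearMap.snd ℝ (Fin p → ℝ) ((Fin n → ℝ) × (Fin m → ℝ))) t w
  exact ExtState.ext' rfl h1 h2 h3

theorem Za_dx {ζ : ExtState n m p d} (h : ζ ∈ D.Za) : ζ.dx = 0 := (h 0).2.2

theorem free_mem_Za {ζ : ExtState n m p d} (h : ζ ∈ D.Za) (t : ℕ) : D.free t ζ ∈ D.Za := fun s => by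
  rw [← free_add]; exact h (s + t)

theorem step_mem_Za {ζ : ExtState n m p d} (h : ζ ∈ D.Za) : D.step ζ 0 ∈ D.Za := free_mem_Za h 1

variable (hD : D.Standing)
include hD

theorem convex_Za : Convex ℝ D.Za := by
  intro x hx y hy a b ha hb hab t
  have h1 : D.free t (a • x + b • y) = a • D.free t x + b • D.free t y := by
    simp only [free_eq, map_add, map_smul]
  rw [h1]
  refine ⟨?_, ?_, ?_⟩
  · exact convex_pdiff hD.U_convex (hx t).1 (hy t).1 ha hb hab
  · exact convex_pdiff hD.X_convex (hx t).2.1 (hy t).2.1 ha hb hab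
  · rw [← ExtState.dxL_apply, map_add, map_smul, map_smul, ExtState.dxL_apply, ExtState.dxL_apply,
      (hx t).2.2, (hy t).2.2]; simp

theorem isClosed_Za : IsClosed D.Za := by
  have h1 : D.Za = ⋂ t : ℕ, ((fun ξ => ExtState.uPrevL ((D.stepL ^ t) ξ)) ⁻¹' pdiff D.U (D.σ • D.Su) ∩
      ((fun ξ => ExtState.xL ((D.stepL ^ t) ξ)) ⁻¹' pdiff D.X (D.σ • D.Sx) ∩
      (fun ξ => ExtState.dxL ((D.stepL ^ t) ξ)) ⁻¹' {0})) := by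
    ext ξ
    simp only [Za, free_eq, Set.mem_iInter, Set.mem_inter_iff, Set.mem_preimage,
      Set.mem_singleton_iff]
    rfl
  rw [h1]
  refine isClosed_iInter fun t => IsClosed.inter ?_ (IsClosed.inter ?_ ?_)
  · exact (isClosed_pdiff hD.U_compact.isClosed).preimage
      (continuous_linear (ExtState.uPrevL ∘ₗ D.stepL ^ t))
  · exact (isClosed_pdiff hD.X_compact.isClosed).preimage
      (continuous_linear (ExtState.xL ∘ₗ D.stepL ^ t))
  · exact isClosed_singleton.preimage (continuous_linear (ExtState.dxL ∘ₗ D.stepL ^ t))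

/-- On admissible references, the state and input windows are bounded by compactness of the
constraints, hence the output window is bounded in terms of the disturbance state. -/
theorem exists_norm_sub_le_of_Za (hS : D.S.Nonempty) :
    ∃ K > 0, ∀ ζ ∈ D.Za, ∀ ζ' ∈ D.Za, ‖ζ - ζ'‖ ≤ K * (1 + ‖D.Tv ζ - D.Tv ζ'‖) := by
  have hc := hD.c_zero
  have hcd := hD.c_last
  obtain ⟨Mx, hMx⟩ := exists_bound_pdiff (Y := D.σ • D.Sx) hD.X_compact.isBounded ((hS.image _).smul_set)
  obtain ⟨Mu, hMu⟩ := exists_bound_pdiff (Y := D.σ • D.Su) hD.U_compact.isBounded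
    (Set.Nonempty.smul_set ⟨0, zero_mem_Su hD hS⟩)
  obtain ⟨Kx, hKx, hx⟩ := exists_norm_le_heads hc hcd (Fin n → ℝ)
  obtain ⟨Ku, hKu, hu⟩ := exists_norm_le_heads hc hcd (Fin m → ℝ)
  have hwin : ∀ ζ ∈ D.Za, ‖ζ.xWin‖ ≤ Kx * |Mx| ∧ ‖ζ.uWin‖ ≤ Ku * |Mu| := by
    intro ζ hζ
    have h1 := fun t => hζ t
    simp only [free_of_dx (Za_dx hζ)] at h1
    exact ⟨hx _ _ (abs_nonneg _) fun t => (hMx _ (h1 t).2.1).trans (le_abs_self _),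
      hu _ _ (abs_nonneg _) fun t => (hMu _ (h1 t).1).trans (le_abs_self _)⟩
  obtain ⟨K, hK, h⟩ := exists_norm_le_of_injective
    (ExtState.dxL.prod (ExtState.xWinL.prod (ExtState.uWinL.prod D.TvL))) (fun ζ h => by
      have h1 : ζ.dx = 0 := congrArg Prod.fst h
      have h2 : ζ.xWin = 0 := congrArg (fun y => y.2.1) h
      have h3 : ζ.uWin = 0 := congrArg (fun y => y.2.2.1) h
      have h4 : D.Tv ζ = 0 := congrArg (fun y => y.2.2.2) h
      refine ExtState.ext' h1 ?_ h2 h3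
      funext i
      have h5 : ζ.eWin i - D.C *ᵥ ζ.xWin i = 0 := congrArg Prod.snd (congrFun h4 i)
      rw [h2, Pi.zero_apply, mulVec_zero, sub_zero] at h5
      exact h5)
  refine ⟨K * (2 * (Kx * |Mx|) + 2 * (Ku * |Mu|) + 1), by positivity, fun ζ hζ ζ' hζ' => (h _).trans ?_⟩
  rw [mul_assoc]
  refine mul_le_mul_of_nonneg_left ?_ hK.le
  have h0 : 0 ≤ ‖D.Tv ζ - D.Tv ζ'‖ := norm_nonneg _
  have hb : 0 ≤ 2 * (Kx * |Mx|) + 2 * (Ku * |Mu|) := by positivity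
  have hpx : 0 ≤ Kx * |Mx| := by positivity
  have hpu : 0 ≤ Ku * |Mu| := by positivity
  have e1 : ‖(ζ - ζ').dx‖ = 0 := by
    have : (ζ - ζ').dx = ζ.dx - ζ'.dx := rfl
    rw [this, Za_dx hζ, Za_dx hζ', sub_self, norm_zero]
  have e2 : ‖(ζ - ζ').xWin‖ ≤ 2 * (Kx * |Mx|) :=
    (norm_sub_le ζ.xWin ζ'.xWin).trans (by linarith [(hwin ζ hζ).1, (hwin ζ' hζ').1])
  have e3 : ‖(ζ - ζ').uWin‖ ≤ 2 * (Ku * |Mu|) :=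
    (norm_sub_le ζ.uWin ζ'.uWin).trans (by linarith [(hwin ζ hζ).2, (hwin ζ' hζ').2])
  have e4 : ‖D.Tv (ζ - ζ')‖ = ‖D.Tv ζ - D.Tv ζ'‖ := by rw [Tv_sub]
  have hprod : 0 ≤ (2 * (Kx * |Mx|) + 2 * (Ku * |Mu|)) * ‖D.Tv ζ - D.Tv ζ'‖ := mul_nonneg hb h0
  refine norm_prod_le_iff.2 ⟨?_, norm_prod_le_iff.2 ⟨?_, norm_prod_le_iff.2 ⟨?_, ?_⟩⟩⟩
  · refine e1.le.trans ?_; positivity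
  · refine e2.trans ?_; nlinarith
  · refine e3.trans ?_; nlinarith
  · refine e4.le.trans ?_; nlinarith

/-- The admissible references with a bounded disturbance state form a compact set. -/
theorem isCompact_Za_inter (hS : D.S.Nonempty) {B : Set (DistWindow n p d)} (hB : IsCompact B) :
    IsCompact (D.Za ∩ D.TvL ⁻¹' B) := by
  rcases (D.Za ∩ D.TvL ⁻¹' B).eq_empty_or_nonempty with h | ⟨ζ₀, h0, hB0⟩
  · rw [h]; exact isCompact_empty
  obtain ⟨K, hK, h⟩ := exists_norm_sub_le_of_Za hD hS
  obtain ⟨M, hM⟩ := hB.isBounded.exists_norm_le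
  refine Metric.isCompact_of_isClosed_isBounded
    ((isClosed_Za hD).inter (hB.isClosed.preimage (continuous_linear D.TvL))) ?_
  refine (Metric.isBounded_closedBall (x := ζ₀) (r := K * (1 + (M + M)))).subset ?_
  rintro ζ ⟨h1, h2⟩
  rw [Metric.mem_closedBall, dist_eq_norm]
  refine (h ζ h1 ζ₀ h0).trans ?_
  gcongr
  exact (norm_sub_le _ _).trans (add_le_add (hM _ h2) (hM _ hB0))

/-- Without decaying modes, admissible references extend backwards in time, by recurrence. -/
theorem exists_step_eq_of_Za (hp : PersistentGenerator D.c d) {ζ : ExtState n m p d} (hζ : ζ ∈ D.Za) :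
    ∃ ζ' ∈ D.Za, D.step ζ' 0 = ζ := by
  have hc := hD.c_zero
  have hcd := hD.c_last
  set E := (Fin p → ℝ) × (Fin n → ℝ) × (Fin m → ℝ)
  have hinj : ∀ w : Fin d → E, genStepL D.c w = 0 → w = 0 := fun w hw => genStep_injective hcd hw
  obtain ⟨w', hw'⟩ := (LinearMap.injective_iff_surjective (f := genStepL (E := E) (d := d) D.c)).1
    ((injective_iff_map_eq_zero _).2 hinj) (toWin ζ)
  have hζw : ofWin (toWin ζ) = ζ := ofWin_toWin (Za_dx hζ)
  refine ⟨ofWin w', ?_, ?_⟩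
  · obtain ⟨K, hK, hK'⟩ := exists_norm_le_of_injective (genStepL (E := E) (d := d) D.c) hinj
    obtain ⟨K₂, hK₂, hK₂'⟩ := exists_norm_map_le (ofWin (n := n) (m := m) (p := p) (d := d))
    rw [← (isClosed_Za hD).closure_eq, Metric.mem_closure_iff]
    intro ε hε
    obtain ⟨t, ht⟩ := genStep_recurrent hc hcd hD.stable hp (toWin ζ) (ε := ε / (K₂ * K)) (by positivity)
    refine ⟨D.free t ζ, free_mem_Za hζ t, ?_⟩
    conv_lhs => rw [← hζw]
    rw [free_ofWin, dist_comm, dist_eq_norm, ← map_sub]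
    have h1 : genStepL D.c ((genStep D.c)^[t] (toWin ζ) - w') = (genStep D.c)^[t + 1] (toWin ζ) - toWin ζ := by
      rw [map_sub, hw', Function.iterate_succ_apply']; rfl
    calc _ ≤ K₂ * ‖(genStep D.c)^[t] (toWin ζ) - w'‖ := hK₂' _
      _ ≤ K₂ * (K * ‖(genStep D.c)^[t + 1] (toWin ζ) - toWin ζ‖) := by
          gcongr; rw [← h1]; exact hK' _
      _ < K₂ * (K * (ε / (K₂ * K))) := by gcongr
      _ = ε := by field_simp
  · have h1 := free_ofWin (D := D) w' 1
    rw [show (genStep D.c)^[1] w' = toWin ζ from hw', hζw] at h1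
    exact h1

theorem exists_free_eq_of_Za (hp : PersistentGenerator D.c d) {ζ : ExtState n m p d} (hζ : ζ ∈ D.Za)
    (t : ℕ) : ∃ ζ' ∈ D.Za, D.free t ζ' = ζ := by
  induction t generalizing ζ with
  | zero => exact ⟨ζ, hζ, rfl⟩
  | succ t ih =>
    obtain ⟨ζ₁, h1, h2⟩ := exists_step_eq_of_Za hD hp hζ
    obtain ⟨ζ₂, h3, h4⟩ := ih h1
    exact ⟨ζ₂, h3, by rw [free_succ, h4, h2]⟩

theorem exists_norm_free_le : ∃ K > 0, ∀ (t : ℕ) (ζ : ExtState n m p d), ζ.dx = 0 →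
    ‖D.free t ζ‖ ≤ K * ‖ζ‖ := by
  obtain ⟨K₁, hK₁, h1⟩ := genStep_iterate_bounded (E := (Fin p → ℝ) × (Fin n → ℝ) × (Fin m → ℝ))
    hD.c_zero hD.c_last hD.stable
  obtain ⟨K₂, hK₂, h2⟩ := exists_norm_map_le (ofWin (n := n) (m := m) (p := p) (d := d))
  obtain ⟨K₃, hK₃, h3⟩ := exists_norm_map_le (toWin (n := n) (m := m) (p := p) (d := d))
  refine ⟨K₂ * (K₁ * K₃), by positivity, fun t ζ hζ => ?_⟩
  conv_lhs => rw [← ofWin_toWin hζ, free_ofWin]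
  calc _ ≤ K₂ * ‖(genStep D.c)^[t] (toWin ζ)‖ := h2 _
    _ ≤ K₂ * (K₁ * (K₃ * ‖ζ‖)) := by gcongr; exact (h1 _ _).trans (by gcongr; exact h3 _)
    _ = _ := by ring

/-! ### The output cost -/

theorem isPSDQuad_Vcost : IsPSDQuad D.Vcost := by
  have := (isPSDQuad_quad hD.P_pd.posSemidef).comp
    ({ toFun := fun e i => e i.1 i.2, map_add' := fun _ _ => rfl, map_smul' := fun _ _ => rfl } :
      (Fin d → Fin p → ℝ) →ₗ[ℝ] (Fin d × Fin p → ℝ))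
  exact this

theorem eq_zero_of_Vcost {e : Fin d → Fin p → ℝ} (h : D.Vcost e = 0) : e = 0 := by
  have h1 := eq_zero_of_quad hD.P_pd h
  funext i j
  exact congrFun h1 (i, j)

theorem isPSDQuad_Vcost_eWin : IsPSDQuad (fun ξ : ExtState n m p d => D.Vcost ξ.eWin) :=
  (isPSDQuad_Vcost hD).comp ExtState.eWinL

theorem Vcost_step_le {ζ : ExtState n m p d} (hζ : ζ ∈ D.Za) :
    D.Vcost (D.step ζ 0).eWin ≤ D.Vcost ζ.eWin := by
  have h1 := free_of_dx (D := D) (Za_dx hζ) 1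
  have h2 : D.step ζ 0 = D.free 1 ζ := rfl
  rw [h2, h1]
  exact hD.P_decrease _

/-- Two admissible references with the same disturbance state coincide if their outputs do. -/
theorem eq_of_eWin {ζ ζ' : ExtState n m p d} (h : ζ ∈ D.Za) (h' : ζ' ∈ D.Za) (hv : D.Tv ζ = D.Tv ζ')
    (he : D.Vcost (ζ - ζ').eWin = 0) : ζ = ζ' := by
  refine sub_eq_zero.1 (eq_zero_of_dx_eWin hD (by rw [Tv_sub, hv, sub_self]) ?_ (eq_zero_of_Vcost hD he))
  have : (ζ - ζ').dx = ζ.dx - ζ'.dx := rfl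
  rw [this, Za_dx h, Za_dx h', sub_self]

/-- Quadratic growth of the output cost at an optimal reference. -/
theorem Vcost_growth {v : DistWindow n p d} {ζ ζ' : ExtState n m p d} (h : ζ ∈ D.Za ∧ D.Tv ζ = v)
    (hmin : ∀ η ∈ D.Za, D.Tv η = v → D.Vcost ζ.eWin ≤ D.Vcost η.eWin) (h' : ζ' ∈ D.Za ∧ D.Tv ζ' = v) :
    D.Vcost (ζ' - ζ).eWin ≤ 2 * (D.Vcost ζ'.eWin - D.Vcost ζ.eWin) := by
  refine (isPSDQuad_Vcost_eWin hD).growth (hmin _ ?_ ?_)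
  · exact convex_Za hD h.1 h'.1 (by norm_num) (by norm_num) (by norm_num)
  · rw [Tv_add, Tv_smul, Tv_smul, h.2, h'.2]; module

theorem exists_opt_ref (hS : D.S.Nonempty) {v : DistWindow n p d} (h : ∃ ζ ∈ D.Za, D.Tv ζ = v) :
    ∃ ζ, (ζ ∈ D.Za ∧ D.Tv ζ = v) ∧ ∀ η ∈ D.Za, D.Tv η = v → D.Vcost ζ.eWin ≤ D.Vcost η.eWin := by
  obtain ⟨ζ₀, h0, h0'⟩ := h
  obtain ⟨ζ, hζ, hmin⟩ := (isCompact_Za_inter hD hS (isCompact_singleton (x := v))).exists_isMinOn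
    ⟨ζ₀, h0, h0'⟩ (isPSDQuad_Vcost_eWin hD).continuous.continuousOn
  exact ⟨ζ, hζ, fun η h1 h2 => hmin ⟨h1, h2⟩⟩

theorem exists_unique_isOptRef (hS : D.S.Nonempty) (hp : PersistentGenerator D.c d)
    {ξ : ExtState n m p d} (h : ∃ ζ ∈ D.Za, D.Tv ζ = D.Tv ξ) :
    ∃ ζ, D.IsOptRef ξ ζ ∧ ∀ η, D.IsOptRef ξ η → η = ζ := by
  obtain ⟨ζ, hζ, hmin⟩ := exists_opt_ref hD hS h
  refine ⟨ζ, ⟨(isReachableRef_iff hD hp).2 hζ, fun η hη => ?_⟩, fun η hη => ?_⟩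
  · have := (isReachableRef_iff hD hp).1 hη
    exact hmin _ this.1 this.2
  · have h1 := (isReachableRef_iff hD hp).1 hη.1
    have h2 := hη.2 ζ ((isReachableRef_iff hD hp).2 hζ)
    refine eq_of_eWin hD h1.1 hζ.1 (h1.2.trans hζ.2.symm)
      (le_antisymm ?_ ((isPSDQuad_Vcost_eWin hD).nonneg (η - ζ)))
    linarith [Vcost_growth hD hζ hmin h1]

end Data

/-! ### The MPC problem as a convex quadratic program -/

/-- The decision variables of the MPC problem as a vector `((ξ_0, Δu), ξ_{a,0}, τ)`. -/
abbrev DecVec (n m p d N : ℕ) : Type :=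
  (ExtState n m p d × (Fin N → Fin m → ℝ)) × ExtState n m p d × ℝ

namespace DecVec

variable {n m p d N : ℕ}

/-- The decision with coordinate vector `y`. -/
def dec (y : DecVec n m p d N) : Decision n m p d N := ⟨y.1.2, y.1.1, y.2.1, y.2.2⟩

/-- The coordinate vector of a decision. -/
def ofDec (z : Decision n m p d N) : DecVec n m p d N := ((z.ξ0, z.du), z.ξa0, z.τ)

/-- The deviation `(ξ_0 - ξ_{a,0}, Δu)` of the prediction from the artificial reference. -/
def devL : DecVec n m p d N →ₗ[ℝ] ExtState n m p d × (Fin N → Fin m → ℝ) where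
  toFun y := (y.1.1 - y.2.1, y.1.2)
  map_add' _ _ := Prod.ext (add_sub_add_comm _ _ _ _) rfl
  map_smul' r _ := Prod.ext (smul_sub r _ _).symm rfl

theorem devL_apply (y : DecVec n m p d N) : devL y = (y.1.1 - y.2.1, y.1.2) := rfl

end DecVec

namespace Data

variable {n m p d N : ℕ} [NeZero d] {D : Data n m p d N}

open DecVec

theorem pred_dec (y : DecVec n m p d N) (k : ℕ) : D.pred y.dec k = D.trajL k y.1 := rfl

theorem predInput_dec (y : DecVec n m p d N) (k : ℕ) : D.predInput y.dec k = D.inputL k y.1 := rfl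

theorem trajL_free (ζ : ExtState n m p d) (k : ℕ) :
    D.trajL k (ζ, (0 : Fin N → Fin m → ℝ)) = D.free k ζ := by
  rw [trajL_apply, ← traj_zero]
  have : pad (0 : Fin N → Fin m → ℝ) = 0 := by funext k; simp [pad]
  rw [this]

theorem trajL_devL (y : DecVec n m p d N) (k : ℕ) :
    D.trajL k (devL y) = D.trajL k y.1 - D.free k y.2.1 := by
  have : devL y = y.1 - (y.2.1, 0) := Prod.ext rfl (sub_zero _).symm
  rw [this, map_sub, trajL_free]

theorem inputL_free (ζ : ExtState n m p d) (k : ℕ) :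
    D.inputL k (ζ, (0 : Fin N → Fin m → ℝ)) = (D.free (k + 1) ζ).uPrev := by
  have h := trajL_free (D := D) (N := N) ζ k
  rw [trajL_apply] at h
  have h2 : (D.step (D.free k ζ) 0).uPrev = push (genNext D.c (D.free k ζ).uWin + 0) (D.free k ζ).uWin 0 := rfl
  rw [inputL_apply, h, free_succ, h2, push_zero (d := d)]
  simp [pad]

variable (D) in
/-- The stage cost `l(ξ_k - ξ_{a,k}, Δu_k)` as a function of the deviation. -/
def devCost (k : ℕ) (w : ExtState n m p d × (Fin N → Fin m → ℝ)) : ℝ :=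
  D.stageCost (D.trajL k w) (pad w.2 k)

theorem cost_dec (y : DecVec n m p d N) : D.cost y.dec =
    (∑ k ∈ Finset.range N, D.devCost k (devL y)) + D.lam * y.2.2 ^ 2 + D.Vcost y.2.1.eWin := by
  rw [cost, Finset.sum_range]
  congr 2
  refine Finset.sum_congr rfl fun k _ => ?_
  rw [devCost, trajL_devL, pred_dec]
  congr 1
  simp [pad, devL_apply, dec]

section

variable (hD : D.Standing)
include hD

theorem isPSDQuad_devCost (k : ℕ) :
    IsPSDQuad (D.devCost k) := by
  have h1 := (isPSDQuad_quad hD.Qdx_psd).comp (ExtState.dxL ∘ₗ D.trajL k)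
  have h2 := (isPSDQuad_quad hD.Qe_pd.posSemidef).comp (ExtState.eL ∘ₗ D.trajL k)
  let f : (ExtState n m p d × (Fin N → Fin m → ℝ)) →ₗ[ℝ] (Fin m → ℝ) :=
    { toFun := fun w => pad w.2 k
      map_add' := fun w w' => by rw [Prod.snd_add, pad_add]; rfl
      map_smul' := fun r w => by rw [Prod.smul_snd, pad_smul]; rfl }
  have h3 := (isPSDQuad_quad hD.R_pd.posSemidef).comp f
  exact (h1.add h2).add h3

theorem isPSDQuad_cost : IsPSDQuad (fun y : DecVec n m p d N => D.cost y.dec) := by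
  have h1 := IsPSDQuad.sum (Finset.range N) fun k => (isPSDQuad_devCost hD k).comp devL
  have hsq : IsPSDQuad (fun x : ℝ => x ^ 2) :=
    ⟨⟨LinearMap.mul ℝ ℝ, fun x => by simp [sq]⟩, fun x => sq_nonneg x, by fun_prop⟩
  have h2 := (hsq.comp (LinearMap.snd ℝ (ExtState n m p d) ℝ ∘ₗ
    LinearMap.snd ℝ (ExtState n m p d × (Fin N → Fin m → ℝ)) _)).const_mul hD.lam_nonneg
  have h3 := (isPSDQuad_Vcost_eWin hD).comp (LinearMap.fst ℝ (ExtState n m p d) ℝ ∘ₗ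
    LinearMap.snd ℝ (ExtState n m p d × (Fin N → Fin m → ℝ)) _)
  have := (h1.add h2).add h3
  refine cast (congrArg IsPSDQuad (funext fun y => ?_)) this
  exact (cost_dec y).symm

theorem sum_devCost_le_cost (y : DecVec n m p d N) :
    (∑ k ∈ Finset.range N, D.devCost k (devL y)) ≤ D.cost y.dec := by
  rw [cost_dec]
  have h1 := mul_nonneg hD.lam_nonneg (sq_nonneg y.2.2)
  have h2 := (isPSDQuad_Vcost hD).nonneg y.2.1.eWin
  linarith

theorem sum_devCost_nonneg (w : ExtState n m p d × (Fin N → Fin m → ℝ)) (s : Finset ℕ) :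
    0 ≤ ∑ k ∈ s, D.devCost k w := Finset.sum_nonneg fun k _ => (isPSDQuad_devCost hD k).nonneg w

theorem devCost_le_sum (w : ExtState n m p d × (Fin N → Fin m → ℝ)) {k : ℕ} (hk : k < N) :
    D.devCost k w ≤ ∑ k ∈ Finset.range N, D.devCost k w :=
  Finset.single_le_sum (f := fun k => D.devCost k w)
    (fun k _ => (isPSDQuad_devCost hD k).nonneg w) (Finset.mem_range.2 hk)

theorem convex_feasible (ξ : ExtState n m p d) (vbar : DistWindow n p d) :
    Convex ℝ {y : DecVec n m p d N | D.IsFeasible ξ vbar y.dec} := by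
  intro y hy z hz a b ha hb hab
  have hx : ∀ k ≤ N, (D.trajL k (a • y + b • z).1).x ∈ pdiff D.X D.Sx := fun k hk => by
    rw [Prod.fst_add, Prod.smul_fst, Prod.smul_fst, map_add, map_smul, map_smul]
    exact convex_pdiff hD.X_convex (hy.state_mem k hk) (hz.state_mem k hk) ha hb hab
  have hu : ∀ k ≤ N, D.inputL k (a • y + b • z).1 ∈ pdiff D.U D.Su := fun k hk => by
    rw [Prod.fst_add, Prod.smul_fst, Prod.smul_fst, map_add, map_smul, map_smul]
    exact convex_pdiff hD.U_convex (hy.input_mem k hk) (hz.input_mem k hk) ha hb hab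
  refine ⟨hx, hu, convex_Icc (0 : ℝ) 1 hy.tau_mem hz.tau_mem ha hb hab, ?_, ?_, ?_,
    convex_Za hD hy.art_mem hz.art_mem ha hb hab⟩
  · have h1 := hy.init_dist
    have h2 := hz.init_dist
    obtain rfl : a = 1 - b := by linarith
    have : D.Tv ((1 - b) • y.dec.ξ0 + b • z.dec.ξ0) = ((1 - b) * y.dec.τ + b * z.dec.τ) • vbar +
        (1 - ((1 - b) * y.dec.τ + b * z.dec.τ)) • D.Tv ξ := by
      rw [Tv_add, Tv_smul, Tv_smul, h1, h2]; module
    exact this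
  · have h := hD.S_convex hy.init_loop hz.init_loop ha hb hab
    rw [← T0_smul, ← T0_smul, ← T0_add] at h
    have h3 : a • (ξ - y.dec.ξ0) + b • (ξ - z.dec.ξ0) = ξ - (a • y + b • z).dec.ξ0 := by
      have : ξ = (a + b) • ξ := by rw [hab, one_smul]
      have h4 : (a • y + b • z).dec.ξ0 = a • y.dec.ξ0 + b • z.dec.ξ0 := rfl
      rw [h4]; nth_rw 3 [this]; module
    rwa [h3] at h
  · have h1 := hy.terminal
    have h2 := hz.terminal
    have : D.trajL N (a • y.1 + b • z.1) = D.free N (a • y.2.1 + b • z.2.1) := by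
      simp only [free_eq, map_add, map_smul]
      rw [← free_eq, ← free_eq]
      exact congrArg₂ (fun u v => a • u + b • v) h1 h2
    exact this

/-- Quadratic growth of the cost at an optimizer. -/
theorem IsOptimal.growth {ξ : ExtState n m p d} {vbar : DistWindow n p d} {y z : DecVec n m p d N}
    (hy : D.IsOptimal ξ vbar y.dec) (hz : D.IsFeasible ξ vbar z.dec) :
    (∑ k ∈ Finset.range N, D.devCost k (devL z - devL y)) + D.Vcost (z.2.1 - y.2.1).eWin ≤
      2 * (D.cost z.dec - D.cost y.dec) := by
  have h := (isPSDQuad_cost hD).growth (x := y) (y := z) (hy.2 _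
    (convex_feasible hD ξ vbar hy.1 hz (by norm_num) (by norm_num) (by norm_num)))
  rw [← map_sub]
  refine le_trans ?_ h
  rw [cost_dec]
  have h1 := mul_nonneg hD.lam_nonneg (sq_nonneg (z - y).2.2)
  have h2 : (z - y).2.1 = z.2.1 - y.2.1 := rfl
  rw [h2]
  linarith

/-- Along feasible decisions, the prediction and the reference share the disturbance state. -/
theorem IsFeasible.Tv_eq {ξ : ExtState n m p d} {vbar : DistWindow n p d} {y : DecVec n m p d N}
    (hy : D.IsFeasible ξ vbar y.dec) : D.Tv y.1.1 = D.Tv y.2.1 := by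
  have h := congrArg D.Tv hy.terminal
  rw [pred_dec, trajL_apply, Tv_traj hD.c_zero hD.c_last, art, Tv_free hD.c_zero hD.c_last] at h
  refine sub_eq_zero.1 (genStep_iterate_injective (t := N) hD.c_last ?_)
  rw [genStep_iterate] at h ⊢
  rw [genStep_iterate] at h
  rw [map_sub]; exact sub_eq_zero.2 h

theorem IsFeasible.trajL_devL_eq_zero {ξ : ExtState n m p d} {vbar : DistWindow n p d}
    {y : DecVec n m p d N} (hy : D.IsFeasible ξ vbar y.dec) : D.trajL N (devL y) = 0 := by
  rw [trajL_devL]; exact sub_eq_zero.2 hy.terminal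

/-- The states and inputs of the prediction determine the increments. -/
theorem exists_norm_increments_le :
    ∃ K > 0, ∀ (y : ExtState n m p d × (Fin N → Fin m → ℝ)) (M : ℝ), 0 ≤ M → ‖y.1‖ ≤ M →
      (∀ k < N, ‖D.inputL k y‖ ≤ M) → ‖y‖ ≤ K * M := by
  let f : (ExtState n m p d × (Fin N → Fin m → ℝ)) →ₗ[ℝ] ExtState n m p d × (Fin N → Fin m → ℝ) :=
    (LinearMap.fst ℝ _ _).prod (LinearMap.pi fun k : Fin N => D.inputL k)
  have hf : ∀ y, f y = (y.1, fun k : Fin N => D.inputL k y) := fun y => rfl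
  obtain ⟨K, hK, h⟩ := exists_norm_le_of_injective f (by
    rintro ⟨ξ, du⟩ hy
    rw [hf] at hy
    obtain rfl : ξ = 0 := congrArg Prod.fst hy
    have hu : ∀ k : Fin N, D.inputL k (0, du) = 0 := fun k => congrFun (congrArg Prod.snd hy) k
    have huw : ∀ k, k ≤ N → (D.traj (0 : ExtState n m p d) (pad du) k).uWin = 0 := by
      intro k
      induction k with
      | zero => intro _; rfl
      | succ k ih =>
        intro hk
        have h1 := hu ⟨k, by omega⟩
        rw [inputL_apply] at h1
        have h2 : (D.traj (0 : ExtState n m p d) (pad du) (k + 1)).uWin =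
          push (genNext D.c (D.traj (0 : ExtState n m p d) (pad du) k).uWin + pad du k)
            (D.traj (0 : ExtState n m p d) (pad du) k).uWin := rfl
        rw [h2, add_comm, h1, ih (by omega)]
        funext i; simp [push]
    refine Prod.ext rfl (funext fun k => ?_)
    have h1 := hu k
    rw [inputL_apply, huw k (by omega), ← genNextL_apply, map_zero, add_zero] at h1
    simpa [pad] using h1)
  refine ⟨K, hK, fun y M hM h1 h2 => (h y).trans ?_⟩
  gcongr
  rw [hf]
  exact norm_prod_le_iff.2 ⟨h1, (pi_norm_le_iff_of_nonneg hM).2 fun k => h2 k k.2⟩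

/-- Uniform boundedness of the feasible decisions. -/
theorem exists_norm_feasible_le (hS : D.S.Nonempty) (M : ℝ) :
    ∃ B, ∀ (ξ : ExtState n m p d) (vbar : DistWindow n p d) (y : DecVec n m p d N), ‖ξ‖ ≤ M →
      ‖vbar‖ ≤ M → D.IsFeasible ξ vbar y.dec → ‖y‖ ≤ B := by
  obtain ⟨MS, hMS⟩ := hD.S_compact.isBounded.exists_norm_le
  obtain ⟨Mu, hMu⟩ := exists_bound_pdiff (Y := D.Su) hD.U_compact.isBounded ⟨0, zero_mem_Su hD hS⟩
  obtain ⟨K₁, hK₁, h1⟩ := exists_norm_map_le (T hD).symm.toLinearMap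
  obtain ⟨K₂, hK₂, h2⟩ := exists_norm_map_le D.T0L
  obtain ⟨K₃, hK₃, h3⟩ := exists_norm_map_le D.TvL
  obtain ⟨K₄, hK₄, h4⟩ := exists_norm_increments_le hD
  obtain ⟨K₅, hK₅, h5⟩ := exists_norm_sub_le_of_Za hD hS
  by_cases hZ : D.Za.Nonempty
  swap
  · exact ⟨0, fun ξ vbar y _ _ hy => absurd ⟨_, hy.art_mem⟩ hZ⟩
  obtain ⟨ζ₀, hζ₀⟩ := hZ
  set M' := M + K₃ * M
  set B₀ := K₁ * (K₂ * M + MS + M')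
  set B₂ := ‖ζ₀‖ + K₅ * (1 + (M' + ‖D.Tv ζ₀‖))
  refine ⟨max (K₄ * max (max B₀ Mu) 0) (max B₂ 1), fun ξ vbar y hξ hv hy => ?_⟩
  have hTvξ : ‖D.Tv ξ‖ ≤ K₃ * M := (h3 ξ).trans (by gcongr)
  have hM0 : 0 ≤ M := (norm_nonneg _).trans hξ
  have hτ := hy.tau_mem
  have hTv : ‖D.Tv y.1.1‖ ≤ M' := by
    have h := hy.init_dist
    have h' : D.Tv y.1.1 = y.dec.τ • vbar + (1 - y.dec.τ) • D.Tv ξ := h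
    rw [h']
    refine (norm_add_le _ _).trans (add_le_add ?_ ?_)
    · rw [norm_smul, Real.norm_eq_abs, abs_of_nonneg hτ.1]
      exact (mul_le_of_le_one_left (norm_nonneg _) hτ.2).trans hv
    · rw [norm_smul, Real.norm_eq_abs, abs_of_nonneg (by linarith [hτ.2])]
      exact (mul_le_of_le_one_left (norm_nonneg _) (by linarith [hτ.1])).trans hTvξ
  have hT0 : ‖D.T0 y.1.1‖ ≤ K₂ * M + MS := by
    have h : D.T0 y.1.1 = D.T0 ξ - D.T0 (ξ - y.dec.ξ0) := by rw [T0_sub]; exact (sub_sub_cancel _ _).symm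
    rw [h]
    refine (norm_sub_le _ _).trans (add_le_add ((h2 ξ).trans (by gcongr)) (hMS _ hy.init_loop))
  have hM'0 : 0 ≤ M' := (norm_nonneg _).trans hTv
  have hξ0 : ‖y.1.1‖ ≤ B₀ := by
    have h : y.1.1 = (T hD).symm (D.T0 y.1.1, D.Tv y.1.1) := by
      rw [← T_apply hD, LinearEquiv.symm_apply_apply]
    rw [h]
    refine (h1 _).trans ?_
    refine mul_le_mul_of_nonneg_left ?_ hK₁.le
    refine norm_prod_le_iff.2 ⟨?_, ?_⟩ <;> dsimp only
    · linarith
    · linarith [(norm_nonneg _).trans hT0]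
  refine norm_prod_le_iff.2 ⟨le_max_of_le_left (h4 _ _ (le_max_right _ _) ?_ fun k hk => ?_),
    le_max_of_le_right (norm_prod_le_iff.2 ⟨le_max_of_le_left ?_, le_max_of_le_right ?_⟩)⟩
  · exact hξ0.trans (le_max_of_le_left (le_max_left _ _))
  · exact (hMu _ (hy.input_mem k hk.le)).trans (le_max_of_le_left (le_max_right _ _))
  · have h6 := h5 _ hy.art_mem _ hζ₀
    have h7 : ‖D.Tv y.dec.ξa0 - D.Tv ζ₀‖ ≤ M' + ‖D.Tv ζ₀‖ := by
      refine (norm_sub_le _ _).trans (add_le_add ?_ le_rfl)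
      rwa [IsFeasible.Tv_eq hD hy] at hTv
    calc ‖y.2.1‖ = ‖ζ₀ + (y.dec.ξa0 - ζ₀)‖ := by rw [add_sub_cancel]; rfl
      _ ≤ ‖ζ₀‖ + ‖y.dec.ξa0 - ζ₀‖ := norm_add_le _ _
      _ ≤ B₂ := by
        refine add_le_add le_rfl (h6.trans ?_)
        gcongr
  · have : y.2.2 = y.dec.τ := rfl
    rw [this, Real.norm_eq_abs, abs_of_nonneg hτ.1]; exact hτ.2

theorem isClosed_feasible (ξ : ExtState n m p d) (vbar : DistWindow n p d) :
    IsClosed {y : DecVec n m p d N | D.IsFeasible ξ vbar y.dec} := by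
  have h1 : {y : DecVec n m p d N | D.IsFeasible ξ vbar y.dec} =
      {y | ∀ k ≤ N, ExtState.xL (D.trajL k y.1) ∈ pdiff D.X D.Sx} ∩
      ({y | ∀ k ≤ N, D.inputL k y.1 ∈ pdiff D.U D.Su} ∩ ({y | y.2.2 ∈ Set.Icc (0 : ℝ) 1} ∩
      ({y | D.TvL y.1.1 = y.2.2 • vbar + (1 - y.2.2) • D.Tv ξ} ∩
      ({y | D.T0L (ξ - y.1.1) ∈ D.S} ∩ ({y | D.trajL N y.1 = (D.stepL ^ N) y.2.1} ∩
      {y | y.2.1 ∈ D.Za}))))) := by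
    ext y
    simp only [← free_eq]
    exact ⟨fun h => ⟨h.1, h.2, h.3, h.4, h.5, h.6, h.7⟩,
      fun ⟨h1, h2, h3, h4, h5, h6, h7⟩ => ⟨h1, h2, h3, h4, h5, h6, h7⟩⟩
  have hf : Continuous fun y : DecVec n m p d N => y.1 := continuous_fst
  have ht : Continuous fun y : DecVec n m p d N => y.2.2 := by fun_prop
  have h0 : Continuous fun y : DecVec n m p d N => y.1.1 := by fun_prop
  have ha : Continuous fun y : DecVec n m p d N => y.2.1 := by fun_prop
  rw [h1]
  refine IsClosed.inter ?_ (IsClosed.inter ?_ (IsClosed.inter ?_ (IsClosed.inter ?_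
    (IsClosed.inter ?_ (IsClosed.inter ?_ ?_)))))
  · simp only [Set.ofPred_forall]
    refine isClosed_iInter fun k => isClosed_iInter fun _ => ?_
    exact (isClosed_pdiff hD.X_compact.isClosed).preimage
      ((continuous_linear ExtState.xL).comp ((continuous_linear (D.trajL k)).comp hf))
  · simp only [Set.ofPred_forall]
    refine isClosed_iInter fun k => isClosed_iInter fun _ => ?_
    exact (isClosed_pdiff hD.U_compact.isClosed).preimage ((continuous_linear (D.inputL k)).comp hf)
  · exact isClosed_Icc.preimage ht
  · exact isClosed_eq ((continuous_linear D.TvL).comp h0) (by fun_prop)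
  · exact hD.S_compact.isClosed.preimage ((continuous_linear D.T0L).comp (continuous_const.sub h0))
  · exact isClosed_eq ((continuous_linear (D.trajL N)).comp hf) ((continuous_linear (D.stepL ^ N)).comp ha)
  · exact (isClosed_Za hD).preimage ha

theorem exists_isOptimal (hS : D.S.Nonempty) {ξ : ExtState n m p d} {vbar : DistWindow n p d}
    (h : ∃ z : Decision n m p d N, D.IsFeasible ξ vbar z) :
    ∃ z : Decision n m p d N, D.IsOptimal ξ vbar z := by
  obtain ⟨z, hz⟩ := h
  obtain ⟨B, hB⟩ := exists_norm_feasible_le (N := N) hD hS (max ‖ξ‖ ‖vbar‖)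
  have hcomp : IsCompact {y : DecVec n m p d N | D.IsFeasible ξ vbar y.dec} :=
    Metric.isCompact_of_isClosed_isBounded (isClosed_feasible hD ξ vbar)
      (isBounded_iff_forall_norm_le.2 ⟨B, fun y hy => hB ξ vbar y (le_max_left _ _) (le_max_right _ _) hy⟩)
  obtain ⟨y, hy, hmin⟩ := hcomp.exists_isMinOn ⟨ofDec z, hz⟩ (isPSDQuad_cost hD).continuous.continuousOn
  exact ⟨y.dec, hy, fun z' hz' => hmin (a := ofDec z') hz'⟩

end

end Data

namespace Data

variable {n m p d N : ℕ} [NeZero d] {D : Data n m p d N}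

open DecVec

/-! ### The shifted prediction -/

variable (D) in
/-- Shift by one stage of a predicted trajectory, given by its initial state and its increments. -/
def shiftL : (ExtState n m p d × (Fin N → Fin m → ℝ)) →ₗ[ℝ] ExtState n m p d × (Fin N → Fin m → ℝ) where
  toFun w := (D.trajL 1 w, fun i => pad w.2 (i + 1))
  map_add' w w' := by rw [map_add, Prod.snd_add, pad_add]; rfl
  map_smul' r w := by rw [map_smul, Prod.smul_snd, pad_smul]; rfl

theorem pad_shiftL (w : ExtState n m p d × (Fin N → Fin m → ℝ)) (k : ℕ) :
    pad (D.shiftL w).2 k = pad w.2 (k + 1) := by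
  have h : (D.shiftL w).2 = fun i : Fin N => pad w.2 (i + 1) := rfl
  by_cases hk : k < N
  · rw [h]; exact pad_apply (fun i => pad w.2 (i + 1)) hk
  · simp [pad, hk, show ¬ k + 1 < N by omega]

theorem trajL_shiftL (w : ExtState n m p d × (Fin N → Fin m → ℝ)) (k : ℕ) :
    D.trajL k (D.shiftL w) = D.trajL (k + 1) w := by
  have h1 : pad (D.shiftL w).2 = fun k => pad w.2 (1 + k) := by
    funext k; rw [pad_shiftL, add_comm]
  have h2 : (D.shiftL w).1 = D.traj w.1 (pad w.2) 1 := rfl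
  rw [trajL_apply, trajL_apply, h1, h2, add_comm k 1, traj_shift]

theorem inputL_shiftL (w : ExtState n m p d × (Fin N → Fin m → ℝ)) (k : ℕ) :
    D.inputL k (D.shiftL w) = D.inputL (k + 1) w := by
  rw [inputL_apply, inputL_apply, ← trajL_apply, trajL_shiftL, pad_shiftL, trajL_apply]

theorem devCost_shiftL (w : ExtState n m p d × (Fin N → Fin m → ℝ)) (k : ℕ) :
    D.devCost k (D.shiftL w) = D.devCost (k + 1) w := by
  rw [devCost, devCost, trajL_shiftL, pad_shiftL]

variable (D) in
/-- The decision shifted by one stage, continued along the artificial reference; it uses the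
fallback disturbance. -/
def shift (y : DecVec n m p d N) : DecVec n m p d N := (D.shiftL y.1, D.step y.2.1 0, 1)

theorem devL_shift (y : DecVec n m p d N) : devL (D.shift y) = D.shiftL (devL y) := by
  have h := trajL_devL (D := D) y 1
  exact Prod.ext h.symm rfl

theorem trajL_succ_of_ge (w : ExtState n m p d × (Fin N → Fin m → ℝ)) {k : ℕ} (hk : N ≤ k) :
    D.trajL (k + 1) w = D.step (D.trajL k w) 0 := by
  rw [trajL_apply, traj, trajL_apply]
  congr 1
  simp [pad, hk]

theorem inputL_of_ge (w : ExtState n m p d × (Fin N → Fin m → ℝ)) {k : ℕ} (hk : N ≤ k) :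
    D.inputL k w = (D.trajL (k + 1) w).uPrev := by
  have h2 : (D.step (D.trajL k w) 0).uPrev =
    push (genNext D.c (D.trajL k w).uWin + 0) (D.trajL k w).uWin 0 := rfl
  rw [trajL_succ_of_ge w hk, h2, push_zero (d := d), inputL_apply, trajL_apply]
  simp [pad, hk]

theorem IsFeasible.trajL_of_ge {ξ : ExtState n m p d} {vbar : DistWindow n p d} {y : DecVec n m p d N}
    (hy : D.IsFeasible ξ vbar y.dec) {k : ℕ} (hk : N ≤ k) : D.trajL k y.1 = D.free k y.2.1 := by
  induction k, hk using Nat.le_induction with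
  | base => exact hy.terminal
  | succ k hk ih => rw [trajL_succ_of_ge _ hk, ih, free_succ]

section

variable (hD : D.Standing)
include hD

theorem shiftL_eq_zero {w : ExtState n m p d × (Fin N → Fin m → ℝ)} (h : D.trajL N w = 0) :
    D.trajL N (D.shiftL w) = 0 := by
  rw [trajL_shiftL, trajL_succ_of_ge _ le_rfl, h, step_zero]

theorem Tv_shiftL (w : ExtState n m p d × (Fin N → Fin m → ℝ)) :
    D.Tv (D.shiftL w).1 = genStep D.c (D.Tv w.1) := Tv_step hD.c_zero hD.c_last _ _

theorem IsFeasible.shift_constraints (hS : D.S.Nonempty) {ξ : ExtState n m p d}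
    {vbar : DistWindow n p d} {y : DecVec n m p d N} (hy : D.IsFeasible ξ vbar y.dec)
    {k : ℕ} (hk : k ≤ N) : (D.trajL k (D.shift y).1).x ∈ pdiff D.X D.Sx ∧
      D.inputL k (D.shift y).1 ∈ pdiff D.U D.Su := by
  have h : (D.shift y).1 = D.shiftL y.1 := rfl
  rw [h, trajL_shiftL, inputL_shiftL]
  rcases Nat.lt_or_ge k N with hlt | hge
  · exact ⟨hy.state_mem _ hlt, hy.input_mem _ hlt⟩
  · rw [inputL_of_ge _ (by omega), hy.trajL_of_ge (by omega), hy.trajL_of_ge (by omega)]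
    exact ⟨pdiff_smul_subset hD.X_convex hD.sigma_gt (mem_of_mem_nhds (Sx_mem_nhds hD hS))
      (hy.art_mem _).2.1, pdiff_smul_subset hD.U_convex hD.sigma_gt (zero_mem_Su hD hS)
      (hy.art_mem _).1⟩

theorem devCost_eq_zero {w : ExtState n m p d × (Fin N → Fin m → ℝ)} (h : D.trajL N w = 0) :
    D.devCost N w = 0 := by
  have h1 : pad w.2 N = 0 := by simp [pad]
  rw [devCost, h, h1]
  have e1 := (isPSDQuad_quad hD.Qdx_psd).map_zero
  have e2 := (isPSDQuad_quad hD.Qe_pd.posSemidef).map_zero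
  have e3 := (isPSDQuad_quad hD.R_pd.posSemidef).map_zero
  have e : D.stageCost 0 0 = quad D.Qdx 0 + quad D.Qe 0 + quad D.R 0 := rfl
  rw [e, e1, e2, e3]; norm_num

theorem sum_devCost_shiftL {w : ExtState n m p d × (Fin N → Fin m → ℝ)} (h : D.trajL N w = 0) :
    (∑ k ∈ Finset.range N, D.devCost k (D.shiftL w)) + D.devCost 0 w =
      ∑ k ∈ Finset.range N, D.devCost k w := by
  simp only [devCost_shiftL]
  rw [← Finset.sum_range_succ' (fun k => D.devCost k w), Finset.sum_range_succ,
    devCost_eq_zero hD h, add_zero]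

theorem cost_shift_le {ξ : ExtState n m p d} {vbar : DistWindow n p d} {y : DecVec n m p d N}
    (hy : D.IsFeasible ξ vbar y.dec) : D.cost (D.shift y).dec + D.devCost 0 (devL y) ≤
      D.cost y.dec + D.lam * (1 - y.2.2 ^ 2) := by
  have h1 := sum_devCost_shiftL hD (IsFeasible.trajL_devL_eq_zero hD hy)
  have h2 := Vcost_step_le hD hy.art_mem
  have h2' : D.Vcost (D.shift y).2.1.eWin ≤ D.Vcost y.2.1.eWin := h2
  have h3 : (D.shift y).2.2 = 1 := rfl
  rw [cost_dec, cost_dec, devL_shift, h3]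
  linarith

/-! ### Positivity of the accumulated stage cost -/

/-- If no increment `Δx` is both unweighted and forgotten, the accumulated stage cost is positive
definite on the deviations that meet the terminal constraint. -/
theorem exists_norm_sq_le_sum_devCost (hw : D.IncrementWeighted) :
    ∃ K > 0, ∀ w : ExtState n m p d × (Fin N → Fin m → ℝ), D.trajL N w = 0 →
      ‖w‖ ^ 2 ≤ K * ∑ k ∈ Finset.range N, D.devCost k w := by
  have hq := (IsPSDQuad.sum (Finset.range N) fun k => isPSDQuad_devCost hD k).comp
    (LinearMap.ker (D.trajL N)).subtype
  obtain ⟨K, hK, h⟩ := hq.exists_norm_sq_le (by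
    rintro ⟨⟨η, du⟩, hη⟩ h0
    rw [LinearMap.mem_ker] at hη
    have hk : ∀ k < N, D.devCost k (η, du) = 0 := fun k hk =>
      (Finset.sum_eq_zero_iff_of_nonneg fun k _ => (isPSDQuad_devCost hD k).nonneg _).1 h0 k
        (Finset.mem_range.2 hk)
    have e1 := (isPSDQuad_quad hD.Qdx_psd).nonneg
    have e2 := (isPSDQuad_quad hD.Qe_pd.posSemidef).nonneg
    have e3 := (isPSDQuad_quad hD.R_pd.posSemidef).nonneg
    have hdu : du = 0 := by
      funext ⟨k, hkN⟩
      have h1 := hk k hkN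
      have h2 : quad D.R (pad du k) = 0 := by
        rw [devCost, stageCost] at h1
        linarith [e1 (D.trajL k (η, du)).dx, e2 (D.trajL k (η, du)).e, e3 (pad du k)]
      have h3 := eq_zero_of_quad hD.R_pd h2
      simpa [pad, hkN] using h3
    subst hdu
    have hdx0 : ∀ k, k ≤ N → (D.free (N - k) η).dx = 0 := by
      intro k
      induction k with
      | zero => intro _; rw [trajL_free] at hη; rw [Nat.sub_zero, hη]; rfl
      | succ k ih =>
        intro hkN
        have h1 := hk (N - (k + 1)) (by omega)
        have h2 := ih (by omega)
        rw [show N - k = N - (k + 1) + 1 by omega, free_succ] at h2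
        rw [devCost, stageCost, trajL_free] at h1
        have h3 : quad D.Qdx (D.free (N - (k + 1)) η).dx = 0 := by
          linarith [e1 (D.free (N - (k + 1)) η).dx, e2 (D.free (N - (k + 1)) η).e,
            e3 (pad (0 : Fin N → Fin m → ℝ) (N - (k + 1)))]
        refine hw _ ?_ (mulVec_eq_zero_of_quad hD.Qdx_psd h3)
        have h4 : (D.step (D.free (N - (k + 1)) η) 0).dx =
          D.A *ᵥ (D.free (N - (k + 1)) η).dx + D.B *ᵥ 0 + 0 := rfl
        rw [h4] at h2
        simpa using h2
    have hdx : η.dx = 0 := by simpa [free_zero] using hdx0 N le_rfl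
    rw [trajL_free, free_of_dx hdx] at hη
    have h1 := congrArg (fun ξ : ExtState n m p d => ξ.2.1) hη
    have h2 := congrArg (fun ξ : ExtState n m p d => ξ.2.2.1) hη
    have h3 := congrArg (fun ξ : ExtState n m p d => ξ.2.2.2) hη
    refine Subtype.ext (Prod.ext (ExtState.ext' hdx ?_ ?_ ?_) rfl)
    · exact genStep_iterate_injective hD.c_last h1
    · exact genStep_iterate_injective hD.c_last h2
    · exact genStep_iterate_injective hD.c_last h3)
  exact ⟨K, hK, fun w hw => h ⟨w, hw⟩⟩

/-! ### Candidate decisions -/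

theorem exists_norm_state_input_le : ∃ K > 0, ∀ k ≤ N, ∀ w : ExtState n m p d × (Fin N → Fin m → ℝ),
    ‖(D.trajL k w).x‖ ≤ K * ‖w‖ ∧ ‖D.inputL k w‖ ≤ K * ‖w‖ := by
  let f : (ExtState n m p d × (Fin N → Fin m → ℝ)) →ₗ[ℝ] Fin (N + 1) → (Fin n → ℝ) × (Fin m → ℝ) :=
    LinearMap.pi fun k => (ExtState.xL ∘ₗ D.trajL k).prod (D.inputL k)
  obtain ⟨K, hK, h⟩ := exists_norm_map_le f
  refine ⟨K, hK, fun k hk w => ?_⟩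
  have h1 := (norm_le_pi_norm (f w) ⟨k, by omega⟩).trans (h w)
  exact ⟨(norm_fst_le _).trans h1, (norm_snd_le _).trans h1⟩

/-- The factor `σ > 1` leaves room between the constraints on references and those on predictions. -/
theorem exists_slack (hS : D.S.Nonempty) (hp : PersistentGenerator D.c d) :
    ∃ r > 0, (∀ x ∈ pdiff D.X (D.σ • D.Sx), ∀ δ, ‖δ‖ ≤ r → x + δ ∈ pdiff D.X D.Sx) ∧
      (∀ x ∈ pdiff D.U (D.σ • D.Su), ∀ δ, ‖δ‖ ≤ r → x + δ ∈ pdiff D.U D.Su) := by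
  obtain ⟨r₁, h1, h1'⟩ := exists_slack_pdiff hD.X_convex hD.sigma_gt (Sx_mem_nhds hD hS)
  obtain ⟨r₂, h2, h2'⟩ := exists_slack_pdiff hD.U_convex hD.sigma_gt (Su_mem_nhds hD hS hp)
  exact ⟨min r₁ r₂, lt_min h1 h2, fun x hx δ hδ => h1' x hx δ (hδ.trans (min_le_left _ _)),
    fun x hx δ hδ => h2' x hx δ (hδ.trans (min_le_right _ _))⟩

/-- A state close to an admissible reference with the same disturbance state is steered to that
reference, with a cost that is quadratic in the distance. -/
theorem exists_near_candidate (hS : D.S.Nonempty) (hp : PersistentGenerator D.c d) :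
    ∃ K > 0, ∃ r > 0, ∀ ζ ∈ D.Za, ∀ η : ExtState n m p d, D.Tv η = 0 → ‖η‖ ≤ r →
      ∃ du : Fin N → Fin m → ℝ, (∀ k ≤ N, (D.trajL k (ζ + η, du)).x ∈ pdiff D.X D.Sx) ∧
        (∀ k ≤ N, D.inputL k (ζ + η, du) ∈ pdiff D.U D.Su) ∧
        D.trajL N (ζ + η, du) = D.free N ζ ∧
        (∑ k ∈ Finset.range N, D.devCost k (η, du)) ≤ K * ‖η‖ ^ 2 := by
  obtain ⟨r, hr, hrX, hrU⟩ := exists_slack hD hS hp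
  obtain ⟨K₁, hK₁, h1⟩ := exists_norm_state_input_le hD
  obtain ⟨K₂, hK₂, h2⟩ := exists_steering hD
  obtain ⟨K₃, hK₃, h3⟩ := (IsPSDQuad.sum (Finset.range N) fun k => isPSDQuad_devCost hD k).exists_le_norm_sq
  refine ⟨K₃ * (1 + K₂) ^ 2, by positivity, r / (K₁ * (1 + K₂)), by positivity, fun ζ hζ η hη hηr => ?_⟩
  obtain ⟨du, hdu, hdu'⟩ := h2 η hη
  have hn : ‖(η, du)‖ ≤ (1 + K₂) * ‖η‖ := by
    refine norm_prod_le_iff.2 ⟨?_, ?_⟩ <;> dsimp only <;> nlinarith [norm_nonneg η]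
  have hsplit : (ζ + η, du) = (ζ, (0 : Fin N → Fin m → ℝ)) + (η, du) := by simp
  have hnr : K₁ * ‖(η, du)‖ ≤ r := by
    rw [le_div_iff₀ (by positivity)] at hηr
    nlinarith
  refine ⟨du, fun k hk => ?_, fun k hk => ?_, ?_, ?_⟩
  · rw [hsplit, map_add, trajL_free]
    exact hrX _ (hζ k).2.1 _ ((h1 k hk _).1.trans hnr)
  · rw [hsplit, map_add, inputL_free]
    exact hrU _ (hζ (k + 1)).1 _ ((h1 k hk _).2.trans hnr)
  · rw [hsplit, map_add, trajL_free, hdu, add_zero]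
  · refine (h3 _).trans ?_
    rw [_root_.mul_assoc, ← mul_pow]
    gcongr

/-- Near its artificial reference, an optimizer cannot have a reference that is much worse than a
reference towards which it may move: a convex combination of the two references is reached at a cost
of second order. -/
theorem exists_forall_Vcost_le (hS : D.S.Nonempty) (hp : PersistentGenerator D.c d) (M : ℝ) {ε : ℝ}
    (hε : 0 < ε) : ∃ δ > 0, ∀ (ξ : ExtState n m p d) (vbar : DistWindow n p d) (y : DecVec n m p d N)
      (ζ : ExtState n m p d), D.IsOptimal ξ vbar y.dec → ζ ∈ D.Za → ‖D.Tv ζ - D.Tv y.2.1‖ ≤ M →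
      ‖y.1.1 - y.2.1‖ ≤ δ → (∀ s : ℝ, 0 < s → s ≤ 1 → ∃ τ : ℝ, 0 ≤ τ ∧ τ ≤ y.2.2 ∧
        D.Tv y.1.1 + s • (D.Tv ζ - D.Tv y.2.1) = τ • vbar + (1 - τ) • D.Tv ξ) →
      D.Vcost y.2.1.eWin ≤ D.Vcost ζ.eWin + ε := by
  obtain ⟨K, hK, r, hr, hcand⟩ := exists_near_candidate hD hS hp
  obtain ⟨K₁, hK₁, h1⟩ := exists_norm_map_le (T hD).symm.toLinearMap
  obtain ⟨K₅, hK₅, h5⟩ := exists_norm_sub_le_of_Za hD hS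
  set M' := max M 0
  set B := 1 + K₁ * M' + K₅ * (1 + M') with hB
  have hB0 : 0 < B := by positivity
  set s := min 1 (min (r / B) (ε / (K * B ^ 2))) with hs
  have hs0 : 0 < s := by positivity
  have hs1 : s ≤ 1 := min_le_left _ _
  have hsr : s * B ≤ r := by
    rw [← le_div_iff₀ hB0]; exact (min_le_right _ _).trans (min_le_left _ _)
  have hsε : s * (K * B ^ 2) ≤ ε := by
    rw [← le_div_iff₀ (by positivity)]; exact (min_le_right _ _).trans (min_le_right _ _)
  refine ⟨s, hs0, fun ξ vbar y ζ hy hζ hM hδ hτ => ?_⟩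
  obtain ⟨τ, hτ0, hτ1, hτ2⟩ := hτ s hs0 hs1
  have hM' : ‖D.Tv ζ - D.Tv y.2.1‖ ≤ M' := hM.trans (le_max_left _ _)
  have hya : y.2.1 ∈ D.Za := hy.1.art_mem
  set ζs := (1 - s) • y.2.1 + s • ζ with hζs
  have hζsZ : ζs ∈ D.Za := convex_Za hD hya hζ (by linarith) hs0.le (by ring)
  set μ := (T hD).symm ((0 : LoopState n p d), s • (D.Tv ζ - D.Tv y.2.1)) with hμ
  set η := y.1.1 + μ - ζs with hη
  have hηeq : η = (y.1.1 - y.2.1) + μ - s • (ζ - y.2.1) := by rw [hη, hζs]; module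
  have hμn : ‖μ‖ ≤ s * (K₁ * M') := by
    refine (h1 _).trans ?_
    have : ‖((0 : LoopState n p d), s • (D.Tv ζ - D.Tv y.2.1))‖ ≤ s * M' := by
      refine norm_prod_le_iff.2 ⟨?_, ?_⟩
      · simp only [norm_zero]; positivity
      · dsimp only
        rw [norm_smul, Real.norm_eq_abs, abs_of_pos hs0]; gcongr
    calc _ ≤ K₁ * (s * M') := by gcongr
      _ = _ := by ring
  have hηn : ‖η‖ ≤ s * B := by
    have h6 : ‖s • (ζ - y.2.1)‖ ≤ s * (K₅ * (1 + M')) := by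
      rw [norm_smul, Real.norm_eq_abs, abs_of_pos hs0]
      gcongr
      exact (h5 _ hζ _ hya).trans (by gcongr)
    rw [hηeq, hB]
    refine (norm_sub_le _ _).trans ((add_le_add (norm_add_le _ _) le_rfl).trans ?_)
    linarith
  have hTv : D.Tv η = 0 := by
    rw [hηeq, Tv_sub, Tv_add, Tv_sub, Tv_smul, Tv_sub, hμ, Tv_symm, IsFeasible.Tv_eq hD hy.1]
    simp
  obtain ⟨du, hdx, hdu, hdN, hdc⟩ := hcand ζs hζsZ η hTv (hηn.trans hsr)
  have hsum : ζs + η = y.1.1 + μ := by rw [hη]; abel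
  rw [hsum] at hdN
  let z : DecVec n m p d N := ((y.1.1 + μ, du), ζs, τ)
  have hz : D.IsFeasible ξ vbar z.dec := by
    refine ⟨fun k hk => ?_, fun k hk => ?_, ⟨hτ0, hτ1.trans hy.1.tau_mem.2⟩, ?_, ?_, hdN, hζsZ⟩
    · have := hdx k hk
      rwa [hsum] at this
    · have := hdu k hk
      rwa [hsum] at this
    · have : D.Tv (y.1.1 + μ) = τ • vbar + (1 - τ) • D.Tv ξ := by
        rw [Tv_add, hμ, Tv_symm, hτ2]
      exact this
    · have : D.T0 (ξ - (y.1.1 + μ)) = D.T0 (ξ - y.1.1) := by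
        rw [T0_sub, T0_add, T0_sub, hμ, T0_symm, add_zero]
      have h := hy.1.init_loop
      rw [show D.T0 (ξ - z.dec.ξ0) = D.T0 (ξ - (y.1.1 + μ)) from rfl, this]
      exact h
  have hcost := hy.2 _ hz
  rw [cost_dec, cost_dec] at hcost
  have hdev : devL z = (η, du) := Prod.ext (by rw [hη]; rfl) rfl
  have hV : D.Vcost z.2.1.eWin ≤ (1 - s) * D.Vcost y.2.1.eWin + s * D.Vcost ζ.eWin :=
    (isPSDQuad_Vcost_eWin hD).map_convex_comb_le hs0.le hs1 y.2.1 ζ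
  rw [hdev] at hcost
  have h7 : D.lam * z.2.2 ^ 2 ≤ D.lam * y.2.2 ^ 2 := by
    have h8 := hD.lam_nonneg
    have h9 : z.2.2 = τ := rfl
    rw [h9]; gcongr
  have h8 := sum_devCost_nonneg hD (devL y) (Finset.range N)
  have h9 : K * ‖η‖ ^ 2 ≤ s * ε := by
    calc K * ‖η‖ ^ 2 ≤ K * (s * B) ^ 2 := by gcongr
      _ = s * (s * (K * B ^ 2)) := by ring
      _ ≤ s * ε := by gcongr
  have h10 : s * (D.Vcost y.2.1.eWin) ≤ s * (D.Vcost ζ.eWin + ε) := by linarith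
  exact le_of_mul_le_mul_left h10 hs0

end

end Data

theorem norm_pair_le {E F : Type*} [SeminormedAddCommGroup E] [SeminormedAddCommGroup F] {K : ℝ}
    (hK : 0 ≤ K) {a : E} {b : F} (h : ‖b‖ ≤ K * ‖a‖) : ‖(a, b)‖ ≤ (1 + K) * ‖a‖ := by
  refine norm_prod_le_iff.2 ⟨?_, ?_⟩ <;> dsimp only <;> nlinarith [norm_nonneg a]

namespace Data

variable {n m p d N : ℕ} [NeZero d] {D : Data n m p d N}

open DecVec

/-! ### The closed loop of plant and tube controller -/

variable (D) in
/-- The extended state after one step under the tube control law, whose input increment is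
`Δu_0 + K(ξ - ξ_0)` in incremental form. -/
def tubeStep (ξ : ExtState n m p d) (y : DecVec n m p d N) (ω : Dist n p) : ExtState n m p d :=
  D.predStep ξ (pad y.1.2 0 + D.dK (ξ - y.1.1)) ω.1 ω.2

theorem tubeStep_sub (ξ : ExtState n m p d) (y : DecVec n m p d N) (ω : Dist n p) :
    D.tubeStep ξ y ω - (D.shiftL y.1).1 =
      D.predStep (ξ - y.1.1) (D.dK (ξ - y.1.1)) ω.1 ω.2 := by
  have h : (D.shiftL y.1).1 = D.predStep y.1.1 (pad y.1.2 0) 0 0 := rfl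
  rw [h, tubeStep, ← predStep_sub]
  simp

section

variable (hD : D.Standing)
include hD

/-- The tube error obeys the error dynamics. -/
theorem T0_tubeStep_sub (ξ : ExtState n m p d) (y : DecVec n m p d N) (ω : Dist n p) :
    D.T0 (D.tubeStep ξ y ω - (D.shiftL y.1).1) = D.errStep (D.T0 (ξ - y.1.1))
      ((D.Tv (D.tubeStep ξ y ω) 0).1 - (genStep D.c (D.Tv y.1.1) 0).1, (D.Tv (ξ - y.1.1) 0).2) := by
  rw [tubeStep_sub, T0_predStep hD, ← tubeStep_sub, Tv_sub, Tv_shiftL hD]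
  rfl

/-- One step of the tube controller. The disturbance state of the plant is split into a nominal
part `vW`, which follows the signal generator, and a part `wW` bounded by the convex hull of `W`. -/
theorem tube_step (hS : D.S.Nonempty) {ξ : ExtState n m p d} {vbar : DistWindow n p d}
    {y : DecVec n m p d N} (hy : D.IsFeasible ξ vbar y.dec) {vW wW wW' : DistWindow n p d}
    {ω : Dist n p} (hv : D.Tv ξ = vW + wW) (hw : ∀ i, wW i ∈ D.Wc) (hw' : ∀ i, wW' i ∈ D.Wc)
    (hv' : D.Tv (D.tubeStep ξ y ω) = genStep D.c vW + wW') (hbar : vbar - vW ∈ D.V) :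
    D.IsFeasible (D.tubeStep ξ y ω) (genStep D.c (D.Tv y.1.1)) (D.shift y).dec ∧
      genStep D.c (D.Tv y.1.1) - genStep D.c vW ∈ D.V ∧
      ξ.x ∈ D.X ∧ D.inputL 0 y.1 + D.K (ξ - y.1.1) ∈ D.U := by
  have hτ := hy.tau_mem
  set ν := D.Tv y.1.1 - vW with hν
  have hTv0 : D.Tv y.1.1 = y.2.2 • vbar + (1 - y.2.2) • D.Tv ξ := hy.init_dist
  have hνV : ν ∈ D.V := by
    have h1 := hD.V_convex hbar (mem_V_of_mem_Wc hD hw) hτ.1 (sub_nonneg.2 hτ.2) (by ring)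
    have h2 : ν = y.dec.τ • (vbar - vW) + (1 - y.dec.τ) • wW := by
      rw [hν, hTv0, hv]
      have : y.dec.τ = y.2.2 := rfl
      rw [this]; module
    rwa [h2]
  have hTvd : D.Tv (ξ - y.1.1) = wW - ν := by rw [Tv_sub, hv, hν]; abel
  have hgen : genStep D.c ν = genStep D.c (D.Tv y.1.1) - genStep D.c vW := by
    simp only [← genStepL_apply]; rw [hν, map_sub]
  have hv1 : (-(genStep D.c ν 0).1, -(ν 0).2) ∈ D.V1 := ⟨ν, hνV, rfl⟩
  have hloop : D.T0 (ξ - y.1.1) ∈ D.S := hy.init_loop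
  refine ⟨⟨fun k hk => (IsFeasible.shift_constraints hD hS hy hk).1,
    fun k hk => (IsFeasible.shift_constraints hD hS hy hk).2, ⟨zero_le_one, le_rfl⟩, ?_, ?_, ?_,
    step_mem_Za hy.art_mem⟩, ?_, ?_, ?_⟩
  · have h1 : D.Tv (D.shiftL y.1).1 =
        (1 : ℝ) • genStep D.c (D.Tv y.1.1) + (1 - (1 : ℝ)) • D.Tv (D.tubeStep ξ y ω) := by
      rw [Tv_shiftL hD]; simp
    exact h1
  · have h1 := T0_tubeStep_sub hD ξ y ω
    have h2 : D.T0 (D.tubeStep ξ y ω - (D.shiftL y.1).1) ∈ D.S := by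
      rw [h1]
      refine errStep_mem hD hloop ⟨_, hv1, ((wW' 0).1, (wW 0).2), ⟨(hw' 0).1, (hw 0).2⟩, ?_⟩
      refine Prod.ext ?_ ?_
      · rw [hv', hgen]
        simp only [Pi.add_apply, Pi.sub_apply, Prod.fst_add, Prod.fst_sub]
        abel
      · rw [hTvd]
        simp only [Pi.sub_apply, Prod.snd_add, Prod.snd_sub]
        abel
    exact h2
  · have h1 := hy.trajL_of_ge (k := N + 1) (by omega)
    rw [← trajL_shiftL] at h1
    exact h1
  · rw [← hgen]; exact hD.V_invariant _ hνV
  · have h1 := hy.state_mem 0 (Nat.zero_le _) (D.T0 (ξ - y.1.1)).1 ⟨_, hloop, rfl⟩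
    have h2 : (D.pred y.dec 0).x + (D.T0 (ξ - y.1.1)).1 = ξ.x := by
      have : (D.T0 (ξ - y.1.1)).1 = ξ.x - y.1.1.x := rfl
      rw [this]; exact add_sub_cancel _ _
    rwa [h2] at h1
  · have h1 := add_mem_of_mem_pdiff_Su hD (hy.input_mem 0 (Nat.zero_le _)) hloop (hw 0).2 hv1
    have he : (ξ - y.1.1).e = D.C *ᵥ (ξ - y.1.1).x + (D.Tv (ξ - y.1.1) 0).2 := by
      simp [Tv, ExtState.e, ExtState.eWin, ExtState.x, ExtState.xWin]
    have h2 : D.K (ξ - y.1.1) = (D.Kx + D.Dc * D.C) *ᵥ (D.T0 (ξ - y.1.1)).1 +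
        D.Cc *ᵥ (D.T0 (ξ - y.1.1)).2 + D.Dc *ᵥ (-(ν 0).2 + (wW 0).2) := by
      rw [hD.ctrl_output, he, hTvd]
      have h3 : ((wW - ν) 0).2 = -(ν 0).2 + (wW 0).2 := by
        simp only [Pi.sub_apply, Prod.snd_sub]; abel
      rw [h3, Matrix.mulVec_add, Matrix.add_mulVec, Matrix.mulVec_mulVec]
      simp only [T0]
      abel
    rw [h2]
    exact h1

set_option maxHeartbeats 1000000 in
/-- If the plant follows the nominal model and the disturbance state of the prediction is accurate,
then the shifted optimizer can be moved to a nearby reference `ζ` while the initial disturbance state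
is set to the exact one. Room for this is made by mixing in a small multiple of `ζ`, which is
strictly feasible; the effect on the controller state is cancelled by a component of the extended state
that leaves the predicted states and inputs unchanged. -/
theorem exists_perturbed_candidate (hS : D.S.Nonempty) (hp : PersistentGenerator D.c d) (M : ℝ) {ε : ℝ}
    (hε : 0 < ε) : ∃ δ > 0, ∀ (ξ : ExtState n m p d) (vbar : DistWindow n p d) (y : DecVec n m p d N)
      (ζ : ExtState n m p d), D.IsFeasible ξ vbar y.dec → ‖devL y‖ ≤ M → ‖D.Tv (ξ - y.1.1)‖ ≤ δ →
      ζ ∈ D.Za → ‖ζ - D.step y.2.1 0‖ ≤ δ → D.Tv ζ = D.Tv (D.tubeStep ξ y 0) →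
      D.Tv (D.tubeStep ξ y 0) = genStep D.c (D.Tv ξ) →
      ∃ z : DecVec n m p d N, (∀ vbar', D.IsFeasible (D.tubeStep ξ y 0) vbar' z.dec) ∧
        z.2 = (ζ, 0) ∧ ‖devL z - D.shiftL (devL y)‖ ≤ ε := by
  have hc := hD.c_zero
  have hcd := hD.c_last
  obtain ⟨r, hr, hrX, hrU⟩ := exists_slack hD hS hp
  obtain ⟨ρ, hρ, hball⟩ := Metric.mem_nhds_iff.1 (Wc_mem_nhds hD)
  obtain ⟨K₁, hK₁, h1⟩ := exists_norm_state_input_le hD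
  obtain ⟨K₂, hK₂, h2⟩ := exists_steering hD
  obtain ⟨K₃, hK₃, h3⟩ := exists_norm_map_le (T hD).symm.toLinearMap
  obtain ⟨K₄, hK₄, h4⟩ := exists_norm_map_le D.T0L
  obtain ⟨K₅, hK₅, h5⟩ := exists_norm_map_le (D.restInc)
  obtain ⟨K₆, hK₆, h6⟩ := exists_norm_map_le (D.shiftL)
  obtain ⟨K₇, hK₇, h7⟩ := exists_norm_map_le (genStepL (E := Dist n p) (d := d) D.c)
  set M' := max M 0
  set B₁ := K₆ * M' + 1 with hB₁
  set Ks := K₆ * M' + (1 + K₅) * (K₃ * (K₄ * B₁)) with hKs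
  set Kδ := (1 + K₂) * (K₃ * K₄) with hKδ
  have hB₁0 : 0 < B₁ := by positivity
  have hKs0 : 0 < Ks := by positivity
  have hKδ0 : 0 < Kδ := by positivity
  set s := min 1 (min (ε / 2 / Ks) (ρ / 3 / B₁)) with hs
  have hs0 : 0 < s := by positivity
  have hs1 : s ≤ 1 := min_le_left _ _
  have hsε : s * Ks ≤ ε / 2 := by
    rw [← le_div_iff₀ hKs0]; exact (min_le_right _ _).trans (min_le_left _ _)
  have hsρ : s * B₁ ≤ ρ / 3 := by
    rw [← le_div_iff₀ hB₁0]; exact (min_le_right _ _).trans (min_le_right _ _)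
  set δ := min (min 1 (ε / 2 / Kδ)) (min (s * r / (K₁ * (1 + Kδ))) (ρ / 3 / (1 + K₇))) with hδ
  have hδ0 : 0 < δ := by positivity
  have hδ1 : δ ≤ 1 := (min_le_left _ _).trans (min_le_left _ _)
  have hδε : δ * Kδ ≤ ε / 2 := by
    rw [← le_div_iff₀ hKδ0]; exact (min_le_left _ _).trans (min_le_right _ _)
  have hδr : δ * (K₁ * (1 + Kδ)) ≤ s * r := by
    rw [← le_div_iff₀ (by positivity)]; exact (min_le_right _ _).trans (min_le_left _ _)
  have hδρ : δ * (1 + K₇) ≤ ρ / 3 := by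
    rw [← le_div_iff₀ (by positivity)]; exact (min_le_right _ _).trans (min_le_right _ _)
  refine ⟨δ, hδ0, fun ξ vbar y ζ hy hM hTvd hζ hζd hTvζ hgen => ?_⟩
  set w := devL y with hwdef
  set wc := D.shiftL w with hwc
  set θ := ζ - D.step y.2.1 0 with hθ
  set ξ₁ := (D.shiftL y.1).1 with hξ₁
  have hwN : D.trajL N w = 0 := IsFeasible.trajL_devL_eq_zero hD hy
  have hwcN : D.trajL N wc = 0 := shiftL_eq_zero hD hwN
  have hwcn : ‖wc‖ ≤ K₆ * M' := (h6 w).trans (by gcongr; exact hM.trans (le_max_left _ _))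
  have hwc1 : wc.1 = ξ₁ - D.step y.2.1 0 := by
    rw [hwc, hwdef, ← devL_shift]; rfl
  have hTvwc : D.Tv wc.1 = 0 := by
    have h8 : D.Tv w.1 = 0 := by
      have : w.1 = y.1.1 - y.2.1 := rfl
      rw [this, Tv_sub, IsFeasible.Tv_eq hD hy, sub_self]
    rw [hwc, Tv_shiftL hD, h8, ← genStepL_apply, map_zero]
  set q := ξ₁ - ζ with hq
  have hqeq : q = wc.1 - θ := by rw [hwc1, hθ, hq]; abel
  have hqn : ‖q‖ ≤ B₁ := by
    rw [hqeq]
    exact (norm_sub_le _ _).trans (add_le_add ((norm_fst_le _).trans hwcn) (hζd.trans hδ1))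
  -- the silent correction of the controller state
  set β := (T hD).symm (((0 : Fin n → ℝ), s • D.Tc q), (0 : DistWindow n p d)) with hβ
  have hβT : D.T0 β = ((0 : Fin n → ℝ), s • D.Tc q) := T0_symm hD _ _
  have hβv : D.Tv β = 0 := Tv_symm hD _ _
  have hβn : ‖β‖ ≤ K₃ * (s * (K₄ * B₁)) := by
    refine (h3 _).trans ?_
    refine mul_le_mul_of_nonneg_left ?_ hK₃.le
    refine norm_prod_le_iff.2 ⟨norm_prod_le_iff.2 ⟨?_, ?_⟩, ?_⟩ <;> dsimp only
    · rw [norm_zero]; positivity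
    · rw [norm_smul, Real.norm_eq_abs, abs_of_pos hs0]
      refine mul_le_mul_of_nonneg_left ?_ hs0.le
      have : D.Tc q = (D.T0L q).2 := rfl
      rw [this]
      exact (norm_snd_le _).trans ((h4 q).trans (by gcongr))
    · rw [norm_zero]; positivity
  obtain ⟨hβN, hβk⟩ := restInc_spec hD hβv (congrArg Prod.fst hβT)
  -- the steered correction of the change of the reference
  set γ := (T hD).symm (-D.T0 θ, (0 : DistWindow n p d)) with hγ
  have hγT : D.T0 γ = -D.T0 θ := T0_symm hD _ _
  have hγn : ‖γ‖ ≤ K₃ * (K₄ * δ) := by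
    refine (h3 _).trans ?_
    refine mul_le_mul_of_nonneg_left ?_ hK₃.le
    refine norm_prod_le_iff.2 ⟨?_, ?_⟩ <;> dsimp only
    · rw [norm_neg]; exact (h4 θ).trans (by gcongr)
    · rw [norm_zero]; positivity
  obtain ⟨dγ, hγN, hdγ⟩ := h2 γ (Tv_symm hD _ _)
  have hγp : ‖(γ, dγ)‖ ≤ δ * Kδ := by
    have : ‖(γ, dγ)‖ ≤ (1 + K₂) * ‖γ‖ := norm_pair_le hK₂.le hdγ
    calc _ ≤ (1 + K₂) * (K₃ * (K₄ * δ)) := this.trans (by gcongr)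
      _ = _ := by rw [hKδ]; ring
  have hβp : ‖(β, D.restInc β)‖ ≤ s * ((1 + K₅) * (K₃ * (K₄ * B₁))) := by
    have : ‖(β, D.restInc β)‖ ≤ (1 + K₅) * ‖β‖ := norm_pair_le hK₅.le (h5 β)
    calc _ ≤ (1 + K₅) * (K₃ * (s * (K₄ * B₁))) := this.trans (by gcongr)
      _ = _ := by ring
  set g : ExtState n m p d × (Fin N → Fin m → ℝ) := (γ, dγ) with hg
  set b : ExtState n m p d × (Fin N → Fin m → ℝ) := (β, D.restInc β) with hb
  set v := (1 - s) • wc + (1 - s) • g + b with hv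
  let z : DecVec n m p d N := ((ζ + v.1, v.2), ζ, 0)
  have hdev : devL z = v := Prod.ext (add_sub_cancel_left _ _) rfl
  -- the prediction as a mixture
  set pert : ExtState n m p d × (Fin N → Fin m → ℝ) := (1 - s) • ((θ, 0) + g) with hpert
  have hz1 : z.1 = (1 - s) • D.shiftL y.1 + s • (ζ, 0) + pert + b := by
    refine Prod.ext ?_ ?_
    · have e1 : z.1.1 = ζ + ((1 - s) • wc.1 + (1 - s) • γ + β) := rfl
      have e2 : ((1 - s) • D.shiftL y.1 + s • (ζ, (0 : Fin N → Fin m → ℝ)) + pert + b).1 =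
        (1 - s) • ξ₁ + s • ζ + (1 - s) • (θ + γ) + β := rfl
      rw [e1, e2, hwc1, hθ]; module
    · have e1 : z.1.2 = (1 - s) • wc.2 + (1 - s) • dγ + D.restInc β := rfl
      have e2 : ((1 - s) • D.shiftL y.1 + s • (ζ, (0 : Fin N → Fin m → ℝ)) + pert + b).2 =
        (1 - s) • (D.shiftL y.1).2 + s • (0 : Fin N → Fin m → ℝ) + (1 - s) • (0 + dγ) + D.restInc β := rfl
      have e3 : wc.2 = (D.shiftL y.1).2 := rfl
      rw [e1, e2, e3]; module
  have hpertn : K₁ * ‖pert‖ ≤ s * r := by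
    have h8 : ‖pert‖ ≤ δ * (1 + Kδ) := by
      rw [hpert, norm_smul, Real.norm_eq_abs, abs_of_nonneg (by linarith)]
      have h9 : ‖(θ, (0 : Fin N → Fin m → ℝ)) + g‖ ≤ δ * (1 + Kδ) := by
        refine (norm_add_le _ _).trans ?_
        have : ‖(θ, (0 : Fin N → Fin m → ℝ))‖ ≤ δ :=
          norm_prod_le_iff.2 ⟨hζd, by dsimp only; rw [norm_zero]; exact hδ0.le⟩
        linarith
      exact (mul_le_of_le_one_left (norm_nonneg _) (by linarith)).trans h9
    calc _ ≤ K₁ * (δ * (1 + Kδ)) := by gcongr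
      _ = δ * (K₁ * (1 + Kδ)) := by ring
      _ ≤ _ := hδr
  have hTz : D.Tv z.1.1 = D.Tv ζ := by
    have : D.Tv z.1.1 = D.Tv ζ + ((1 - s) • D.Tv wc.1 + (1 - s) • D.Tv γ + D.Tv β) := by
      rw [← Tv_smul, ← Tv_smul, ← Tv_add, ← Tv_add, ← Tv_add]; rfl
    rw [this, hTvwc, hβv, hγ, Tv_symm]; simp
  refine ⟨z, fun vbar' => ⟨fun k hk => ?_, fun k hk => ?_, ⟨le_rfl, zero_le_one⟩, ?_, ?_, ?_, hζ⟩, rfl, ?_⟩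
  · rw [pred_dec, hz1]
    simp only [map_add, map_smul]
    rw [trajL_free]
    have hx := mix_mem_pdiff hD.X_convex hrX hs0 hs1 (IsFeasible.shift_constraints hD hS hy hk).1
      (hζ k).2.1 (((h1 k hk pert).1).trans hpertn)
    have hbx := (hβk k hk).1
    have e : ((1 - s) • D.trajL k (D.shiftL y.1) + s • D.free k ζ + D.trajL k pert + D.trajL k b).x =
      (1 - s) • (D.trajL k (D.shiftL y.1)).x + s • (D.free k ζ).x + (D.trajL k pert).x
        + (D.trajL k b).x := rfl
    rw [e, hbx, add_zero]
    exact hx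
  · rw [predInput_dec, hz1]
    simp only [map_add, map_smul]
    rw [inputL_free, (hβk k hk).2, add_zero]
    exact mix_mem_pdiff hD.U_convex hrU hs0 hs1 (IsFeasible.shift_constraints hD hS hy hk).2
      (hζ (k + 1)).1 (((h1 k hk pert).2).trans hpertn)
  · have h8 : D.Tv z.1.1 = (0 : ℝ) • vbar' + (1 - (0 : ℝ)) • D.Tv (D.tubeStep ξ y 0) := by
      rw [hTz, hTvζ]; simp
    exact h8
  · have h8 : D.tubeStep ξ y 0 - z.1.1 =
        (D.tubeStep ξ y 0 - ξ₁) + (s • q - (1 - s) • (θ + γ) - β) := by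
      have e1 : z.1.1 = ζ + ((1 - s) • wc.1 + (1 - s) • γ + β) := rfl
      have e2 : wc.1 = q + θ := by rw [hqeq]; abel
      have e3 : ζ = ξ₁ - q := by rw [hq]; abel
      rw [e1, e2]; nth_rw 1 [e3]; module
    have h9 : D.T0 (s • q - (1 - s) • (θ + γ) - β) = (s • q.x, 0) := by
      rw [T0_sub, T0_sub, T0_smul, T0_smul, T0_add, hγT, hβT]
      refine Prod.ext ?_ ?_
      · simp [T0]
      · simp [T0]
    have h10 : D.T0 (D.tubeStep ξ y 0 - z.1.1) ∈ D.S := by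
      rw [h8, T0_add, h9, T0_tubeStep_sub hD, ← errStep_zero_fst hD]
      refine errStep_mem_of_Wc hD hy.init_loop (hball ?_)
      rw [mem_ball_zero_iff]
      have e1 : (D.Tv (D.tubeStep ξ y 0) 0).1 - (genStep D.c (D.Tv y.1.1) 0).1 =
          (genStepL D.c (D.Tv (ξ - y.1.1)) 0).1 := by
        rw [hgen, Tv_sub, map_sub]; rfl
      rw [e1]
      have n1 : ‖(genStepL D.c (D.Tv (ξ - y.1.1)) 0).1‖ ≤ K₇ * δ :=
        (norm_fst_le _).trans ((norm_le_pi_norm _ 0).trans ((h7 _).trans (by gcongr)))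
      have n2 : ‖(D.Tv (ξ - y.1.1) 0).2‖ ≤ δ := (norm_snd_le _).trans ((norm_le_pi_norm _ 0).trans hTvd)
      have n3 : ‖s • q.x‖ ≤ s * B₁ := by
        rw [norm_smul, Real.norm_eq_abs, abs_of_pos hs0]
        gcongr
        have : ‖q.x‖ ≤ ‖q‖ := (norm_le_pi_norm q.2.2.1 0).trans
          ((norm_fst_le q.2.2).trans ((norm_snd_le q.2).trans (norm_snd_le q)))
        exact this.trans hqn
      refine lt_of_le_of_lt (b := 2 * ρ / 3) (norm_prod_le_iff.2 ⟨?_, ?_⟩) (by linarith)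
      · refine (norm_add_le _ _).trans ?_
        dsimp only
        linarith
      · simp only [Prod.snd_add, add_zero]
        linarith [mul_nonneg hδ0.le hK₇.le]
    exact h10
  · have h8 : D.trajL N z.1 - D.free N z.2.1 = 0 := by
      rw [← trajL_devL, hdev, hv]
      simp only [map_add, map_smul]
      rw [hwcN, hγN, hβN]; simp
    exact sub_eq_zero.1 h8
  · rw [hdev]
    have e : v - wc = -(s • wc) + (1 - s) • g + b := by rw [hv]; module
    rw [e]
    refine (norm_add_le _ _).trans ((add_le_add (norm_add_le _ _) hβp).trans ?_)
    rw [norm_neg, norm_smul, norm_smul, Real.norm_eq_abs, abs_of_pos hs0, Real.norm_eq_abs,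
      abs_of_nonneg (by linarith)]
    have n1 : s * ‖wc‖ ≤ s * (K₆ * M') := by gcongr
    have n2 : (1 - s) * ‖g‖ ≤ δ * Kδ :=
      (mul_le_of_le_one_left (norm_nonneg _) (by linarith)).trans hγp
    have n3 : s * Ks = s * (K₆ * M') + s * ((1 + K₅) * (K₃ * (K₄ * B₁))) := by rw [hKs]; ring
    linarith

end

end Data

/-- To derive a property from smallness of finitely many successive terms of a nonnegative sequence,
it suffices to derive it along all filters on which these terms vanish. -/
theorem exists_delta_of_filter {a : ℕ → ℝ} (ha : ∀ t, 0 ≤ a t) {k : ℕ} {Q : ℕ → Prop}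
    (h : ∀ l : Filter ℕ, l ≤ atTop → (∀ i < k, Tendsto (fun t => a (t + i)) l (𝓝 0)) → ∀ᶠ t in l, Q t) :
    ∃ δ > 0, ∀ᶠ t in atTop, (∀ i < k, a (t + i) ≤ δ) → Q t := by
  by_contra! hcon
  have h1 : ∀ j : ℕ, ∃ᶠ t in atTop, (∀ i < k, a (t + i) ≤ 1 / ((j : ℝ) + 1)) ∧ ¬ Q t := fun j => by
    simpa only [not_eventually, Classical.not_imp] using hcon (1 / ((j : ℝ) + 1)) (by positivity)
  obtain ⟨φ, hφ, hφ'⟩ := extraction_forall_of_frequently h1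
  have h2 := h (map φ atTop) hφ.tendsto_atTop fun i hi => tendsto_map'_iff.2
    (squeeze_zero (fun j => ha _) (fun j => (hφ' j).1 i hi) tendsto_one_div_add_atTop_nhds_zero_nat)
  obtain ⟨j, hj⟩ := (eventually_map.1 h2).exists
  exact (hφ' j).2 hj

/-- Diagonal choice of witnesses with vanishing error. -/
theorem exists_seq_tendsto_zero {α : Type*} [Nonempty α] {P : ℕ → α → Prop} {g : ℕ → α → ℝ}
    (hg : ∀ t z, 0 ≤ g t z) (h : ∀ ε > 0, ∀ᶠ t in atTop, ∃ z, P t z ∧ g t z ≤ ε) :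
    ∃ z : ℕ → α, (∀ᶠ t in atTop, P t (z t)) ∧ Tendsto (fun t => g t (z t)) atTop (𝓝 0) := by
  classical
  have h1 : ∀ t, ∃ z, (∃ z, P t z) → P t z ∧ ∀ z', P t z' → g t z ≤ g t z' + 1 / ((t : ℝ) + 1) := by
    intro t
    by_cases hP : ∃ z, P t z
    · have hne : (g t '' {z | P t z}).Nonempty := let ⟨z, hz⟩ := hP; ⟨_, z, hz, rfl⟩
      have hbd : BddBelow (g t '' {z | P t z}) := ⟨0, by rintro _ ⟨z, -, rfl⟩; exact hg t z⟩
      obtain ⟨_, ⟨z, hz, rfl⟩, hlt⟩ := exists_lt_of_csInf_lt hne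
        (lt_add_of_pos_right (sInf (g t '' {z | P t z})) (show (0 : ℝ) < 1 / ((t : ℝ) + 1) by positivity))
      refine ⟨z, fun _ => ⟨hz, fun z' hz' => hlt.le.trans ?_⟩⟩
      gcongr
      exact csInf_le hbd ⟨z', hz', rfl⟩
    · exact ⟨Classical.arbitrary α, fun h => absurd h hP⟩
  choose z hz using h1
  refine ⟨z, (h 1 one_pos).mono fun t ⟨z', hz', _⟩ => (hz t ⟨z', hz'⟩).1, ?_⟩
  rw [Metric.tendsto_atTop]
  intro ε hε
  have h2 := (tendsto_one_div_add_atTop_nhds_zero_nat (𝕜 := ℝ)).eventually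
    (gt_mem_nhds (show (0 : ℝ) < ε / 2 by positivity))
  obtain ⟨T, hT⟩ := eventually_atTop.1 ((h (ε / 2 / 2) (by positivity)).and h2)
  refine ⟨T, fun t ht => ?_⟩
  obtain ⟨⟨z', hz', hle⟩, hlt⟩ := hT t ht
  have h3 := (hz t ⟨z', hz'⟩).2 z' hz'
  rw [Real.dist_eq, sub_zero, abs_of_nonneg (hg _ _)]
  linarith

namespace Data

variable {n m p d N : ℕ} [NeZero d] {D : Data n m p d N}

open DecVec

section

variable (hD : D.Standing)
include hD

/-! ### Vanishing stage costs -/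

/-- If the first stage cost and the distance between successive shifted optimizers vanish, then all
stage costs vanish, and so does the deviation from the artificial reference. -/
theorem dev_tendsto_zero (hw : D.IncrementWeighted) {l : Filter ℕ}
    {w : ℕ → ExtState n m p d × (Fin N → Fin m → ℝ)} (hN : ∀ t, D.trajL N (w t) = 0) {M : ℝ}
    (hM : ∀ t, (∑ k ∈ Finset.range N, D.devCost k (w t)) ≤ M)
    (h0 : ∀ i < N, Tendsto (fun t => D.devCost 0 (w (t + i))) l (𝓝 0))
    (hg : ∀ i < N, Tendsto (fun t => ∑ k ∈ Finset.range N,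
      D.devCost k (D.shiftL (w (t + i)) - w (t + i + 1))) l (𝓝 0)) : Tendsto w l (𝓝 0) := by
  have hq := isPSDQuad_devCost (N := N) hD
  have key : ∀ k i, i + k < N → Tendsto (fun t => D.devCost k (w (t + i))) l (𝓝 0) := by
    intro k
    induction k with
    | zero => intro i hi; exact h0 i (by omega)
    | succ k ih =>
      intro i hi
      have h1 := ih (i + 1) (by omega)
      have h2 : Tendsto (fun t => D.devCost k (D.shiftL (w (t + i)) - w (t + i + 1))) l (𝓝 0) :=
        squeeze_zero (fun t => (hq k).nonneg _) (fun t => devCost_le_sum hD _ (by omega)) (hg i (by omega))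
      have h3 := (hq k).tendsto_map_sub (x := fun t => w (t + i + 1)) (y := fun t => D.shiftL (w (t + i)))
        (Eventually.of_forall fun t => (devCost_le_sum hD _ (by omega)).trans (hM _)) h2
      simp only [devCost_shiftL] at h3
      have h4 := h3.add h1
      rw [add_zero] at h4
      exact h4.congr fun t => sub_add_cancel _ _
  have hsum : Tendsto (fun t => ∑ k ∈ Finset.range N, D.devCost k (w t)) l (𝓝 0) := by
    simpa using tendsto_finsetSum (Finset.range N) fun k hk => key k 0 (by simpa using hk)
  obtain ⟨K, hK, h⟩ := exists_norm_sq_le_sum_devCost hD hw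
  rw [tendsto_zero_iff_norm_tendsto_zero]
  have h1 : Tendsto (fun t => √(K * ∑ k ∈ Finset.range N, D.devCost k (w t))) l (𝓝 0) := by
    simpa using (hsum.const_mul K).sqrt
  exact squeeze_zero (fun t => norm_nonneg _) (fun t => Real.le_sqrt_of_sq_le (h _ (hN t))) h1

/-- If the optimizers approach their artificial references, they approach the optimal reachable
references. -/
theorem sub_optRef_tendsto_zero (hS : D.S.Nonempty) (hp : PersistentGenerator D.c d)
    {ξ : ℕ → ExtState n m p d} {vbar : ℕ → DistWindow n p d} {y : ℕ → DecVec n m p d N}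
    (hy : ∀ t, D.IsOptimal (ξ t) (vbar t) (y t).dec) (hdev : Tendsto (fun t => devL (y t)) atTop (𝓝 0))
    {ζ : ℕ → ExtState n m p d} (hζ : ∀ t, D.IsOptRef (y t).1.1 (ζ t)) :
    Tendsto (fun t => (y t).1.1 - ζ t) atTop (𝓝 0) := by
  have hd1 : Tendsto (fun t => (y t).1.1 - (y t).2.1) atTop (𝓝 0) :=
    (continuous_fst.tendsto (0 : ExtState n m p d × (Fin N → Fin m → ℝ))).comp hdev
  have hζ1 : ∀ t, ζ t ∈ D.Za ∧ D.Tv (ζ t) = D.Tv (y t).1.1 := fun t => (isReachableRef_iff hD hp).1 (hζ t).1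
  have hTv : ∀ t, D.Tv (y t).1.1 = D.Tv (y t).2.1 := fun t => IsFeasible.Tv_eq hD (hy t).1
  have ha : ∀ t, (y t).2.1 ∈ D.Za := fun t => (hy t).1.art_mem
  have hgrow : ∀ t, D.Vcost ((y t).2.1 - ζ t).eWin ≤
      2 * (D.Vcost (y t).2.1.eWin - D.Vcost (ζ t).eWin) := fun t =>
    Vcost_growth hD (hζ1 t) (fun η h1 h2 => (hζ t).2 η ((isReachableRef_iff hD hp).2 ⟨h1, h2⟩))
      ⟨ha t, (hTv t).symm⟩
  have hV : Tendsto (fun t => D.Vcost ((y t).2.1 - ζ t).eWin) atTop (𝓝 0) := by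
    rw [Metric.tendsto_atTop]
    intro ε hε
    obtain ⟨δ, hδ, h⟩ := exists_forall_Vcost_le (N := N) hD hS hp 0 (show 0 < ε / 4 by positivity)
    have h1 := hd1.eventually (Metric.closedBall_mem_nhds (0 : ExtState n m p d) hδ)
    obtain ⟨T, hT⟩ := eventually_atTop.1 h1
    refine ⟨T, fun t ht => ?_⟩
    have h2 := h (ξ t) (vbar t) (y t) (ζ t) (hy t) (hζ1 t).1 (by rw [(hζ1 t).2, hTv]; simp)
      (mem_closedBall_zero_iff.1 (hT t ht)) fun s _ _ => ⟨(y t).2.2, (hy t).1.tau_mem.1, le_rfl, by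
        rw [(hζ1 t).2, hTv, sub_self, smul_zero, add_zero, ← hTv]; exact (hy t).1.init_dist⟩
    rw [Real.dist_eq, sub_zero, abs_of_nonneg ((isPSDQuad_Vcost hD).nonneg _)]
    linarith [hgrow t]
  have he := (isPSDQuad_Vcost hD).tendsto_of_tendsto_zero (fun e he => eq_zero_of_Vcost hD he) hV
  have h1 : Tendsto (fun t => (y t).2.1 - ζ t) atTop (𝓝 0) := by
    refine tendsto_zero_of_dx_eWin hD ?_ ?_ he
    · have : ∀ t, D.Tv ((y t).2.1 - ζ t) = 0 := fun t => by rw [Tv_sub, (hζ1 t).2, hTv, sub_self]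
      simp only [this]; exact tendsto_const_nhds
    · have : ∀ t, ((y t).2.1 - ζ t).dx = 0 := fun t => by
        have h2 : ((y t).2.1 - ζ t).dx = (y t).2.1.dx - (ζ t).dx := rfl
        rw [h2, Za_dx (ha t), Za_dx (hζ1 t).1, sub_self]
      simp only [this]; exact tendsto_const_nhds
  simpa using hd1.add h1

end

variable (D) in
/-- The distance between the shift of `y t` and `y (t + 1)`, measured by the stage costs and the output
cost. -/
def gap (y : ℕ → DecVec n m p d N) (t : ℕ) : ℝ :=
  (∑ k ∈ Finset.range N, D.devCost k (D.shiftL (devL (y t)) - devL (y (t + 1)))) +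
    D.Vcost (D.step (y t).2.1 0 - (y (t + 1)).2.1).eWin

section

variable (hD : D.Standing)
include hD

theorem gap_nonneg (y : ℕ → DecVec n m p d N) (t : ℕ) : 0 ≤ D.gap y t :=
  add_nonneg (sum_devCost_nonneg hD _ _) ((isPSDQuad_Vcost hD).nonneg _)

theorem sum_devCost_le_gap (y : ℕ → DecVec n m p d N) (t : ℕ) :
    (∑ k ∈ Finset.range N, D.devCost k (D.shiftL (devL (y t)) - devL (y (t + 1)))) ≤ D.gap y t :=
  le_add_of_nonneg_right ((isPSDQuad_Vcost hD).nonneg _)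

/-- Vanishing decrements of the optimal cost make the deviation vanish. -/
theorem dev_tendsto_zero_of_decrement (hw : D.IncrementWeighted) {l : Filter ℕ}
    {ξ : ℕ → ExtState n m p d} {vbar : ℕ → DistWindow n p d} {y : ℕ → DecVec n m p d N}
    (hy : ∀ t, D.IsOptimal (ξ t) (vbar t) (y t).dec) {M : ℝ}
    (hM : ∀ t, (∑ k ∈ Finset.range N, D.devCost k (devL (y t))) ≤ M)
    (ha : ∀ i < N, Tendsto (fun t => D.devCost 0 (devL (y (t + i))) + 1 / 4 * D.gap y (t + i)) l (𝓝 0)) :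
    Tendsto (fun t => devL (y t)) l (𝓝 0) := by
  have h0 := (isPSDQuad_devCost (N := N) hD 0).nonneg
  refine dev_tendsto_zero hD hw (fun t => IsFeasible.trajL_devL_eq_zero hD (hy t).1) hM
    (fun i hi => squeeze_zero (fun t => h0 _) (fun t => ?_) (ha i hi)) (fun i hi => ?_)
  · linarith [gap_nonneg hD y (t + i)]
  · refine squeeze_zero (fun t => sum_devCost_nonneg hD _ _) (fun t => (sum_devCost_le_gap hD y (t + i)).trans ?_)
      (by simpa using (ha i hi).const_mul 4)
    linarith [h0 (devL (y (t + i)))]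

/-- Convergence if the fallback is given up with summable penalties only. -/
theorem decrement_tendsto_zero_of_summable {ξ : ℕ → ExtState n m p d} {vbar : ℕ → DistWindow n p d}
    {y : ℕ → DecVec n m p d N} (hy : ∀ t, D.IsOptimal (ξ t) (vbar t) (y t).dec)
    (hs : ∀ t, D.IsFeasible (ξ (t + 1)) (vbar (t + 1)) (D.shift (y t)).dec) {K : ℝ}
    (hK : ∀ t, ∑ i ∈ Finset.range t, D.lam * (1 - (y i).2.2 ^ 2) ≤ K) :
    Tendsto (fun t => D.devCost 0 (devL (y t)) + 1 / 4 * D.gap y t) atTop (𝓝 0) ∧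
      ∀ t, (∑ k ∈ Finset.range N, D.devCost k (devL (y t))) ≤ D.cost (y 0).dec + K := by
  have h0 := (isPSDQuad_devCost (N := N) hD 0).nonneg
  have hstep : ∀ t, D.cost (y (t + 1)).dec + (D.devCost 0 (devL (y t)) + 1 / 4 * D.gap y t) ≤
      D.cost (y t).dec + D.lam * (1 - (y t).2.2 ^ 2) := fun t => by
    have h1 := IsOptimal.growth hD (hy (t + 1)) (hs t)
    have h2 := cost_shift_le hD (hy t).1
    rw [devL_shift] at h1
    have h3 : D.gap y t ≤ 2 * (D.cost (D.shift (y t)).dec - D.cost (y (t + 1)).dec) := h1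
    linarith [gap_nonneg hD y t]
  refine ⟨tendsto_zero_of_decrease (fun t => (isPSDQuad_cost hD).nonneg (y t)) (fun t => ?_) hK hstep,
    fun t => (sum_devCost_le_cost hD (y t)).trans ?_⟩
  · linarith [gap_nonneg hD y t, h0 (devL (y t))]
  · have h1 : D.cost (y t).dec ≤ D.cost (y 0).dec + ∑ i ∈ Finset.range t, D.lam * (1 - (y i).2.2 ^ 2) := by
      induction t with
      | zero => simp
      | succ t ih =>
        rw [Finset.sum_range_succ]
        linarith [hstep t, gap_nonneg hD y t, h0 (devL (y t))]
    linarith [hK t]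

/-- Admissible references whose disturbance states converge are close to admissible references with
the limiting disturbance state. -/
theorem exists_near_Za (hS : D.S.Nonempty) {ρ : ℕ → ExtState n m p d} (hρ : ∀ t, ρ t ∈ D.Za)
    {v : DistWindow n p d} (hv : Tendsto (fun t => D.Tv (ρ t)) atTop (𝓝 v)) :
    ∃ ζ : ℕ → ExtState n m p d, (∀ t, ζ t ∈ D.Za ∧ D.Tv (ζ t) = v) ∧
      Tendsto (fun t => ζ t - ρ t) atTop (𝓝 0) := by
  set C := D.Za ∩ D.TvL ⁻¹' Metric.closedBall v 1 with hC
  have hCc : IsCompact C := isCompact_Za_inter hD hS (isCompact_closedBall v 1)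
  have hK : IsCompact (D.Za ∩ D.TvL ⁻¹' {v}) := isCompact_Za_inter hD hS isCompact_singleton
  have hρC : ∀ᶠ t in atTop, ρ t ∈ C :=
    (hv.eventually (Metric.closedBall_mem_nhds v one_pos)).mono fun t ht => ⟨hρ t, ht⟩
  have hclus : ∀ a, a ∈ D.Za → MapClusterPt a atTop ρ → a ∈ D.Za ∩ D.TvL ⁻¹' {v} := fun a ha hcl => by
    refine ⟨ha, ?_⟩
    have h1 : MapClusterPt (D.TvL a) atTop (fun t => D.Tv (ρ t)) :=
      hcl.continuousAt_comp (continuous_linear D.TvL).continuousAt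
    exact eq_of_nhds_neBot (ClusterPt.mono h1 hv)
  have hne : (D.Za ∩ D.TvL ⁻¹' {v}).Nonempty := by
    obtain ⟨a, haC, ha⟩ := hCc.exists_mapClusterPt_of_frequently hρC.frequently
    exact ⟨a, hclus a haC.1 ha⟩
  have hdist : Tendsto (fun t => Metric.infDist (ρ t) (D.Za ∩ D.TvL ⁻¹' {v})) atTop (𝓝 0) := by
    rw [Metric.tendsto_atTop]
    by_contra! hcon
    obtain ⟨ε, hε, hcon⟩ := hcon
    have hfr : ∃ᶠ t in atTop, ρ t ∈ C ∩ {ξ | ε ≤ Metric.infDist ξ (D.Za ∩ D.TvL ⁻¹' {v})} := by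
      refine ((frequently_atTop.2 hcon).and_eventually hρC).mono fun t ht => ⟨ht.2, ?_⟩
      have h1 := ht.1
      rwa [Real.dist_eq, sub_zero, abs_of_nonneg Metric.infDist_nonneg] at h1
    obtain ⟨a, haC, ha⟩ := (hCc.inter_right (isClosed_le continuous_const
      (Metric.continuous_infDist_pt _))).exists_mapClusterPt_of_frequently hfr
    have h1 := Metric.infDist_zero_of_mem (hclus a haC.1.1 ha)
    have h2 : ε ≤ Metric.infDist a (D.Za ∩ D.TvL ⁻¹' {v}) := haC.2
    linarith
  choose ζ hζ hζd using fun t => hK.exists_infDist_eq_dist hne (ρ t)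
  refine ⟨ζ, fun t => hζ t, ?_⟩
  rw [tendsto_zero_iff_norm_tendsto_zero]
  refine hdist.congr fun t => ?_
  rw [hζd t, dist_comm, dist_eq_norm]

end

end Data

/-- Weights in `[0, 1]` whose product stays away from zero approach one summably: the decrease of the
product telescopes. -/
theorem sum_one_sub_sq_le {τ : ℕ → ℝ} (hτ : ∀ t, τ t ∈ Set.Icc (0 : ℝ) 1) {L : ℝ} (hL : 0 < L)
    (h : ∀ t, L ≤ ∏ i ∈ Finset.range t, τ i) (t : ℕ) : ∑ i ∈ Finset.range t, (1 - τ i ^ 2) ≤ 2 / L := by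
  have h1 : L * ∑ i ∈ Finset.range t, (1 - τ i ^ 2) ≤ 2 * (1 - ∏ i ∈ Finset.range t, τ i) := by
    induction t with
    | zero => simp
    | succ t ih =>
      rw [Finset.sum_range_succ, Finset.prod_range_succ]
      have h2 := h t
      obtain ⟨h3, h4⟩ := hτ t
      have h5 : L * (1 - τ t) ≤ (∏ i ∈ Finset.range t, τ i) * (1 - τ t) :=
        mul_le_mul_of_nonneg_right h2 (by linarith)
      nlinarith [mul_nonneg hL.le (mul_nonneg (sub_nonneg.2 h4) (sub_nonneg.2 h4))]
  rw [le_div_iff₀ hL]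
  linarith [h t]

theorem tendsto_prod_of_mem_Icc {τ : ℕ → ℝ} (hτ : ∀ t, τ t ∈ Set.Icc (0 : ℝ) 1) :
    ∃ L, 0 ≤ L ∧ (∀ t, L ≤ ∏ i ∈ Finset.range t, τ i) ∧
      Tendsto (fun t => ∏ i ∈ Finset.range t, τ i) atTop (𝓝 L) := by
  have h0 : ∀ t, 0 ≤ ∏ i ∈ Finset.range t, τ i := fun t => Finset.prod_nonneg fun i _ => (hτ i).1
  have hanti : Antitone fun t => ∏ i ∈ Finset.range t, τ i := antitone_nat_of_succ_le fun t => by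
    rw [Finset.prod_range_succ]
    exact mul_le_of_le_one_right (h0 t) (hτ t).2
  have hb : BddBelow (Set.range fun t => ∏ i ∈ Finset.range t, τ i) :=
    ⟨0, by rintro _ ⟨t, rfl⟩; exact h0 t⟩
  exact ⟨_, le_ciInf h0, fun t => ciInf_le hb t, tendsto_atTop_ciInf hanti hb⟩

namespace Data

variable {n m p d N : ℕ} [NeZero d] {D : Data n m p d N}

open DecVec

section

variable (hD : D.Standing)
include hD

/-! ### Convergence under persistent disturbances -/

/-- The mismatch between the fallback and the true disturbance state is contracted by the chosen
weights `τ`. -/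
theorem Tv_init_eq {ξ : ℕ → ExtState n m p d} {vbar : ℕ → DistWindow n p d}
    {y : ℕ → DecVec n m p d N} (hy : ∀ t, D.IsOptimal (ξ t) (vbar t) (y t).dec)
    (hgen : ∀ t, D.Tv (ξ (t + 1)) = genStep D.c (D.Tv (ξ t)))
    (hbar : ∀ t, vbar (t + 1) = genStep D.c (D.Tv (y t).1.1)) (t : ℕ) :
    D.Tv (ξ t) = (genStepL D.c ^ t) (D.Tv (ξ 0)) ∧
    vbar t = D.Tv (ξ t) + (∏ i ∈ Finset.range t, (y i).2.2) •
      (genStepL D.c ^ t) (vbar 0 - D.Tv (ξ 0)) ∧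
    D.Tv (y t).1.1 = D.Tv (ξ t) + (∏ i ∈ Finset.range (t + 1), (y i).2.2) •
      (genStepL D.c ^ t) (vbar 0 - D.Tv (ξ 0)) := by
  have hinit : ∀ t, D.Tv (y t).1.1 = (y t).2.2 • vbar t + (1 - (y t).2.2) • D.Tv (ξ t) :=
    fun t => (hy t).1.init_dist
  have h3 : ∀ t, vbar t = D.Tv (ξ t) + (∏ i ∈ Finset.range t, (y i).2.2) •
      (genStepL D.c ^ t) (vbar 0 - D.Tv (ξ 0)) → D.Tv (y t).1.1 = D.Tv (ξ t) +
      (∏ i ∈ Finset.range (t + 1), (y i).2.2) • (genStepL D.c ^ t) (vbar 0 - D.Tv (ξ 0)) := by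
    intro t h
    rw [hinit, h, Finset.prod_range_succ]; module
  induction t with
  | zero =>
    have h : vbar 0 = D.Tv (ξ 0) + (∏ i ∈ Finset.range 0, (y i).2.2) •
        (genStepL D.c ^ 0) (vbar 0 - D.Tv (ξ 0)) := by simp
    exact ⟨by simp, h, h3 0 h⟩
  | succ t ih =>
    have h1 : D.Tv (ξ (t + 1)) = (genStepL D.c ^ (t + 1)) (D.Tv (ξ 0)) := by
      rw [hgen, ih.1, pow_succ', Module.End.mul_apply]; rfl
    have h : vbar (t + 1) = D.Tv (ξ (t + 1)) + (∏ i ∈ Finset.range (t + 1), (y i).2.2) •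
        (genStepL D.c ^ (t + 1)) (vbar 0 - D.Tv (ξ 0)) := by
      rw [hbar, ih.2.2, hgen, ← genStepL_apply, ← genStepL_apply, map_add, map_smul, pow_succ',
        Module.End.mul_apply]
    exact ⟨h1, h, h3 _ h⟩

set_option maxHeartbeats 1000000 in
/-- Convergence if the fallback is abandoned asymptotically. The optimal cost, less the penalty on `τ`,
decreases up to vanishing errors; it is asymptotically bounded below by the optimal cost `b` of the
admissible references with the true disturbance state, and it is close to `b` whenever its
decrements have been small for `N` steps. -/
theorem dev_tendsto_zero_of_prod_tendsto_zero (hS : D.S.Nonempty) (hp : PersistentGenerator D.c d)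
    (hw : D.IncrementWeighted)
    {ξ : ℕ → ExtState n m p d} {vbar : ℕ → DistWindow n p d} {y : ℕ → DecVec n m p d N}
    (hy : ∀ t, D.IsOptimal (ξ t) (vbar t) (y t).dec)
    (hξ : ∀ t, ξ (t + 1) = D.tubeStep (ξ t) (y t) 0)
    (hgen : ∀ t, D.Tv (ξ (t + 1)) = genStep D.c (D.Tv (ξ t)))
    (hbar : ∀ t, vbar (t + 1) = genStep D.c (D.Tv (y t).1.1)) {M : ℝ} (hM : ∀ t, ‖ξ t‖ ≤ M)
    (hP : Tendsto (fun t => ∏ i ∈ Finset.range t, (y i).2.2) atTop (𝓝 0)) :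
    Tendsto (fun t => devL (y t)) atTop (𝓝 0) ∧ Tendsto (D.gap y) atTop (𝓝 0) := by
  have hc := hD.c_zero
  have hcd := hD.c_last
  have hTv := Tv_init_eq hD hy hgen hbar
  set d₀ := D.Tv (ξ 0)
  set Δ₀ := vbar 0 - d₀
  set P : ℕ → ℝ := fun t => ∏ i ∈ Finset.range t, (y i).2.2 with hPdef
  have hτ : ∀ t, (y t).2.2 ∈ Set.Icc (0 : ℝ) 1 := fun t => (hy t).1.tau_mem
  have hP0 : ∀ t, 0 ≤ P t := fun t => Finset.prod_nonneg fun i _ => (hτ i).1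
  have hP1 : ∀ t, P t ≤ 1 := fun t => Finset.prod_le_one (fun i _ => (hτ i).1) fun i _ => (hτ i).2
  have hPs : Tendsto (fun t => P (t + 1)) atTop (𝓝 0) := (tendsto_add_atTop_iff_nat 1).2 hP
  have hfe : ∀ t, D.IsFeasible (ξ t) (vbar t) (y t).dec := fun t => (hy t).1
  have hya : ∀ t, (y t).2.1 ∈ D.Za := fun t => (hfe t).art_mem
  have hTa : ∀ t, D.Tv (y t).1.1 = D.Tv (y t).2.1 := fun t => IsFeasible.Tv_eq hD (hfe t)
  obtain ⟨Kg, hKg, hg⟩ := genStep_iterate_bounded (E := Dist n p) hc hcd hD.stable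
  have hgΔ : ∀ t, ‖(genStepL D.c ^ t) Δ₀‖ ≤ Kg * ‖Δ₀‖ := fun t => by rw [← genStep_iterate]; exact hg t _
  have hgd : ∀ t, ‖D.Tv (ξ t)‖ ≤ Kg * ‖d₀‖ := fun t => by rw [(hTv t).1, ← genStep_iterate]; exact hg t _
  have hΔn : ∀ t, ‖P t • (genStepL D.c ^ t) Δ₀‖ ≤ Kg * ‖Δ₀‖ := fun t => by
    rw [norm_smul, Real.norm_eq_abs, abs_of_nonneg (hP0 t)]
    exact (mul_le_of_le_one_left (norm_nonneg _) (hP1 t)).trans (hgΔ t)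
  have hΔn' : ∀ t, ‖P (t + 1) • (genStepL D.c ^ t) Δ₀‖ ≤ P (t + 1) * (Kg * ‖Δ₀‖) := fun t => by
    rw [norm_smul, Real.norm_eq_abs, abs_of_nonneg (hP0 _)]
    exact mul_le_mul_of_nonneg_left (hgΔ t) (hP0 _)
  have hΔ0 : Tendsto (fun t => P (t + 1) * (Kg * ‖Δ₀‖)) atTop (𝓝 0) := by
    simpa using hPs.mul_const (Kg * ‖Δ₀‖)
  -- bounds
  obtain ⟨B, hB⟩ := exists_norm_feasible_le (N := N) hD hS (max M (Kg * ‖d₀‖ + Kg * ‖Δ₀‖))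
  have hyB : ∀ t, ‖y t‖ ≤ B := fun t => by
    refine hB _ _ _ ((hM t).trans (le_max_left _ _)) (le_max_of_le_right ?_) (hfe t)
    rw [(hTv t).2.1]
    exact (norm_add_le _ _).trans (add_le_add (hgd t) (hΔn t))
  have hB0 : 0 ≤ B := (norm_nonneg _).trans (hyB 0)
  obtain ⟨Kd, hKd, hdev⟩ := exists_norm_map_le (devL (n := n) (m := m) (p := p) (d := d) (N := N))
  have hdevB : ∀ t, ‖devL (y t)‖ ≤ Kd * B := fun t => (hdev _).trans (by gcongr; exact hyB t)
  have hQ := IsPSDQuad.sum (Finset.range N) fun k => isPSDQuad_devCost (N := N) hD k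
  have hV := isPSDQuad_Vcost_eWin hD
  obtain ⟨KQ, hKQ, hQb⟩ := hQ.exists_le_norm_sq
  obtain ⟨KV, hKV, hVb⟩ := hV.exists_le_norm_sq
  have hQM : ∀ t, (∑ k ∈ Finset.range N, D.devCost k (devL (y t))) ≤ KQ * (Kd * B) ^ 2 := fun t =>
    (hQb _).trans (by gcongr; exact hdevB t)
  have hVM : ∀ t, D.Vcost (y t).2.1.eWin ≤ KV * B ^ 2 := fun t =>
    (hVb _).trans (by gcongr; exact (norm_fst_le (y t).2).trans ((norm_snd_le (y t)).trans (hyB t)))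
  have hq0 := (isPSDQuad_devCost (N := N) hD 0).nonneg
  -- admissible references with the true disturbance state, close to the artificial ones
  choose ρ hρ hρf using fun t => exists_free_eq_of_Za hD hp (hya t) t
  have hTρ : ∀ t, D.Tv (ρ t) = d₀ + P (t + 1) • Δ₀ := fun t => by
    have h1 : D.Tv (D.free t (ρ t)) = (genStepL D.c ^ t) (d₀ + P (t + 1) • Δ₀) := by
      rw [hρf, ← hTa, (hTv t).2.2, map_add, map_smul, ← (hTv t).1]
    rw [Tv_free hc hcd, genStep_iterate] at h1
    refine sub_eq_zero.1 (genStep_iterate_injective (t := t) hcd ?_)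
    rw [genStep_iterate, map_sub, sub_eq_zero]; exact h1
  obtain ⟨ζ₀, hζ₀, hζ₀ρ⟩ := exists_near_Za hD hS hρ (v := d₀) (by
    simp only [hTρ]
    simpa using (hPs.smul_const Δ₀).const_add d₀)
  obtain ⟨Kf, hKf, hf⟩ := exists_norm_free_le hD
  set ζh : ℕ → ExtState n m p d := fun t => D.free t (ζ₀ t) with hζh
  have hζhZ : ∀ t, ζh t ∈ D.Za := fun t => free_mem_Za (hζ₀ t).1 t
  have hζhT : ∀ t, D.Tv (ζh t) = D.Tv (ξ t) := fun t => by
    rw [hζh]; dsimp only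
    rw [Tv_free hc hcd, (hζ₀ t).2, (hTv t).1, genStep_iterate]
  have hζhn : Tendsto (fun t => ζh t - (y t).2.1) atTop (𝓝 0) := by
    refine squeeze_zero_norm (fun t => ?_) (by simpa using hζ₀ρ.norm.const_mul Kf)
    have h1 : ζh t - (y t).2.1 = D.free t (ζ₀ t - ρ t) := by
      rw [free_eq, map_sub, ← free_eq, ← free_eq, hρf]
    have h2 : (ζ₀ t - ρ t).dx = 0 := by
      have : (ζ₀ t - ρ t).dx = (ζ₀ t).dx - (ρ t).dx := rfl
      rw [this, Za_dx (hζ₀ t).1, Za_dx (hρ t), sub_self]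
    rw [h1]; exact hf t _ h2
  set ζs : ℕ → ExtState n m p d := fun t => D.step (ζh t) 0 with hζs
  have hζsZ : ∀ t, ζs t ∈ D.Za := fun t => step_mem_Za (hζhZ t)
  have hζsT : ∀ t, D.Tv (ζs t) = D.Tv (ξ (t + 1)) := fun t => by
    rw [hζs]; dsimp only
    rw [Tv_step hc hcd, hζhT, hgen]
  have hζsn : Tendsto (fun t => ζs t - D.step (y t).2.1 0) atTop (𝓝 0) := by
    have h1 := tendsto_linear_zero D.stepL hζhn
    refine h1.congr fun t => ?_
    rw [map_sub]; rfl
  -- the optimal references with the true disturbance state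
  choose ζo hζo hζomin using fun t => exists_opt_ref hD hS ⟨ζh t, hζhZ t, hζhT t⟩
  set b : ℕ → ℝ := fun t => D.Vcost (ζo t).eWin with hb
  have hbanti : ∀ t, b (t + 1) ≤ b t := fun t =>
    (hζomin (t + 1) _ (step_mem_Za (hζo t).1) (by rw [Tv_step hc hcd, (hζo t).2, hgen])).trans
      (Vcost_step_le hD (hζo t).1)
  have hbd : Tendsto (fun t => b t - b (t + 1)) atTop (𝓝 0) := by
    have h1 := tendsto_atTop_ciInf (antitone_nat_of_succ_le hbanti)
      ⟨0, by rintro _ ⟨t, rfl⟩; exact (isPSDQuad_Vcost hD).nonneg _⟩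
    simpa using h1.sub ((tendsto_add_atTop_iff_nat 1).2 h1)
  -- candidates for the next problem
  have hcand : ∀ ε > 0, ∀ᶠ t in atTop, ∃ z : DecVec n m p d N,
      ((∀ vbar', D.IsFeasible (ξ (t + 1)) vbar' z.dec) ∧ z.2 = (ζs t, 0)) ∧
        ‖devL z - D.shiftL (devL (y t))‖ ≤ ε := by
    intro ε hε
    obtain ⟨δ, hδ, h⟩ := exists_perturbed_candidate (N := N) hD hS hp (Kd * B) hε
    filter_upwards [hζsn.eventually (Metric.closedBall_mem_nhds 0 hδ), hΔ0.eventually (ge_mem_nhds hδ)]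
      with t h1 h2
    have h3 : D.Tv (ξ t - (y t).1.1) = -(P (t + 1) • (genStepL D.c ^ t) Δ₀) := by
      rw [Tv_sub, (hTv t).2.2]; abel
    obtain ⟨z, hz1, hz2, hz3⟩ := h (ξ t) (vbar t) (y t) (ζs t) (hfe t) (hdevB t)
      (by rw [h3, norm_neg]; exact (hΔn' t).trans h2) (hζsZ t) (mem_closedBall_zero_iff.1 h1)
      (by rw [← hξ, hζsT]) (by rw [← hξ, hgen])
    rw [← hξ] at hz1
    exact ⟨z, ⟨hz1, hz2⟩, hz3⟩
  obtain ⟨z, hz, hzn⟩ := exists_seq_tendsto_zero (fun _ _ => norm_nonneg _) hcand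
  have hzd := tendsto_zero_iff_norm_tendsto_zero.2 hzn
  -- the decrease
  set φ : ℕ → ℝ := fun t => (∑ k ∈ Finset.range N, D.devCost k (devL (y t))) + D.Vcost (y t).2.1.eWin with hφ
  set a : ℕ → ℝ := fun t => D.devCost 0 (devL (y t)) + 1 / 4 * D.gap y t with ha
  have ha0 : ∀ t, 0 ≤ a t := fun t => by
    have := gap_nonneg hD y t
    have := hq0 (devL (y t))
    rw [ha]; positivity
  have hshift : ∀ t, (∑ k ∈ Finset.range N, D.devCost k (D.shiftL (devL (y t)))) + D.devCost 0 (devL (y t)) =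
      ∑ k ∈ Finset.range N, D.devCost k (devL (y t)) := fun t =>
    sum_devCost_shiftL hD (IsFeasible.trajL_devL_eq_zero hD (hfe t))
  have e1 := hQ.tendsto_map_sub (M := KQ * (Kd * B) ^ 2) (x := fun t => D.shiftL (devL (y t))) (y := fun t => devL (z t))
    (Eventually.of_forall fun t => by linarith [hshift t, hQM t, hq0 (devL (y t))]) (hQ.tendsto_zero hzd)
  have e2 := hV.tendsto_map_sub (M := KV * B ^ 2) (x := fun t => D.step (y t).2.1 0) (y := ζs)
    (Eventually.of_forall fun t => (Vcost_step_le hD (hya t)).trans (hVM t)) (hV.tendsto_zero hζsn)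
  have e3 := hQ.tendsto_zero hzd
  have e4 := hV.tendsto_zero hζsn
  have hκ := ((e1.add e2).add (e3.const_mul (1 / 2))).add (e4.const_mul (1 / 2))
  simp only [mul_zero, add_zero] at hκ
  have hstep : ∀ᶠ t in atTop, φ (t + 1) + a t - φ t ≤
      ((∑ k ∈ Finset.range N, D.devCost k (devL (z t))) -
        ∑ k ∈ Finset.range N, D.devCost k (D.shiftL (devL (y t)))) +
      (D.Vcost (ζs t).eWin - D.Vcost (D.step (y t).2.1 0).eWin) +
      1 / 2 * (∑ k ∈ Finset.range N, D.devCost k (devL (z t) - D.shiftL (devL (y t)))) +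
      1 / 2 * D.Vcost (ζs t - D.step (y t).2.1 0).eWin := by
    filter_upwards [hz] with t ht
    have h1 := IsOptimal.growth hD (hy (t + 1)) (ht.1 (vbar (t + 1)))
    have hzt : (z t).2.1 = ζs t := by rw [ht.2]
    have hzt' : (z t).2.2 = 0 := by rw [ht.2]
    have h2 := hQ.map_add_le (D.shiftL (devL (y t)) - devL (z t)) (devL (z t) - devL (y (t + 1)))
    rw [sub_add_sub_cancel] at h2
    have h2' := hQ.map_sub_comm (D.shiftL (devL (y t))) (devL (z t))
    have h3 := hV.map_add_le (D.step (y t).2.1 0 - ζs t) (ζs t - (y (t + 1)).2.1)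
    rw [sub_add_sub_cancel] at h3
    have h3' := hV.map_sub_comm (D.step (y t).2.1 0) (ζs t)
    rw [hzt, cost_dec, cost_dec, hzt, hzt'] at h1
    have h4 := mul_nonneg hD.lam_nonneg (sq_nonneg (y (t + 1)).2.2)
    have h5 := Vcost_step_le hD (hya t)
    have h6 := hshift t
    have h7 : D.lam * (0 : ℝ) ^ 2 = 0 := by norm_num
    have h8 : D.gap y t = (∑ k ∈ Finset.range N, D.devCost k (D.shiftL (devL (y t)) - devL (y (t + 1)))) +
      D.Vcost (D.step (y t).2.1 0 - (y (t + 1)).2.1).eWin := rfl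
    rw [h7] at h1
    simp only [hφ, ha]
    linarith only [h1, h2, h2', h3, h3', h4, h5, h6, h8]
  -- the deviation vanishes wherever the decrements do
  have hdevl : ∀ l : Filter ℕ, (∀ i < N, Tendsto (fun t => a (t + i)) l (𝓝 0)) →
      Tendsto (fun t => devL (y t)) l (𝓝 0) := fun l hl =>
    dev_tendsto_zero_of_decrement hD hw hy hQM hl
  have hx : Tendsto (fun t => φ t - b t) atTop (𝓝 0) := by
    refine tendsto_zero_of_block_decrease (a := a) (k := N)
      (κ := fun t => max 0 (φ (t + 1) + a t - φ t) + (b t - b (t + 1))) ha0 ?_ (fun t => ?_) ?_ ?_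
    · have h1 : Tendsto (fun t => max 0 (φ (t + 1) + a t - φ t)) atTop (𝓝 0) := by
        refine squeeze_zero' (Eventually.of_forall fun t => le_max_left _ _)
          (hstep.mono fun t ht => max_le_max le_rfl ht) ?_
        simpa using (tendsto_const_nhds (x := (0 : ℝ))).max hκ
      simpa using h1.add hbd
    · linarith [le_max_right 0 (φ (t + 1) + a t - φ t)]
    · intro ε hε
      have h1 := hV.tendsto_map_sub (M := KV * B ^ 2) (x := fun t => (y t).2.1) (y := ζh)
        (Eventually.of_forall hVM) (hV.tendsto_zero hζhn)
      filter_upwards [h1.eventually (ge_mem_nhds hε)] with t ht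
      have h2 := hζomin t _ (hζhZ t) (hζhT t)
      have h3 := hQ.nonneg (devL (y t))
      simp only [hφ, hb]
      linarith
    · intro ε hε
      refine exists_delta_of_filter ha0 fun l hl hal => ?_
      have h1 := hdevl l hal
      obtain ⟨δ, hδ, h⟩ := exists_forall_Vcost_le (N := N) hD hS hp (Kg * ‖Δ₀‖) (half_pos hε)
      have h2 : Tendsto (fun t => (y t).1.1 - (y t).2.1) l (𝓝 0) :=
        (continuous_fst.tendsto (0 : ExtState n m p d × (Fin N → Fin m → ℝ))).comp h1
      filter_upwards [h2.eventually (Metric.closedBall_mem_nhds 0 hδ),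
        (hQ.tendsto_zero h1).eventually (ge_mem_nhds (half_pos hε))] with t h3 h4
      have h5 : D.Tv (ζo t) - D.Tv (y t).2.1 = -(P (t + 1) • (genStepL D.c ^ t) Δ₀) := by
        rw [(hζo t).2, ← hTa, (hTv t).2.2]; abel
      have h6 := h (ξ t) (vbar t) (y t) (ζo t) (hy t) (hζo t).1
        (by rw [h5, norm_neg]
            exact (hΔn' t).trans (mul_le_of_le_one_left (by positivity) (hP1 _)))
        (mem_closedBall_zero_iff.1 h3) fun s hs0 hs1 => ⟨(1 - s) * (y t).2.2,
          mul_nonneg (by linarith) (hτ t).1, mul_le_of_le_one_left (hτ t).1 (by linarith), by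
          rw [h5, (hTv t).2.2, (hTv t).2.1, Finset.prod_range_succ]
          simp only [hPdef, Finset.prod_range_succ]
          module⟩
      simp only [hφ, hb]
      linarith
  have hxs : Tendsto (fun t => φ (t + 1) - b (t + 1)) atTop (𝓝 0) := (tendsto_add_atTop_iff_nat 1).2 hx
  have hat : Tendsto a atTop (𝓝 0) := by
    have h1 := ((hx.sub hxs).add hbd).add hκ
    simp only [sub_zero, add_zero] at h1
    refine squeeze_zero' (Eventually.of_forall ha0) (hstep.mono fun t ht => ?_) h1
    linarith only [ht]
  refine ⟨hdevl atTop fun i _ => (tendsto_add_atTop_iff_nat i).2 hat, ?_⟩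
  refine squeeze_zero (gap_nonneg hD y) (fun t => ?_) (by simpa using hat.const_mul 4)
  simp only [ha]
  linarith [hq0 (devL (y t))]

/-- Convergence under disturbances that follow the signal generator. -/
theorem dev_tendsto_zero_of_nominal (hS : D.S.Nonempty) (hp : PersistentGenerator D.c d)
    (hw : D.IncrementWeighted)
    {ξ : ℕ → ExtState n m p d} {vbar : ℕ → DistWindow n p d} {y : ℕ → DecVec n m p d N}
    (hy : ∀ t, D.IsOptimal (ξ t) (vbar t) (y t).dec)
    (hs : ∀ t, D.IsFeasible (ξ (t + 1)) (vbar (t + 1)) (D.shift (y t)).dec)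
    (hξ : ∀ t, ξ (t + 1) = D.tubeStep (ξ t) (y t) 0)
    (hgen : ∀ t, D.Tv (ξ (t + 1)) = genStep D.c (D.Tv (ξ t)))
    (hbar : ∀ t, vbar (t + 1) = genStep D.c (D.Tv (y t).1.1)) {M : ℝ} (hM : ∀ t, ‖ξ t‖ ≤ M) :
    Tendsto (fun t => devL (y t)) atTop (𝓝 0) ∧ Tendsto (D.gap y) atTop (𝓝 0) := by
  obtain ⟨L, hL0, hL, hPL⟩ := tendsto_prod_of_mem_Icc (τ := fun t => (y t).2.2) fun t => (hy t).1.tau_mem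
  rcases hL0.eq_or_lt with rfl | hLpos
  · exact dev_tendsto_zero_of_prod_tendsto_zero hD hS hp hw hy hξ hgen hbar hM hPL
  · have hK : ∀ t, ∑ i ∈ Finset.range t, D.lam * (1 - (y i).2.2 ^ 2) ≤ D.lam * (2 / L) := fun t => by
      rw [← Finset.mul_sum]
      exact mul_le_mul_of_nonneg_left
        (sum_one_sub_sq_le (fun t => (hy t).1.tau_mem) hLpos hL t) hD.lam_nonneg
    obtain ⟨h1, h2⟩ := decrement_tendsto_zero_of_summable hD hy hs hK
    refine ⟨dev_tendsto_zero_of_decrement hD hw hy h2 fun i _ => (tendsto_add_atTop_iff_nat i).2 h1, ?_⟩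
    refine squeeze_zero (gap_nonneg hD y) (fun t => ?_) (by simpa using h1.const_mul 4)
    linarith [(isPSDQuad_devCost (N := N) hD 0).nonneg (devL (y t))]

/-- The output of the plant approaches that of the prediction: the tube error follows the stabilized
loop, driven by the vanishing distance between successive shifted optimizers. -/
theorem eWin_sub_tendsto_zero {ξ : ℕ → ExtState n m p d} {y : ℕ → DecVec n m p d N}
    (hya : ∀ t, (y t).2.1 ∈ D.Za)
    (hξ : ∀ t, ξ (t + 1) = D.tubeStep (ξ t) (y t) 0)
    (hdev : Tendsto (fun t => devL (y t)) atTop (𝓝 0)) (hgap : Tendsto (D.gap y) atTop (𝓝 0)) :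
    Tendsto (fun t => (ξ t - (y t).1.1).eWin) atTop (𝓝 0) := by
  let pr : ExtState n m p d →ₗ[ℝ] (Fin n → ℝ) × (Fin d → Fin p → ℝ) := ExtState.dxL.prod ExtState.eWinL
  let ι : (Fin n → ℝ) × (Fin d → Fin p → ℝ) →ₗ[ℝ] ExtState n m p d :=
    { toFun := fun v => (v.1, v.2, 0, 0)
      map_add' := fun v v' => ExtState.ext' rfl rfl (add_zero _).symm (add_zero _).symm
      map_smul' := fun r v => ExtState.ext' rfl rfl (smul_zero _).symm (smul_zero _).symm }
  let Ψ := pr ∘ₗ D.loopL ∘ₗ ι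
  have hΨ : ∀ ζ, pr (D.loopL ζ) = Ψ (pr ζ) := fun ζ => rfl
  have hΨt : ∀ (t : ℕ) ζ, pr ((D.loopL ^ t) ζ) = (Ψ ^ t) (pr ζ) := by
    intro t
    induction t with
    | zero => intro ζ; rfl
    | succ t ih => intro ζ; rw [pow_succ, pow_succ, Module.End.mul_apply, Module.End.mul_apply, ih, hΨ]
  have hstab : ∀ v, Tendsto (fun t : ℕ => (Ψ ^ t) v) atTop (𝓝 0) := fun v => by
    obtain ⟨h1, h2⟩ := hD.stabilizing (ι v)
    simp only [loopL_iterate] at h1 h2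
    have h3 := h1.prodMk_nhds h2
    have h4 : ∀ t : ℕ, (Ψ ^ t) v = (((D.loopL ^ t) (ι v)).dx, ((D.loopL ^ t) (ι v)).eWin) := fun t =>
      (hΨt t (ι v)).symm
    simp only [h4]
    exact h3
  set r : ℕ → ExtState n m p d := fun t => (D.shiftL (y t).1).1 - (y (t + 1)).1.1 with hr
  have hrec : ∀ t, ξ (t + 1) - (y (t + 1)).1.1 = D.loopL (ξ t - (y t).1.1) + r t := fun t => by
    have h1 := tubeStep_sub (D := D) (ξ t) (y t) 0
    rw [← hξ] at h1
    have h2 : D.loopL (ξ t - (y t).1.1) = ξ (t + 1) - (D.shiftL (y t).1).1 := h1.symm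
    rw [h2, hr]; dsimp only; abel
  have hr0 : Tendsto (fun t => pr (r t)) atTop (𝓝 0) := by
    have e1 : ∀ t, r t = (D.shiftL (devL (y t))).1 - (devL (y (t + 1))).1 +
        (D.step (y t).2.1 0 - (y (t + 1)).2.1) := fun t => by
      have h1 : (D.shiftL (devL (y t))).1 = (D.shiftL (y t).1).1 - D.step (y t).2.1 0 := by
        rw [← devL_shift]; rfl
      rw [h1, hr, devL_apply]; dsimp only; abel
    have h1 : Tendsto (fun t => (D.shiftL (devL (y t))).1 - (devL (y (t + 1))).1) atTop (𝓝 0) := by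
      have h2 := tendsto_linear_zero D.shiftL hdev
      have h3 := (tendsto_add_atTop_iff_nat 1).2 hdev
      have h4 := (continuous_fst.tendsto (0 : ExtState n m p d × (Fin N → Fin m → ℝ))).comp (h2)
      have h5 := (continuous_fst.tendsto (0 : ExtState n m p d × (Fin N → Fin m → ℝ))).comp (h3)
      simpa [Function.comp_def] using h4.sub h5
    have h2 : Tendsto (fun t => (D.step (y t).2.1 0 - (y (t + 1)).2.1).eWin) atTop (𝓝 0) := by
      refine (isPSDQuad_Vcost hD).tendsto_of_tendsto_zero (fun e he => eq_zero_of_Vcost hD he) ?_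
      exact squeeze_zero (fun t => (isPSDQuad_Vcost hD).nonneg _)
        (fun t => le_add_of_nonneg_left (sum_devCost_nonneg hD _ _)) hgap
    have h3 : ∀ t, (D.step (y t).2.1 0 - (y (t + 1)).2.1).dx = 0 := fun t => by
      have : (D.step (y t).2.1 0 - (y (t + 1)).2.1).dx = (D.step (y t).2.1 0).dx - (y (t + 1)).2.1.dx := rfl
      rw [this, Za_dx (step_mem_Za (hya t)), Za_dx (hya _), sub_self]
    have h4 : Tendsto (fun t => pr (D.step (y t).2.1 0 - (y (t + 1)).2.1)) atTop (𝓝 0) := by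
      have h5 : ∀ t, pr (D.step (y t).2.1 0 - (y (t + 1)).2.1) =
          (0, (D.step (y t).2.1 0 - (y (t + 1)).2.1).eWin) := fun t => Prod.ext (h3 t) rfl
      simp only [h5]
      exact (tendsto_const_nhds (x := (0 : Fin n → ℝ))).prodMk_nhds h2
    have h5 := (tendsto_linear_zero pr h1).add h4
    rw [add_zero] at h5
    refine h5.congr fun t => ?_
    rw [e1, map_add]
  have hfin := tendsto_zero_of_stable_input Ψ hstab (y := fun t => pr (ξ t - (y t).1.1)) (fun t => by
    rw [hrec, map_add, hΨ]) hr0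
  exact (continuous_snd.tendsto (0 : (Fin n → ℝ) × (Fin d → Fin p → ℝ))).comp hfin

end

end Data

namespace Run

open Data DecVec

variable {n m p d N : ℕ} [NeZero d] {D : Data n m p d N} {r : Run n m p d N} {t₀ : ℕ} {Δv : Dist n p}

/-! ### Runs of the controlled plant -/

theorem xOld_ext (hcd : D.c d ≠ 0) (t : ℤ) (i : Fin d) : D.xOld (r.ext D t) i = r.x (t - 1 - (i : ℕ)) := by
  rw [xOld]
  split
  · rename_i h
    show r.x (t - ((i : ℕ) + 1 : ℕ)) = _
    congr 1; push_cast; ring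
  · have hi : (i : ℕ) + 1 = d := by omega
    have h1 : (r.ext D t).dx = ∑ j : Fin d, D.c j • r.x (t - (j : ℕ)) + D.c d • r.x (t - d) := by
      show delayFilter D.c d r.x t = _
      rw [delayFilter, Finset.sum_range_succ, Finset.sum_range]
    have h2 : ∀ j : Fin d, (r.ext D t).xWin j = r.x (t - (j : ℕ)) := fun j => rfl
    simp only [h1, h2, add_sub_cancel_left]
    rw [inv_smul_smul₀ hcd]
    congr 1
    have : (d : ℤ) = (i : ℕ) + 1 := by exact_mod_cast hi.symm
    rw [this]; ring

section

variable (hD : D.Standing) (h : r.IsClosedLoop D t₀ Δv)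
include hD h

/-- `T_v` recovers the total disturbance from the measured extended state. -/
theorem Tv_ext (t : ℕ) : D.Tv (r.ext D t) =
    fun i : Fin d => r.v ((t : ℤ) - 1 - (i : ℕ)) + r.w ((t : ℤ) - 1 - (i : ℕ)) := by
  funext i
  have hi := i.2
  have h1 := h.dynamics ((t : ℤ) - 1 - (i : ℕ)) (by omega)
  have h2 := h.output ((t : ℤ) - (i : ℕ)) (by omega)
  have e1 : (t : ℤ) - 1 - (i : ℕ) + 1 = t - (i : ℕ) := by ring
  rw [e1] at h1
  rw [Tv, xOld_ext hD.c_last]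
  refine Prod.ext ?_ ?_
  · show r.x (t - (i : ℕ)) - D.A *ᵥ r.x (t - 1 - (i : ℕ)) - D.B *ᵥ r.u (t - 1 - (i : ℕ)) =
      r.vx (t - 1 - (i : ℕ)) + r.wx (t - 1 - (i : ℕ))
    rw [h1]; abel
  · show r.e (t - (i : ℕ)) - D.C *ᵥ r.x (t - (i : ℕ)) =
      r.ve (t - 1 - (i : ℕ) + 1) + r.we (t - 1 - (i : ℕ) + 1)
    rw [h2, e1]; abel

/-- The increments of the plant state and of the output obey the prediction model. -/
theorem ext_succ (t : ℕ) : r.ext D (t + 1) = D.predStep (r.ext D t) (delayFilter D.c d r.u t)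
    (delayFilter D.c d (fun s => r.v s + r.w s) t).1 (delayFilter D.c d (fun s => r.v s + r.w s) t).2 := by
  have hc := hD.c_zero
  have hfst : (delayFilter D.c d (fun s => r.v s + r.w s) t).1 =
      delayFilter D.c d (fun s => r.vx s + r.wx s) t :=
    (delayFilter_map (LinearMap.fst ℝ (Fin n → ℝ) (Fin p → ℝ)) (fun s => r.v s + r.w s) t).symm
  have hsnd : (delayFilter D.c d (fun s => r.v s + r.w s) t).2 =
      delayFilter D.c d (fun s => r.ve (s + 1) + r.we (s + 1)) t :=
    (delayFilter_map (LinearMap.snd ℝ (Fin n → ℝ) (Fin p → ℝ)) (fun s => r.v s + r.w s) t).symm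
  have hdx : delayFilter D.c d r.x ((t : ℤ) + 1) = D.A *ᵥ delayFilter D.c d r.x t +
      D.B *ᵥ delayFilter D.c d r.u t + delayFilter D.c d (fun s => r.vx s + r.wx s) t := by
    have e1 := delayFilter_map (c := D.c) (d := d) D.A.mulVecLin r.x t
    have e2 := delayFilter_map (c := D.c) (d := d) D.B.mulVecLin r.u t
    simp only [Matrix.mulVecLin_apply] at e1 e2
    rw [← e1, ← e2, ← delayFilter_add, ← delayFilter_add]
    refine Finset.sum_congr rfl fun i hi => ?_
    have hi' := Finset.mem_range.1 hi
    have h1 := h.dynamics ((t : ℤ) - (i : ℕ)) (by omega)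
    rw [show (t : ℤ) + 1 - (i : ℕ) = t - (i : ℕ) + 1 by ring, h1]
    dsimp only
    module
  have hde : delayFilter D.c d r.e ((t : ℤ) + 1) = D.C *ᵥ delayFilter D.c d r.x ((t : ℤ) + 1) +
      delayFilter D.c d (fun s => r.ve (s + 1) + r.we (s + 1)) t := by
    have e1 := delayFilter_map (c := D.c) (d := d) D.C.mulVecLin r.x ((t : ℤ) + 1)
    simp only [Matrix.mulVecLin_apply] at e1
    rw [← e1, delayFilter, delayFilter, delayFilter, ← Finset.sum_add_distrib]
    refine Finset.sum_congr rfl fun i hi => ?_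
    have hi' := Finset.mem_range.1 hi
    have h1 := h.output ((t : ℤ) + 1 - (i : ℕ)) (by omega)
    rw [h1, show (t : ℤ) - (i : ℕ) + 1 = t + 1 - (i : ℕ) by ring, ← smul_add]
    congr 1; abel
  have hpush : ∀ {E : Type} [AddCommGroup E] [Module ℝ E] (s : ℤ → E) (k : ℤ),
      (fun i : Fin d => s (k - (i : ℕ))) =
        push (delayFilter D.c d s k + genNext D.c (fun i : Fin d => s (k - 1 - (i : ℕ))))
          (fun i : Fin d => s (k - 1 - (i : ℕ))) := fun s k => by
    rw [window_succ s k, delayFilter_eq hc, sub_add_cancel]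
  have e0 : (t : ℤ) + 1 - 1 = t := by ring
  rw [hfst, hsnd]
  refine ExtState.ext' hdx ?_ ?_ ?_
  · show (fun i : Fin d => r.e ((t : ℤ) + 1 - (i : ℕ))) = push (D.C *ᵥ (D.A *ᵥ delayFilter D.c d r.x t +
      D.B *ᵥ delayFilter D.c d r.u t + delayFilter D.c d (fun s => r.vx s + r.wx s) t) +
      genNext D.c (fun i : Fin d => r.e (t - (i : ℕ))) + _) (fun i : Fin d => r.e (t - (i : ℕ)))
    rw [hpush r.e ((t : ℤ) + 1), hde, e0, hdx]
    congr 1; abel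
  · show (fun i : Fin d => r.x ((t : ℤ) + 1 - (i : ℕ))) = push (D.A *ᵥ delayFilter D.c d r.x t +
      D.B *ᵥ delayFilter D.c d r.u t + delayFilter D.c d (fun s => r.vx s + r.wx s) t +
      genNext D.c (fun i : Fin d => r.x (t - (i : ℕ)))) (fun i : Fin d => r.x (t - (i : ℕ)))
    rw [hpush r.x ((t : ℤ) + 1), hdx, e0]
  · show (fun i : Fin d => r.u ((t : ℤ) + 1 - 1 - (i : ℕ))) =
      push (genNext D.c (fun i : Fin d => r.u (t - 1 - (i : ℕ))) + delayFilter D.c d r.u t)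
        (fun i : Fin d => r.u (t - 1 - (i : ℕ)))
    rw [e0, hpush r.u t, add_comm]

/-- Under the control law, the plant performs a step of the tube controller. -/
theorem ext_succ_eq_tubeStep {t : ℕ}
    (hu : r.u t = D.predInput (r.sol t) 0 + D.K (r.ext D t - (r.sol t).ξ0)) :
    r.ext D (t + 1) = D.tubeStep (r.ext D t) (ofDec (r.sol t))
      (delayFilter D.c d (fun s => r.v s + r.w s) t) := by
  rw [ext_succ hD h, tubeStep]
  congr 1
  rw [delayFilter_eq hD.c_zero, hu]
  have h1 : D.predInput (r.sol t) 0 = pad (r.sol t).du 0 + genNext D.c (r.sol t).ξ0.uWin := rfl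
  have h2 : D.K (r.ext D t - (r.sol t).ξ0) = D.dK (r.ext D t - (r.sol t).ξ0) +
    genNext D.c ((r.ext D t).uWin - (r.sol t).ξ0.uWin) := rfl
  have h3 : (fun i : Fin d => r.u ((t : ℤ) - 1 - (i : ℕ))) = (r.ext D t).uWin := rfl
  have h4 : (ofDec (r.sol t)).1 = ((r.sol t).ξ0, (r.sol t).du) := rfl
  rw [h1, h2, h3, h4]
  simp only [← genNextL_apply, map_sub]
  abel

/-- The window of `v` follows the generator, except for the jump, which enters at the head. -/
theorem vWin_succ (t : ℕ) : r.vWin (t + 1) =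
    genStepL D.c (r.vWin t : Fin d → Dist n p) + push (if t = t₀ then Δv else 0) 0 := by
  have h1 := h.generator t
  rw [delayFilter_eq hD.c_zero] at h1
  have h2 : r.vWin ((t : ℤ) + 1) = push (r.v t) (r.vWin t : Fin d → Dist n p) := by
    have : r.vWin ((t : ℤ) + 1) = fun i : Fin d => r.v ((t : ℤ) - (i : ℕ)) := by
      funext i; show r.v ((t : ℤ) + 1 - 1 - (i : ℕ)) = _
      congr 1; ring
    rw [this, window_succ]; rfl
  have h3 : r.v t = genNext D.c (r.vWin t : Fin d → Dist n p) + (if t = t₀ then Δv else 0) := by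
    rw [← h1]; exact (add_sub_cancel _ _).symm
  rw [h2, genStepL_apply, genStep, ← push_add, add_zero, ← h3]

end

theorem exists_norm_le_of_mem {E : Type*} [NormedAddCommGroup E] {X : Set E} (hX : Bornology.IsBounded X)
    {s : ℤ → E} (hs : ∀ t : ℕ, s t ∈ X) (a : ℤ) : ∃ B, 0 ≤ B ∧ ∀ t, a ≤ t → ‖s t‖ ≤ B := by
  obtain ⟨B, hB⟩ := (hX.union ((Set.finite_Icc a 0).image s).isBounded).exists_norm_le
  refine ⟨max B 0, le_max_right _ _, fun t ht => (hB _ ?_).trans (le_max_left _ _)⟩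
  rcases le_or_gt t 0 with h0 | h0
  · exact Or.inr ⟨t, ⟨ht, h0⟩, rfl⟩
  · obtain ⟨k, rfl⟩ := Int.eq_ofNat_of_zero_le h0.le
    exact Or.inl (hs k)

/-- Under the constraints, the extended state is bounded if the disturbance state is: the output window
is recovered from the states and the disturbance. -/
theorem exists_norm_ext_le (hD : D.Standing) (hXU : r.SatisfiesConstraints D) {K : ℝ} (T : ℕ)
    (hK : ∀ t : ℕ, ‖D.Tv (r.ext D ((t + T : ℕ) : ℤ))‖ ≤ K) :
    ∃ M, ∀ t : ℕ, ‖r.ext D ((t + T : ℕ) : ℤ)‖ ≤ M := by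
  obtain ⟨Bx, hBx0, hBx⟩ := exists_norm_le_of_mem hD.X_compact.isBounded (fun t => (hXU t).1) (-(d : ℤ))
  obtain ⟨Bu, hBu0, hBu⟩ := exists_norm_le_of_mem hD.U_compact.isBounded (fun t => (hXU t).2) (-(d : ℤ))
  obtain ⟨KC, hKC, hC⟩ := exists_norm_map_le D.C.mulVecLin
  have hK0 : 0 ≤ K := (norm_nonneg _).trans (hK 0)
  refine ⟨max (∑ i ∈ Finset.range (d + 1), |D.c i| * Bx) (max (KC * Bx + K) (max Bx Bu)), fun t => ?_⟩
  refine norm_prod_le_iff.2 ⟨le_max_of_le_left ?_, le_max_of_le_right (norm_prod_le_iff.2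
    ⟨le_max_of_le_left ?_, le_max_of_le_right (norm_prod_le_iff.2 ⟨le_max_of_le_left ?_,
      le_max_of_le_right ?_⟩)⟩)⟩
  · have h1 : (r.ext D ((t + T : ℕ) : ℤ)).1 =
      ∑ i ∈ Finset.range (d + 1), D.c i • r.x (((t + T : ℕ) : ℤ) - (i : ℕ)) := rfl
    rw [h1]
    refine (norm_sum_le _ _).trans (Finset.sum_le_sum fun i hi => ?_)
    have hi' := Finset.mem_range.1 hi
    rw [norm_smul, Real.norm_eq_abs]
    exact mul_le_mul_of_nonneg_left (hBx _ (by omega)) (abs_nonneg _)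
  · refine (pi_norm_le_iff_of_nonneg (by positivity)).2 fun i => ?_
    have h1 : r.e (((t + T : ℕ) : ℤ) - (i : ℕ)) = D.C *ᵥ r.x (((t + T : ℕ) : ℤ) - (i : ℕ)) +
      (D.Tv (r.ext D ((t + T : ℕ) : ℤ)) i).2 := (add_sub_cancel _ _).symm
    show ‖r.e (((t + T : ℕ) : ℤ) - (i : ℕ))‖ ≤ _
    rw [h1]
    refine (norm_add_le _ _).trans (add_le_add ((hC _).trans ?_)
      ((norm_snd_le _).trans ((norm_le_pi_norm _ i).trans (hK t))))
    exact mul_le_mul_of_nonneg_left (hBx _ (by omega)) hKC.le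
  · exact (pi_norm_le_iff_of_nonneg hBx0).2 fun i => hBx _ (by omega)
  · exact (pi_norm_le_iff_of_nonneg hBu0).2 fun i => hBu _ (by omega)

/-- The nominal part of the disturbance follows the signal generator from the initial window on;
what a jump adds to it remains bounded by the jump and is treated as part of `w`. -/
theorem exists_split (hD : D.Standing) (h : r.IsClosedLoop D t₀ Δv) {K : ℝ} (hK0 : 0 ≤ K)
    (hK : ∀ (t : ℕ) (w : Fin d → Dist n p), ‖(genStep D.c)^[t] w‖ ≤ K * ‖w‖)
    (hw : ∀ (t : ℕ) (f : Dist n p), ‖f‖ ≤ K * ‖Δv‖ → r.w t + f ∈ D.Wc) (t : ℕ) :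
    ∃ wW : DistWindow n p d, D.Tv (r.ext D t) = (genStep D.c)^[t] (r.vWin 0) + wW ∧ ∀ i, wW i ∈ D.Wc := by
  have hc := hD.c_zero
  have hcd := hD.c_last
  obtain ⟨s, -, hs⟩ := exists_solution hc hcd (r.vWin 0 : Fin d → Dist n p)
  -- the deviation of the disturbance state from its jump-free continuation
  set E : ℕ → DistWindow n p d := fun t => r.vWin t - (genStep D.c)^[t] (r.vWin 0) with hE
  have hE0 : E 0 = 0 := sub_self _
  have hEs : ∀ t, E (t + 1) = genStepL D.c (E t) + push (if t = t₀ then Δv else 0) 0 := fun t => by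
    have h1 := vWin_succ hD h t
    have h2 : E (t + 1) = r.vWin ((t : ℤ) + 1) - (genStep D.c)^[t + 1] (r.vWin 0) := by
      rw [hE]; push_cast; rfl
    rw [h2, h1, Function.iterate_succ_apply', hE, map_sub, ← genStepL_apply]
    abel
  have hpush0 : push (0 : Dist n p) (0 : Fin d → Dist n p) = 0 := by funext i; simp [push]
  have hEle : ∀ t, t ≤ t₀ → E t = 0 := by
    intro t
    induction t with
    | zero => intro _; exact hE0
    | succ t ih =>
      intro ht
      rw [hEs, ih (by omega), map_zero, if_neg (by omega), hpush0, add_zero]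
  have hEgt : ∀ k, E (t₀ + 1 + k) = (genStep D.c)^[k] (push Δv 0) := by
    intro k
    induction k with
    | zero => rw [add_zero, hEs, hEle t₀ le_rfl, map_zero, if_pos rfl, zero_add]; rfl
    | succ k ih =>
      rw [← add_assoc, hEs, ih, if_neg (by omega), hpush0, add_zero, Function.iterate_succ_apply']; rfl
  have hEn : ∀ t, ‖E t‖ ≤ K * ‖Δv‖ := fun t => by
    rcases Nat.lt_or_ge t₀ t with ht | ht
    · obtain ⟨k, rfl⟩ := Nat.exists_eq_add_of_le (Nat.succ_le_of_lt ht)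
      rw [Nat.succ_eq_add_one, hEgt]
      refine (hK _ _).trans (mul_le_mul_of_nonneg_left ?_ hK0)
      refine (pi_norm_le_iff_of_nonneg (norm_nonneg _)).2 fun i => ?_
      simp only [push]; split
      · exact le_rfl
      · simp
    · rw [hEle t ht, norm_zero]; positivity
  have hEf : ∀ (t : ℕ) (i : Fin d), E t i = r.v ((t : ℤ) - 1 - (i : ℕ)) - s ((t : ℤ) - 1 - (i : ℕ) + 1) :=
    fun t i => by
    rw [show (t : ℤ) - 1 - (i : ℕ) + 1 = t - (i : ℕ) by ring, hs]; rfl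
  refine ⟨fun i => r.w ((t : ℤ) - 1 - (i : ℕ)) + E t i, ?_, fun i => ?_⟩
  · rw [Tv_ext hD h]
    funext i
    have : ((genStep D.c)^[t] (r.vWin 0) + fun i : Fin d => r.w ((t : ℤ) - 1 - (i : ℕ)) + E t i) i =
      (genStep D.c)^[t] (r.vWin 0) i + (r.w ((t : ℤ) - 1 - (i : ℕ)) + (r.v ((t : ℤ) - 1 - (i : ℕ)) -
        (genStep D.c)^[t] (r.vWin 0) i)) := rfl
    rw [this]; abel
  · have hi := i.2
    by_cases hj : 0 ≤ (t : ℤ) - 1 - (i : ℕ)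
    · obtain ⟨k, hk⟩ := Int.eq_ofNat_of_zero_le hj
      dsimp only
      rw [hk]
      exact hw k _ ((norm_le_pi_norm _ i).trans (hEn t))
    -- entries from the initialization phase coincide with the initial window
    · have h1 : E t i = 0 := by
        have h2 := hEf 0 ⟨(i : ℕ) - t, by omega⟩
        rw [hE0] at h2
        have h3 : ((0 : ℕ) : ℤ) - 1 - ((⟨(i : ℕ) - t, by omega⟩ : Fin d) : ℕ) = (t : ℤ) - 1 - (i : ℕ) := by
          simp only; omega
        rw [h3] at h2
        rw [hEf, ← h2]; rfl
      dsimp only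
      rw [h1, add_zero, Wc_eq]
      exact subset_convexHull ℝ _ (h.w_mem _ (by omega))

/-- The guarantees hold if the disturbance `w` leaves room for the effect of the jump. -/
theorem IsClosedLoop.guarantees (hD : D.Standing) (h : r.IsClosedLoop D t₀ Δv) {K : ℝ} (hK0 : 0 ≤ K)
    (hK : ∀ (t : ℕ) (w : Fin d → Dist n p), ‖(genStep D.c)^[t] w‖ ≤ K * ‖w‖)
    (hw : ∀ (t : ℕ) (f : Dist n p), ‖f‖ ≤ K * ‖Δv‖ → r.w t + f ∈ D.Wc) : r.Guarantees D := by
  have hS : D.S.Nonempty := h.init_feasible.elim fun z hz => ⟨_, hz.init_loop⟩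
  choose wW hwW hwWc using exists_split hD h hK0 hK hw
  have hstep : ∀ t : ℕ, D.IsOptimal (r.ext D t) (r.vbar t) (r.sol t) →
      r.u t = D.predInput (r.sol t) 0 + D.K (r.ext D t - (r.sol t).ξ0) →
      r.vbar t - (genStep D.c)^[t] (r.vWin 0) ∈ D.V →
      D.IsFeasible (r.ext D (t + 1)) (genStep D.c (D.Tv (r.sol t).ξ0)) (D.shift (ofDec (r.sol t))).dec ∧
        genStep D.c (D.Tv (r.sol t).ξ0) - (genStep D.c)^[t + 1] (r.vWin 0) ∈ D.V ∧
        (r.ext D t).x ∈ D.X ∧ r.u t ∈ D.U := by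
    intro t ho hu hv
    have e1 := ext_succ_eq_tubeStep hD h hu
    have e2 := hwW (t + 1)
    rw [Nat.cast_succ, e1, Function.iterate_succ_apply'] at e2
    have e3 := tube_step hD hS (y := ofDec (r.sol t)) ho.1 (hwW t) (hwWc t) (hwWc (t + 1)) e2 hv
    rw [e1, hu, Function.iterate_succ_apply']
    exact e3
  have hpred : ∀ t : ℕ, D.Tv (D.pred (r.sol t) 1) = genStep D.c (D.Tv (r.sol t).ξ0) := fun t =>
    Tv_shiftL hD (ofDec (r.sol t)).1
  have hinv : ∀ t : ℕ, (∃ z, D.IsFeasible (r.ext D t) (r.vbar t) z) ∧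
      r.vbar t - (genStep D.c)^[t] (r.vWin 0) ∈ D.V := by
    intro t
    induction t with
    | zero => exact ⟨h.init_feasible, h.init_vbar⟩
    | succ t ih =>
      obtain ⟨h1, h2, h3⟩ := h.control t (exists_isOptimal hD hS ih.1)
      obtain ⟨h4, h5, -, -⟩ := hstep t h1 h2 ih.2
      rw [hpred] at h3
      rw [h3, Nat.cast_succ]
      exact ⟨⟨_, h4⟩, h5⟩
  have hctrl := fun t : ℕ => h.control t (exists_isOptimal hD hS (hinv t).1)
  have hopt : ∀ t : ℕ, D.IsOptimal (r.ext D t) (r.vbar t) (ofDec (r.sol t)).dec := fun t => (hctrl t).1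
  have hbar : ∀ t : ℕ, r.vbar (t + 1) = genStep D.c (D.Tv (ofDec (r.sol t)).1.1) := fun t => by
    rw [(hctrl t).2.2, hpred]; rfl
  have hall := fun t : ℕ => hstep t (hctrl t).1 (hctrl t).2.1 (hinv t).2
  have hshift : ∀ t : ℕ, D.IsFeasible (r.ext D ((t + 1 : ℕ) : ℤ)) (r.vbar (t + 1))
      (D.shift (ofDec (r.sol t))).dec := fun t => by
    rw [hbar, Nat.cast_succ]; exact (hall t).1
  have hXU : r.SatisfiesConstraints D := fun t => by
    refine ⟨?_, (hall t).2.2.2⟩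
    have h1 := (hall t).2.2.1
    have h2 : (r.ext D t).x = r.x ((t : ℤ) - ((0 : Fin d) : ℕ)) := rfl
    rw [h2] at h1
    simpa using h1
  have href : PersistentGenerator D.c d → ∃ ζ : ℕ → ExtState n m p d, r.IsOptRefSeq D ζ := fun hp => by
    choose ζ hζ using fun t : ℕ => exists_unique_isOptRef hD hS hp (ξ := (r.sol t).ξ0)
      ⟨(r.sol t).ξa0, (hopt t).1.art_mem, (IsFeasible.Tv_eq hD (hopt t).1).symm⟩
    exact ⟨ζ, hζ⟩
  refine ⟨fun t => ⟨(hinv t).1, (hctrl t).1⟩, hXU, fun hp hiw hlam => ?_, fun hp hiw hlam hpw => ?_⟩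
  · obtain ⟨ζ, hζ⟩ := href hp
    refine ⟨ζ, hζ, ?_⟩
    obtain ⟨h1, h2⟩ := decrement_tendsto_zero_of_summable hD (ξ := fun t => r.ext D t)
      (y := fun t => ofDec (r.sol t)) hopt hshift (K := 0) fun t => by simp [hlam]
    have h3 := dev_tendsto_zero_of_decrement hD hiw hopt h2 fun i _ => (tendsto_add_atTop_iff_nat i).2 h1
    exact sub_optRef_tendsto_zero hD hS hp hopt h3 fun t => (hζ t).1
  · obtain ⟨ζ, hζ⟩ := href hp
    refine ⟨ζ, hζ, ?_⟩
    -- after the jump, the increments of the disturbances vanish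
    set T := t₀ + 1 with hT
    set ξ' : ℕ → ExtState n m p d := fun t => r.ext D ((t + T : ℕ) : ℤ) with hξ'
    set y' : ℕ → DecVec n m p d N := fun t => ofDec (r.sol (t + T)) with hy'
    have hopt' : ∀ t, D.IsOptimal (ξ' t) (r.vbar (t + T)) (y' t).dec := fun t => hopt (t + T)
    have hT1 : ∀ t, t + 1 + T = t + T + 1 := fun t => by ring
    have hnext : ∀ t, ξ' (t + 1) = D.tubeStep (ξ' t) (y' t) 0 := fun t => by
      have h1 := ext_succ_eq_tubeStep hD h (hctrl (t + T)).2.1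
      have h2 : delayFilter D.c d (fun s => r.v s + r.w s) ((t + T : ℕ) : ℤ) = 0 := by
        rw [delayFilter_add, h.generator, hpw, if_neg (by omega), add_zero]
      rw [h2] at h1
      simp only [hξ', hy', hT1]
      rw [Nat.cast_succ]; exact h1
    have hgen : ∀ t, D.Tv (ξ' (t + 1)) = genStep D.c (D.Tv (ξ' t)) := fun t => by
      rw [hnext]; exact Tv_step hD.c_zero hD.c_last _ _
    have hbar' : ∀ t, r.vbar (t + 1 + T) = genStep D.c (D.Tv (y' t).1.1) := fun t => by
      rw [hT1]; exact hbar (t + T)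
    have hshift' : ∀ t, D.IsFeasible (ξ' (t + 1)) (r.vbar (t + 1 + T)) (D.shift (y' t)).dec := fun t => by
      have h1 := hshift (t + T)
      simp only [hξ', hT1]
      exact h1
    obtain ⟨M, hM⟩ := exists_norm_ext_le hD hXU (K := K * ‖D.Tv (ξ' 0)‖) T fun t => by
      have h1 := (Tv_init_eq hD hopt' hgen hbar' t).1
      rw [← genStep_iterate] at h1
      have h2 : D.Tv (r.ext D ((t + T : ℕ) : ℤ)) = (genStep D.c)^[t] (D.Tv (ξ' 0)) := h1
      rw [h2]
      exact hK _ _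
    obtain ⟨h1, h2⟩ := dev_tendsto_zero_of_nominal hD hS hp hiw hopt' hshift' hnext hgen hbar' hM
    have h3 := sub_optRef_tendsto_zero hD hS hp hopt' h1 (ζ := fun t => ζ (t + T)) fun t => (hζ (t + T)).1
    have h4 := eWin_sub_tendsto_zero hD (fun t => (hopt' t).1.art_mem) hnext h1 h2
    refine ⟨(tendsto_add_atTop_iff_nat T).1 h3, (tendsto_add_atTop_iff_nat T).1 ?_⟩
    have h5 := (continuous_apply (0 : Fin d)).tendsto (0 : Fin d → Fin p → ℝ) |>.comp h4
    have h6 := (tendsto_linear_zero ExtState.eL h3)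
    have h7 := h5.add h6
    simp only [Pi.zero_apply, add_zero] at h7
    refine h7.congr fun t => ?_
    have e1 : (ξ' t - (y' t).1.1).eWin 0 = (ξ' t).e - (y' t).1.1.e := rfl
    have e2 : ExtState.eL ((y' t).1.1 - ζ (t + T)) = (y' t).1.1.e - (ζ (t + T)).e := rfl
    have e3 : (ξ' t).e = r.e (((t + T : ℕ) : ℤ) - ((0 : Fin d) : ℕ)) := rfl
    simp only [Function.comp_def, e1, e2, e3]
    simp

end Run

end TubeMPC

end

theorem theorem1 {n m p d N : ℕ} [NeZero d] (D : TubeMPC.Data n m p d N) (hD : D.Standing) :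
    (∀ r : TubeMPC.Run n m p d N, r.IsClosedLoop D 0 0 → r.Guarantees D) ∧
    (∀ σ₁ ∈ Set.Ico (0 : ℝ) 1, ∀ σ₂ ∈ Set.Ico (0 : ℝ) 1, ∃ ε > 0,
      ∀ (t₀ : ℕ) (Δv : TubeMPC.Dist n p), ‖Δv‖ < ε →
        ∀ r : TubeMPC.Run n m p d N, r.IsClosedLoop D t₀ Δv →
          (∀ t : ℕ, r.w t ∈ σ₁ • D.W) → r.vbar t₀ - r.vWin t₀ ∈ σ₂ • D.V →
          r.Guarantees D) := by
  obtain ⟨K, hK, hgen⟩ := TubeMPC.genStep_iterate_bounded (E := TubeMPC.Dist n p) hD.c_zero hD.c_last hD.stable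
  refine ⟨fun r h => h.guarantees hD hK.le hgen fun t f hf => ?_, fun σ₁ hσ₁ _ _ => ?_⟩
  · rw [norm_zero, mul_zero, norm_le_zero_iff] at hf
    rw [hf, add_zero, TubeMPC.Data.Wc_eq]
    exact subset_convexHull ℝ _ (h.w_mem _ (by omega))
  obtain ⟨ρ, hρ, hball⟩ := Metric.mem_nhds_iff.1 (TubeMPC.Data.Wc_mem_nhds hD)
  have h1 : 0 < 1 - σ₁ := sub_pos.2 hσ₁.2
  -- the generator amplifies the jump by at most `K`, and `σ₁ W` leaves a ball of radius `(1 - σ₁) ρ`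
  -- in the convex hull of `W`
  refine ⟨(1 - σ₁) * ρ / K, by positivity, fun t₀ Δv hΔ r h hw _ =>
    h.guarantees hD hK.le hgen fun t f hf => ?_⟩
  obtain ⟨w, hwW, hwt⟩ := hw t
  have hw' : w ∈ D.Wc := by rw [TubeMPC.Data.Wc_eq]; exact subset_convexHull ℝ _ hwW
  have hf' : (1 - σ₁)⁻¹ • f ∈ D.Wc := by
    refine hball ?_
    rw [mem_ball_zero_iff, norm_smul, norm_inv, Real.norm_eq_abs, abs_of_pos h1, inv_mul_lt_iff₀ h1]
    rw [lt_div_iff₀ hK] at hΔ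
    linarith
  have hconv : Convex ℝ D.Wc := by rw [TubeMPC.Data.Wc_eq]; exact convex_convexHull ℝ _
  have h2 := hconv hw' hf' hσ₁.1 h1.le (by ring)
  rwa [smul_inv_smul₀ h1.ne', show σ₁ • w = r.w t from hwt] at h2
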